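/- **Session types.** Session types are generated by $$S ::= \mathsf{end} \mid ?[S_1,\dots,S_n]\,S \mid\ ![S_1,\dots,S_n]\,S \mid \&\{l_i:S_i\}_{1\le i\le n} \mid \oplus\{l_i:S_i\}_{1\le i\le n} \mid \mu X.S \mid X ,$$ where the variables $X$ and the labels range over countable sets, here $\mathbb N$. All session types considered are closed and contractive (no subterm has the form $\mu X_1.\cdots\mu X_n.X_1$ with $n\ge 1$), and the labels of each branching $\&\{\dots\}$ and of each selection $\oplus\{\dots\}$ are pairwise distinct. Let $\mathrm{unfold}(\mu X.T)=\mathrm{unfold}(T[\mu X.T/X])$ and $\mathrm{unfold}(T)=T$ if $T$ is not a $\mu$-type. The size is $|\mathsf{end}|=|X|=1$, $|\mu X.T|=|T|+1$, $|?[T_1,\dots,T_n]U|=|![T_1,\dots,T_n]U|=\sum_i|T_i|+|U|+1$, $|\&\{l_i:T_i\}|=|\oplus\{l_i:T_i\}|=\sum_i|T_i|+1$. **Subtyping.** $T\le_c U$ holds if $T\mathrel{\mathcal R}U$ for some relation $\mathcal R$ such that $T\mathrel{\mathcal R}U$ always implies: - if $\mathrm{unfold}(T)=?[T_1,\dots,T_n]S_1$,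 then $\mathrm{unfold}(U)=?[U_1,\dots,U_n]S_2$ with $T_i\mathrel{\mathcal R}U_i$ for all $i$ and $S_1\mathrel{\mathcal R}S_2$; - if $\mathrm{unfold}(T)=![T_1,\dots,T_n]S_1$, then $\mathrm{unfold}(U)=![U_1,\dots,U_n]S_2$ with $U_i\mathrel{\mathcal R}T_i$ for all $i$ and $S_1\mathrel{\mathcal R}S_2$; - if $\mathrm{unfold}(T)$ is a branching, then so is $\mathrm{unfold}(U)$, every label $l$ of $\mathrm{unfold}(T)$ is a label of $\mathrm{unfold}(U)$, and the components at $l$ are related by $\mathcal R$ (that of $T$ on the left); - if $\mathrm{unfold}(T)$ is a selection, then so is $\mathrm{unfold}(U)$, every label $l$ of $\mathrm{unfold}(U)$ is a label of $\mathrm{unfold}(T)$, and the components at $l$ are related by $\mathcal R$ (that of $T$ on the left); - if $\mathrm{unfold}(T)=\mathsf{end}$, then $\mathrm{unfold}(U)=\mathsf{end}$. **Product graph.** The type LTS has the types and one further node $\mathsf{Skip}$ as nodes, and its transitions are: $T\xrightarrow{\mathsf{end}}\mathsf{Skip}$ if $\mathrm{unfold}(T)=\mathsf{end}$; $T\xrightarrow{?c}U$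 and $T\xrightarrow{?p_i}T_i$ if $\mathrm{unfold}(T)=?[T_1,\dots,T_n]U$; $T\xrightarrow{!c}U$ and $T\xrightarrow{!p_i}T_i$ if $\mathrm{unfold}(T)=![T_1,\dots,T_n]U$; $T\xrightarrow{\& l_j}T_j$ if $\mathrm{unfold}(T)=\&\{l_i:T_i\}$; $T\xrightarrow{\oplus l_j}T_j$ if $\mathrm{unfold}(T)=\oplus\{l_i:T_i\}$. Let $$\mathcal X=\{?c,\,!c,\,?p_i,\,\& l,\,\mathsf{end}\},\quad \mathcal Y=\{?p_i,\,\oplus l,\,\mathsf{end}\},\quad \mathcal Z=\mathcal W=\{!p_i\}$$ ($i$ and $l$ arbitrary). A pair $(N,M)$ of nodes is *inconsistent* if some $\alpha\in\mathcal X\cup\mathcal Z$ is enabled at $N$ but not at $M$, or some $\alpha\in\mathcal Y\cup\mathcal W$ is enabled at $M$ but not at $N$, or $N,M$ are types whose unfoldings have different outermost constructors. The top-down subterms $\mathrm{Sub}(T)$ are given by the least solution of $\mathrm{Sub}(\mu X.T)=\{\mu X.T\}\cup\mathrm{Sub}(T[\mu X.T/X])$, where for every other constructor $\mathrm{Sub}(T)$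 consists of $T$ and the top-down subterms of the immediate components of $T$. The product graph of $T,U$ has vertex set $V\times V$ with $V=\mathrm{Sub}(T)\cup\mathrm{Sub}(U)\cup\{\mathsf{Skip}\}$; it has an edge $(N,M)\to(N',M')$ if $N\xrightarrow{\alpha}N'$ and $M\xrightarrow{\alpha}M'$ for some $\alpha\in\mathcal X\cup\mathcal Y$, and an edge $(N,M)\to(M',N')$ if $N\xrightarrow{\alpha}N'$ and $M\xrightarrow{\alpha}M'$ for some $\alpha\in\mathcal Z\cup\mathcal W$. **Theorem.** 1. Whether $T\le_c U$ can be decided in time $O(n^2)$, where $n=|T|+|U|$, on a random access machine. Precisely: there are a fixed program and a constant $C$ such that, for all $T,U$, the program started on the prefix codes of the syntax trees of $T$ and $U$ (each constructor, arity, variable and label occupying one memory cell) halts after at most $Cn^2$ steps with output $1$ if $T\le_c U$ and output $0$ otherwise. A step is a load, a store, a copy, the writing of a constant, an addition, a truncated subtraction or a test for zero, and for every $W\geq Cn^2$ that is at least every number in the input, no number above $W$ is ever written. 2. For all $T,U$: $T\le_c U$ if and only if no inconsistent pair is reachable from $(T,U)$ in the product graph of $T,U$. -/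

import Mathlib

open scoped BigOperators

namespace SessionTypes

/-! Session types -/

/-- Raw session types. Type variables and labels are drawn from a countable set, here `ℕ`.
`inp n T U` is `?[T_1, …, T_n] U`, `out n T U` is `![T_1, …, T_n] U`,
`bra n l T` is the branching type `&{l_i : T_i}`, `sel n l T` is the selection type
`⊕{l_i : T_i}` (`1 ≤ i ≤ n`), and `mu X T` is `μX.T`. -/
inductive SType : Type
  | tend : SType
  | var (X : ℕ) : SType
  | mu (X : ℕ) (T : SType) : SType
  | inp (n : ℕ) (T : Fin n → SType) (U : SType) : SType
  | out (n : ℕ) (T : Fin n → SType) (U : SType) : SType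
  | bra (n : ℕ) (l : Fin n → ℕ) (T : Fin n → SType) : SType
  | sel (n : ℕ) (l : Fin n → ℕ) (T : Fin n → SType) : SType

namespace SType

/-- The size `|T|`. -/
def size : SType → ℕ
  | tend => 1
  | var _ => 1
  | mu _ T => T.size + 1
  | inp _ T U => (∑ i, (T i).size) + U.size + 1
  | out _ T U => (∑ i, (T i).size) + U.size + 1
  | bra _ _ T => (∑ i, (T i).size) + 1
  | sel _ _ T => (∑ i, (T i).size) + 1

/-- Free type variables. -/
def freeVars : SType → Set ℕ
  | tend => ∅
  | var X => {X}
  | mu X T => T.freeVars \ {X}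
  | inp _ T U => (⋃ i, (T i).freeVars) ∪ U.freeVars
  | out _ T U => (⋃ i, (T i).freeVars) ∪ U.freeVars
  | bra _ _ T => ⋃ i, (T i).freeVars
  | sel _ _ T => ⋃ i, (T i).freeVars

/-- Removes the leading binders: `core (μX_1. … μX_n. T) = T` if `T` is not a `μ`-type. -/
def core : SType → SType
  | mu _ T => T.core
  | T => T

/-- Contractivity: no subterm has the form `μX_1. μX_2. … μX_n. X_1` with `n ≥ 1`. -/
def Contractive : SType → Prop
  | tend => True
  | var _ => True
  | mu X T => T.core ≠ var X ∧ T.Contractive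
  | inp _ T U => (∀ i, (T i).Contractive) ∧ U.Contractive
  | out _ T U => (∀ i, (T i).Contractive) ∧ U.Contractive
  | bra _ _ T => ∀ i, (T i).Contractive
  | sel _ _ T => ∀ i, (T i).Contractive

/-- The labels of each branching and of each selection are pairwise distinct. -/
def DistinctLabels : SType → Prop
  | tend => True
  | var _ => True
  | mu _ T => T.DistinctLabels
  | inp _ T U => (∀ i, (T i).DistinctLabels) ∧ U.DistinctLabels
  | out _ T U => (∀ i, (T i).DistinctLabels) ∧ U.DistinctLabels
  | bra _ l T => Function.Injective l ∧ ∀ i, (T i).DistinctLabels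
  | sel _ l T => Function.Injective l ∧ ∀ i, (T i).DistinctLabels

/-- The session types on which subtyping is considered: closed contractive terms. -/
structure IsSessionType (T : SType) : Prop where
  closed : T.freeVars = ∅
  contractive : T.Contractive
  distinctLabels : T.DistinctLabels

/-- `subst X S T` is `T[S / X]`. Only closed `S` are ever substituted into the types that we
consider, so that no variable can be captured. -/
def subst (X : ℕ) (S : SType) : SType → SType
  | tend => tend
  | var Y => if Y = X then S else var Y
  | mu Y T => if Y = X then mu Y T else mu Y (subst X S T)
  | inp n T U => inp n (fun i => subst X S (T i)) (subst X S U)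
  | out n T U => out n (fun i => subst X S (T i)) (subst X S U)
  | bra n l T => bra n l (fun i => subst X S (T i))
  | sel n l T => sel n l (fun i => subst X S (T i))

/-- The outermost constructor of a type, as a number. -/
def tag : SType → ℕ
  | tend => 0
  | var _ => 1
  | mu _ _ => 2
  | inp _ _ _ => 3
  | out _ _ _ => 4
  | bra _ _ _ => 5
  | sel _ _ _ => 6

/-- The prefix code of a type: every node of the syntax tree contributes its constructor and one
argument (variable name or number of components), followed by its labels if there are any,
followed by the codes of its children. -/
def code : SType → List ℕ
  | tend => [0, 0]
  | var X => [1, X]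
  | mu X T => 2 :: X :: T.code
  | inp n T U => 3 :: n :: ((List.ofFn fun i => (T i).code).flatten ++ U.code)
  | out n T U => 4 :: n :: ((List.ofFn fun i => (T i).code).flatten ++ U.code)
  | bra n l T => 5 :: n :: (List.ofFn l ++ (List.ofFn fun i => (T i).code).flatten)
  | sel n l T => 6 :: n :: (List.ofFn l ++ (List.ofFn fun i => (T i).code).flatten)

end SType

open SType

/-- `Unfolds T V` means `unfold T = V`, where `unfold (μX.T) = unfold (T[μX.T / X])` and
`unfold T = T` if `T` is not a `μ`-type. -/
inductive Unfolds : SType → SType → Prop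
  | self (T : SType) (h : ∀ X S, T ≠ mu X S) : Unfolds T T
  | mu (X : ℕ) (T V : SType) (h : Unfolds (subst X (mu X T) T) V) : Unfolds (mu X T) V

/-! Coinductive subtyping -/

/-- Type simulations. Branchings and selections are compared label by label; as labels are
distinct, the condition on branchings says that the labels of `T` are among those of `U`, and
the condition on selections says that the labels of `U` are among those of `T`. -/
structure IsTypeSimulation (R : SType → SType → Prop) : Prop where
  inp : ∀ T U, R T U → ∀ n T' S₁, Unfolds T (SType.inp n T' S₁) →
    ∃ U' S₂, Unfolds U (SType.inp n U' S₂) ∧ (∀ i, R (T' i) (U' i)) ∧ R S₁ S₂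
  out : ∀ T U, R T U → ∀ n T' S₁, Unfolds T (SType.out n T' S₁) →
    ∃ U' S₂, Unfolds U (SType.out n U' S₂) ∧ (∀ i, R (U' i) (T' i)) ∧ R S₁ S₂
  bra : ∀ T U, R T U → ∀ m l T', Unfolds T (SType.bra m l T') →
    ∃ n k U', Unfolds U (SType.bra n k U') ∧ ∀ i, ∃ j, k j = l i ∧ R (T' i) (U' j)
  sel : ∀ T U, R T U → ∀ m l T', Unfolds T (SType.sel m l T') →
    ∃ n k U', Unfolds U (SType.sel n k U') ∧ ∀ j, ∃ i, l i = k j ∧ R (T' i) (U' j)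
  tend : ∀ T U, R T U → Unfolds T SType.tend → Unfolds U SType.tend

/-- Coinductive subtyping `T ≤_c U`. -/
def SubtypeC (T U : SType) : Prop :=
  ∃ R : SType → SType → Prop, IsTypeSimulation R ∧ R T U

/-! The type LTS and the product graph -/

/-- Transition labels: `end`, continuation and payload of an input, continuation and payload of
an output, branching label, selection label. -/
inductive Action : Type
  | tend : Action
  | inC : Action
  | inP (i : ℕ) : Action
  | outC : Action
  | outP (i : ℕ) : Action
  | bra (l : ℕ) : Action
  | sel (l : ℕ) : Action

/-- Nodes of the type LTS: types, and `Skip`. -/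
inductive Node : Type
  | ty (T : SType) : Node
  | skip : Node

/-- The transitions of the type LTS. -/
inductive Trans : Node → Action → Node → Prop
  | tend (T : SType) (h : Unfolds T SType.tend) : Trans (.ty T) .tend .skip
  | inC (T : SType) (n : ℕ) (T' : Fin n → SType) (U : SType)
      (h : Unfolds T (SType.inp n T' U)) : Trans (.ty T) .inC (.ty U)
  | inP (T : SType) (n : ℕ) (T' : Fin n → SType) (U : SType)
      (h : Unfolds T (SType.inp n T' U)) (i : Fin n) : Trans (.ty T) (.inP i) (.ty (T' i))
  | outC (T : SType) (n : ℕ) (T' : Fin n → SType) (U : SType)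
      (h : Unfolds T (SType.out n T' U)) : Trans (.ty T) .outC (.ty U)
  | outP (T : SType) (n : ℕ) (T' : Fin n → SType) (U : SType)
      (h : Unfolds T (SType.out n T' U)) (i : Fin n) : Trans (.ty T) (.outP i) (.ty (T' i))
  | bra (T : SType) (n : ℕ) (l : Fin n → ℕ) (T' : Fin n → SType)
      (h : Unfolds T (SType.bra n l T')) (j : Fin n) : Trans (.ty T) (.bra (l j)) (.ty (T' j))
  | sel (T : SType) (n : ℕ) (l : Fin n → ℕ) (T' : Fin n → SType)
      (h : Unfolds T (SType.sel n l T')) (j : Fin n) : Trans (.ty T) (.sel (l j)) (.ty (T' j))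

/-- Actions that the right-hand type has to match, with the derivatives related in the same
order. -/
def actX : Set Action :=
  {a | a = .inC ∨ a = .outC ∨ (∃ i, a = .inP i) ∨ (∃ l, a = .bra l) ∨ a = .tend}

/-- Actions that the left-hand type has to match, with the derivatives related in the same
order. -/
def actY : Set Action :=
  {a | (∃ i, a = .inP i) ∨ (∃ l, a = .sel l) ∨ a = .tend}

/-- Actions that the right-hand type has to match, with the derivatives related in the opposite
order. -/
def actZ : Set Action := {a | ∃ i, a = .outP i}

/-- Actions that the left-hand type has to match, with the derivatives related in the opposite
order. -/
def actW : Set Action := {a | ∃ i, a = .outP i}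

/-- `N` has a transition with label `a`. -/
def Enabled (N : Node) (a : Action) : Prop := ∃ N', Trans N a N'

/-- Inconsistent pairs of nodes: some action that has to be matched is not, or both nodes are
types and their unfoldings have different outermost constructors. -/
def Inconsistent (p : Node × Node) : Prop :=
  (∃ a ∈ actX, Enabled p.1 a ∧ ¬ Enabled p.2 a) ∨
  (∃ a ∈ actY, Enabled p.2 a ∧ ¬ Enabled p.1 a) ∨
  (∃ a ∈ actZ, Enabled p.1 a ∧ ¬ Enabled p.2 a) ∨
  (∃ a ∈ actW, Enabled p.2 a ∧ ¬ Enabled p.1 a) ∨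
  (∃ T U T' U', p = (.ty T, .ty U) ∧ Unfolds T T' ∧ Unfolds U U' ∧ T'.tag ≠ U'.tag)

/-- `TopDown S T` means that `S` is a top-down subterm of `T`; this is the least relation with
`Sub (μX.T) = {μX.T} ∪ Sub (T[μX.T / X])` and the structural clauses for the other
constructors. -/
inductive TopDown (S : SType) : SType → Prop
  | self : TopDown S S
  | mu (X : ℕ) (T : SType) (h : TopDown S (subst X (mu X T) T)) : TopDown S (mu X T)
  | inpP (n : ℕ) (T : Fin n → SType) (U : SType) (i : Fin n) (h : TopDown S (T i)) :
      TopDown S (inp n T U)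
  | inpC (n : ℕ) (T : Fin n → SType) (U : SType) (h : TopDown S U) : TopDown S (inp n T U)
  | outP (n : ℕ) (T : Fin n → SType) (U : SType) (i : Fin n) (h : TopDown S (T i)) :
      TopDown S (out n T U)
  | outC (n : ℕ) (T : Fin n → SType) (U : SType) (h : TopDown S U) : TopDown S (out n T U)
  | bra (n : ℕ) (l : Fin n → ℕ) (T : Fin n → SType) (i : Fin n) (h : TopDown S (T i)) :
      TopDown S (bra n l T)
  | sel (n : ℕ) (l : Fin n → ℕ) (T : Fin n → SType) (i : Fin n) (h : TopDown S (T i)) :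
      TopDown S (sel n l T)

/-- The components of the vertices of the product graph of `T` and `U`: the top-down subterms of
`T` and of `U`, and `Skip`. -/
def component (T U : SType) : Set Node :=
  {N | N = .skip ∨ ∃ S, N = .ty S ∧ (TopDown S T ∨ TopDown S U)}

/-- The edges of the product graph of `T` and `U`: from `(N, M)` to the pairs that have to be
related as soon as `N` and `M` are. -/
def Edge (T U : SType) (p q : Node × Node) : Prop :=
  p ∈ component T U ×ˢ component T U ∧ q ∈ component T U ×ˢ component T U ∧
  ((∃ a ∈ actX ∪ actY, Trans p.1 a q.1 ∧ Trans p.2 a q.2) ∨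
   (∃ a ∈ actZ ∪ actW, Trans p.1 a q.2 ∧ Trans p.2 a q.1))

/-! Random access machines -/

/-- A machine state: registers, and a memory that is addressed by natural numbers. -/
structure State : Type where
  reg : ℕ → ℕ
  mem : ℕ → ℕ

/-- The instructions of the random access machine (`sub` is truncated subtraction). The numbers
`d`, `a`, `b` are register names that are fixed in the program. -/
inductive Instr : Type
  | const (d c : ℕ) : Instr
  | copy (d a : ℕ) : Instr
  | add (d a b : ℕ) : Instr
  | sub (d a b : ℕ) : Instr
  | load (d a : ℕ) : Instr
  | store (a b : ℕ) : Instr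

/-- The effect of an instruction. -/
def Instr.apply : Instr → State → State
  | const d c, s => { s with reg := Function.update s.reg d c }
  | copy d a, s => { s with reg := Function.update s.reg d (s.reg a) }
  | add d a b, s => { s with reg := Function.update s.reg d (s.reg a + s.reg b) }
  | sub d a b, s => { s with reg := Function.update s.reg d (s.reg a - s.reg b) }
  | load d a, s => { s with reg := Function.update s.reg d (s.mem (s.reg a)) }
  | store a b, s => { s with mem := Function.update s.mem (s.reg a) (s.reg b) }

/-- Programs: instructions with structured control flow; the tests ask whether a register is
nonzero. -/
inductive Program : Type
  | instr (i : Instr) : Program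
  | seq (p q : Program) : Program
  | ite (r : ℕ) (p q : Program) : Program
  | loop (r : ℕ) (p : Program) : Program

/-- All registers and all memory cells hold numbers that are at most `W`. -/
def State.Bounded (W : ℕ) (s : State) : Prop := (∀ r, s.reg r ≤ W) ∧ ∀ a, s.mem a ≤ W

/-- `Exec W p s t s'`: started in the state `s`, the program `p` halts in the state `s'` after
exactly `t` steps, and no number greater than `W` is written on the way (a program that would
write such a number is stuck). Every instruction and every evaluation of a test is one step. -/
inductive Exec (W : ℕ) : Program → State → ℕ → State → Prop
  | instr (i : Instr) (s : State) (h : (i.apply s).Bounded W) :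
      Exec W (.instr i) s 1 (i.apply s)
  | seq (p q : Program) (s s₁ s₂ : State) (t₁ t₂ : ℕ) (hp : Exec W p s t₁ s₁)
      (hq : Exec W q s₁ t₂ s₂) : Exec W (.seq p q) s (t₁ + t₂) s₂
  | iteTrue (r : ℕ) (p q : Program) (s s₁ : State) (t : ℕ) (h : s.reg r ≠ 0)
      (hp : Exec W p s t s₁) : Exec W (.ite r p q) s (t + 1) s₁
  | iteFalse (r : ℕ) (p q : Program) (s s₁ : State) (t : ℕ) (h : s.reg r = 0)
      (hq : Exec W q s t s₁) : Exec W (.ite r p q) s (t + 1) s₁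
  | loopTrue (r : ℕ) (p : Program) (s s₁ s₂ : State) (t₁ t₂ : ℕ) (h : s.reg r ≠ 0)
      (hp : Exec W p s t₁ s₁) (hl : Exec W (.loop r p) s₁ t₂ s₂) :
      Exec W (.loop r p) s (t₁ + t₂ + 1) s₂
  | loopFalse (r : ℕ) (p : Program) (s : State) (h : s.reg r = 0) :
      Exec W (.loop r p) s 1 s

/-- The initial state on input `(T, U)`: the codes of `T` and `U` stand one after the other in the
memory, starting at address `0`; registers `0` and `1` hold their lengths; everything else
is `0`. -/
def initState (T U : SType) : State where
  reg r := if r = 0 then T.code.length else if r = 1 then U.code.length else 0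
  mem a := (T.code ++ U.code).getD a 0

end SessionTypes

set_option linter.unusedSimpArgs false

open scoped BigOperators

namespace SessionTypes

open SType

/-! ### Unfolding -/

/-! Statement 2. `Step R V V'` is the condition that a simulation imposes on two unfolded types. If
`T` is a subtype of `U`, then every pair reachable in the product graph is again a pair of subtypes,
or a pair of `Skip`s (`Related.edge`), and such a pair is never inconsistent. Conversely,
consistency of a pair says that its successors satisfy `Step` (`step_of_not_inconsistent`), so the
reachable pairs of types form a simulation.

Statement 1. The program works with occurrences in the syntax trees instead of types. A node, given
by its address in the code, stands for one closed type: its subterm, closed by replacing each free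
variable with the closed type of its binder. A variable jumps to its binder and a binder jumps to
its body; by `subst_close` the body of a binder stands for the unfolding of the binder. So no
substitution is ever carried out.

The first phase reads the code from left to right and writes three tables. With `L` the length of
the input, the cell `L + a` holds the parent of the node `a`, `2 * L + a` the end of its tree (the
address of the next sibling), and `3 * L + a` the target of its jump. Each node costs at most one
walk up to a binder and one pass over its children, hence `O(n)`. `ParseInv` is the invariant and
`ParseInv.step` preserves it.

The second phase is a breadth-first search on pairs of nodes. The cell `4 * L + a` holds the row
address `5 * L + a * L`, the cell `5 * L + a * L + b` marks the pair `(a, b)`, and the queue starts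
at `5 * L + L * L`. Each pair is processed once, in time proportional to the product of `weight a`
and `weight b`, where `weight` is one plus the number of children; comparing every label with every
label is affordable. As the weights add up to at most `2 * n`, the products over all pairs add up to
at most `(2 * n) ^ 2` (`ParseInv.sum_weight_le`).

Register 9 is a failure flag. All pairs in the queue are pairs of subtypes if the initial one is
(`Sound`), so failure refutes subtyping. Without failure the pairs in the queue give a simulation
(`ParseInv.subtypeC`).

Programs are verified by the weakest preconditions `vc`, which carry a clock; loops are treated by
induction with `vc_loop_unroll`. -/

theorem Unfolds.ne_mu {T V : SType} (h : Unfolds T V) (X : ℕ) (S : SType) : V ≠ SType.mu X S := by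
  induction h with
  | self T h => exact h X S
  | mu _ _ _ _ ih => exact ih

theorem Unfolds.det {T V V' : SType} (h : Unfolds T V) (h' : Unfolds T V') : V = V' := by
  induction h with
  | self T h =>
    cases h' with
    | self => rfl
    | mu X S _ _ => exact absurd rfl (h X S)
  | mu X T V _ ih =>
    cases h' with
    | self _ h => exact absurd rfl (h X T)
    | mu _ _ _ h' => exact ih h'

/-! ### Closedness, contractivity and distinct labels are preserved by unfolding. -/

namespace SType

theorem freeVars_subst_subset {S : SType} (hS : S.freeVars = ∅) (X : ℕ) (T : SType) :
    (subst X S T).freeVars ⊆ T.freeVars \ {X} := by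
  induction T with
  | tend => simp [subst, freeVars]
  | var Y =>
    by_cases h : Y = X
    · simp [subst, h, hS]
    · simp [subst, h, freeVars]
  | mu Y T ih =>
    by_cases h : Y = X
    · simp [subst, h, freeVars]
    · intro Z hZ
      simp only [subst, h, if_false, freeVars] at hZ ⊢
      exact ⟨⟨(ih hZ.1).1, hZ.2⟩, (ih hZ.1).2⟩
  | inp n T U ihT ihU =>
    intro Z hZ
    simp only [subst, freeVars, Set.mem_union, Set.mem_iUnion] at hZ
    rcases hZ with ⟨i, hi⟩ | hZ
    · exact ⟨Or.inl (Set.mem_iUnion.2 ⟨i, (ihT i hi).1⟩), (ihT i hi).2⟩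
    · exact ⟨Or.inr (ihU hZ).1, (ihU hZ).2⟩
  | out n T U ihT ihU =>
    intro Z hZ
    simp only [subst, freeVars, Set.mem_union, Set.mem_iUnion] at hZ
    rcases hZ with ⟨i, hi⟩ | hZ
    · exact ⟨Or.inl (Set.mem_iUnion.2 ⟨i, (ihT i hi).1⟩), (ihT i hi).2⟩
    · exact ⟨Or.inr (ihU hZ).1, (ihU hZ).2⟩
  | bra n l T ih =>
    intro Z hZ
    simp only [subst, freeVars, Set.mem_iUnion] at hZ
    obtain ⟨i, hi⟩ := hZ
    exact ⟨Set.mem_iUnion.2 ⟨i, (ih i hi).1⟩, (ih i hi).2⟩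
  | sel n l T ih =>
    intro Z hZ
    simp only [subst, freeVars, Set.mem_iUnion] at hZ
    obtain ⟨i, hi⟩ := hZ
    exact ⟨Set.mem_iUnion.2 ⟨i, (ih i hi).1⟩, (ih i hi).2⟩

theorem subst_of_notMem_freeVars {X : ℕ} {S T : SType} (h : X ∉ T.freeVars) :
    subst X S T = T := by
  induction T with
  | tend => rfl
  | var Y =>
    have : Y ≠ X := fun e => h (by simp [freeVars, e])
    simp [subst, this]
  | mu Y T ih =>
    by_cases e : Y = X
    · simp [subst, e]
    · have : X ∉ T.freeVars := fun hX => h ⟨hX, fun hXY => e (by simpa using hXY.symm)⟩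
      simp [subst, e, ih this]
  | inp n T U ihT ihU =>
    simp only [freeVars, Set.mem_union, Set.mem_iUnion, not_or, not_exists] at h
    simp only [subst, ihU h.2, fun i => ihT i (h.1 i)]
  | out n T U ihT ihU =>
    simp only [freeVars, Set.mem_union, Set.mem_iUnion, not_or, not_exists] at h
    simp only [subst, ihU h.2, fun i => ihT i (h.1 i)]
  | bra n l T ih =>
    simp only [freeVars, Set.mem_iUnion, not_exists] at h
    simp only [subst, fun i => ih i (h i)]
  | sel n l T ih =>
    simp only [freeVars, Set.mem_iUnion, not_exists] at h
    simp only [subst, fun i => ih i (h i)]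

/-- Contractivity prevents the leading binders from binding a variable at the core. Hence the core
of a closed contractive type is never a variable. -/
theorem mem_freeVars_of_core_eq_var {S : SType} {Y : ℕ} (hS : S.Contractive)
    (h : S.core = var Y) : Y ∈ S.freeVars := by
  induction S with
  | var X => simp only [core, var.injEq] at h; simp [freeVars, h]
  | mu X T ih =>
    refine ⟨ih hS.2 h, fun e => hS.1 ?_⟩
    rw [Set.mem_singleton_iff] at e
    rw [← e]; exact h
  | _ => simp [core] at h

theorem core_eq_var_of_subst {S : SType} (hS : ∀ Y, S.core ≠ var Y) {X Y : ℕ} {T : SType}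
    (h : (subst X S T).core = var Y) : T.core = var Y := by
  induction T with
  | var Z =>
    by_cases e : Z = X
    · simp only [subst, e, if_true] at h; exact absurd h (hS Y)
    · simpa only [subst, e, if_false] using h
  | mu Z T ih =>
    by_cases e : Z = X
    · simpa only [subst, e, if_true] using h
    · simp only [subst, e, if_false, core] at h; exact ih h
  | _ => simp [subst, core] at h

/-- A new forbidden chain of binders could only end in a variable at the core of `S`, which `hc`
excludes. -/
theorem Contractive.subst {S : SType} (hS : S.Contractive) (hc : ∀ Y, S.core ≠ var Y) (X : ℕ)
    {T : SType} (hT : T.Contractive) : (subst X S T).Contractive := by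
  induction T with
  | tend => trivial
  | var Y => by_cases e : Y = X <;> simp [SType.subst, e, hS, Contractive]
  | mu Y T ih =>
    by_cases e : Y = X
    · simpa only [SType.subst, e, if_true] using hT
    · simp only [SType.subst, e, if_false]
      exact ⟨fun h => hT.1 (core_eq_var_of_subst hc h), ih hT.2⟩
  | inp n T U ihT ihU => exact ⟨fun i => ihT i (hT.1 i), ihU hT.2⟩
  | out n T U ihT ihU => exact ⟨fun i => ihT i (hT.1 i), ihU hT.2⟩
  | bra n l T ih => exact fun i => ih i (hT i)
  | sel n l T ih => exact fun i => ih i (hT i)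

theorem DistinctLabels.subst {S : SType} (hS : S.DistinctLabels) (X : ℕ)
    {T : SType} (hT : T.DistinctLabels) : (subst X S T).DistinctLabels := by
  induction T with
  | tend => trivial
  | var Y => by_cases e : Y = X <;> simp [SType.subst, e, hS, DistinctLabels]
  | mu Y T ih =>
    by_cases e : Y = X
    · simpa only [SType.subst, e, if_true] using hT
    · simp only [SType.subst, e, if_false]
      exact ih hT
  | inp n T U ihT ihU => exact ⟨fun i => ihT i (hT.1 i), ihU hT.2⟩
  | out n T U ihT ihU => exact ⟨fun i => ihT i (hT.1 i), ihU hT.2⟩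
  | bra n l T ih => exact ⟨hT.1, fun i => ih i (hT.2 i)⟩
  | sel n l T ih => exact ⟨hT.1, fun i => ih i (hT.2 i)⟩

/-- The number of leading binders. -/
def leading : SType → ℕ
  | mu _ T => T.leading + 1
  | _ => 0

/-- New leading binders could only appear if `X` itself were at the core. So unfolding a contractive
binder lowers the number of leading binders by one, which is why `unfold` terminates. -/
theorem leading_subst {S : SType} {X : ℕ} {T : SType} (h : T.core ≠ var X) :
    (subst X S T).leading = T.leading := by
  induction T with
  | var Y =>
    have : Y ≠ X := fun e => h (by simp [core, e])
    simp [subst, this]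
  | mu Y T ih =>
    by_cases e : Y = X
    · simp [subst, e]
    · simp only [subst, e, if_false, leading]
      rw [ih h]
  | _ => simp [subst, leading]

end SType

namespace SType.IsSessionType

theorem core_ne_var {T : SType} (h : T.IsSessionType) (Y : ℕ) : T.core ≠ var Y := fun e => by
  have := mem_freeVars_of_core_eq_var h.contractive e
  simp [h.closed] at this

theorem unfold_mu {X : ℕ} {T : SType} (h : (mu X T).IsSessionType) :
    (subst X (mu X T) T).IsSessionType where
  closed := by
    refine Set.subset_empty_iff.1 ((freeVars_subst_subset h.closed X T).trans ?_)
    exact h.closed.subset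
  contractive := h.contractive.subst (core_ne_var h) X h.contractive.2
  distinctLabels := DistinctLabels.subst (S := mu X T) h.distinctLabels X h.distinctLabels

theorem inp {n : ℕ} {T : Fin n → SType} {U : SType} (h : (SType.inp n T U).IsSessionType) :
    (∀ i, (T i).IsSessionType) ∧ U.IsSessionType := by
  have hc := h.closed
  simp only [freeVars, Set.union_empty_iff, Set.iUnion_eq_empty] at hc
  exact ⟨fun i => ⟨hc.1 i, h.contractive.1 i, h.distinctLabels.1 i⟩,
    ⟨hc.2, h.contractive.2, h.distinctLabels.2⟩⟩

theorem out {n : ℕ} {T : Fin n → SType} {U : SType} (h : (SType.out n T U).IsSessionType) :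
    (∀ i, (T i).IsSessionType) ∧ U.IsSessionType := by
  have hc := h.closed
  simp only [freeVars, Set.union_empty_iff, Set.iUnion_eq_empty] at hc
  exact ⟨fun i => ⟨hc.1 i, h.contractive.1 i, h.distinctLabels.1 i⟩,
    ⟨hc.2, h.contractive.2, h.distinctLabels.2⟩⟩

theorem bra {n : ℕ} {l : Fin n → ℕ} {T : Fin n → SType}
    (h : (SType.bra n l T).IsSessionType) (i : Fin n) : (T i).IsSessionType := by
  have hc := h.closed
  simp only [freeVars, Set.iUnion_eq_empty] at hc
  exact ⟨hc i, h.contractive i, h.distinctLabels.2 i⟩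

theorem sel {n : ℕ} {l : Fin n → ℕ} {T : Fin n → SType}
    (h : (SType.sel n l T).IsSessionType) (i : Fin n) : (T i).IsSessionType := by
  have hc := h.closed
  simp only [freeVars, Set.iUnion_eq_empty] at hc
  exact ⟨hc i, h.contractive i, h.distinctLabels.2 i⟩

theorem not_var {X : ℕ} (h : (var X).IsSessionType) : False := by
  have := h.closed
  simp [freeVars] at this

theorem exists_unfolds {T : SType} (h : T.IsSessionType) : ∃ V, Unfolds T V := by
  induction hk : T.leading using Nat.strong_induction_on generalizing T with
  | _ k ih =>
    cases T with
    | mu X T =>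
      have hl : (subst X (mu X T) T).leading = T.leading := leading_subst h.contractive.1
      obtain ⟨V, hV⟩ := ih T.leading (by simp only [← hk, leading]; omega)
        h.unfold_mu hl
      exact ⟨V, .mu _ _ _ hV⟩
    | _ => exact ⟨_, .self _ (by simp)⟩

theorem unfolds {T V : SType} (h : T.IsSessionType) (hV : Unfolds T V) : V.IsSessionType := by
  induction hV with
  | self => exact h
  | mu X T V _ ih => exact ih h.unfold_mu

theorem topDown {S T : SType} (h : T.IsSessionType) (hS : TopDown S T) : S.IsSessionType := by
  induction hS with
  | self => exact h
  | mu X T _ ih => exact ih h.unfold_mu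
  | inpP n T U i _ ih => exact ih (h.inp.1 i)
  | inpC n T U _ ih => exact ih h.inp.2
  | outP n T U i _ ih => exact ih (h.out.1 i)
  | outC n T U _ ih => exact ih h.out.2
  | bra n l T i _ ih => exact ih (h.bra i)
  | sel n l T i _ ih => exact ih (h.sel i)

end SType.IsSessionType

/-! ### One step of a simulation -/

/-- The condition that a simulation imposes on a pair of unfolded types. -/
def Step (R : SType → SType → Prop) : SType → SType → Prop
  | tend, tend => True
  | inp n T U, inp n' T' U' =>
    n = n' ∧ (∀ (i : Fin n) (j : Fin n'), i.1 = j.1 → R (T i) (T' j)) ∧ R U U'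
  | out n T U, out n' T' U' =>
    n = n' ∧ (∀ (i : Fin n) (j : Fin n'), i.1 = j.1 → R (T' j) (T i)) ∧ R U U'
  | bra _ l T, bra _ l' T' => ∀ i, ∃ j, l' j = l i ∧ R (T i) (T' j)
  | sel _ l T, sel _ l' T' => ∀ j, ∃ i, l i = l' j ∧ R (T i) (T' j)
  | _, _ => False

theorem Step.mono {R R' : SType → SType → Prop} (h : ∀ T U, R T U → R' T U) {V V' : SType}
    (hs : Step R V V') : Step R' V V' := by
  cases V <;> cases V' <;> simp only [Step] at hs ⊢
  · exact ⟨hs.1, fun i j e => h _ _ (hs.2.1 i j e), h _ _ hs.2.2⟩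
  · exact ⟨hs.1, fun i j e => h _ _ (hs.2.1 i j e), h _ _ hs.2.2⟩
  · exact fun i => (hs i).imp fun j hj => ⟨hj.1, h _ _ hj.2⟩
  · exact fun i => (hs i).imp fun j hj => ⟨hj.1, h _ _ hj.2⟩

theorem Step.tag_eq {R : SType → SType → Prop} {V V' : SType} (hs : Step R V V') :
    V.tag = V'.tag := by
  cases V <;> cases V' <;> simp only [Step] at hs <;> rfl

theorem isTypeSimulation_of_step {R : SType → SType → Prop}
    (h : ∀ T U, R T U → ∃ V V', Unfolds T V ∧ Unfolds U V' ∧ Step R V V') :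
    IsTypeSimulation R := by
  constructor
  · intro T U hR n T' S₁ hT
    obtain ⟨V, V', hV, hV', hs⟩ := h T U hR
    obtain rfl := hV.det hT
    cases V' <;> simp only [Step] at hs
    obtain ⟨rfl, h1, h2⟩ := hs
    exact ⟨_, _, hV', fun i => h1 i i rfl, h2⟩
  · intro T U hR n T' S₁ hT
    obtain ⟨V, V', hV, hV', hs⟩ := h T U hR
    obtain rfl := hV.det hT
    cases V' <;> simp only [Step] at hs
    obtain ⟨rfl, h1, h2⟩ := hs
    exact ⟨_, _, hV', fun i => h1 i i rfl, h2⟩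
  · intro T U hR m l T' hT
    obtain ⟨V, V', hV, hV', hs⟩ := h T U hR
    obtain rfl := hV.det hT
    cases V' <;> simp only [Step] at hs
    exact ⟨_, _, _, hV', hs⟩
  · intro T U hR m l T' hT
    obtain ⟨V, V', hV, hV', hs⟩ := h T U hR
    obtain rfl := hV.det hT
    cases V' <;> simp only [Step] at hs
    exact ⟨_, _, _, hV', hs⟩
  · intro T U hR hT
    obtain ⟨V, V', hV, hV', hs⟩ := h T U hR
    obtain rfl := hV.det hT
    cases V' <;> simp only [Step] at hs
    exact hV'

/-- A simulation says nothing about a left-hand type that unfolds to a variable; closedness of `T`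
excludes this case. -/
theorem IsTypeSimulation.step {R : SType → SType → Prop} (hR : IsTypeSimulation R)
    {T U V V' : SType} (hT : T.IsSessionType) (h : R T U) (hV : Unfolds T V)
    (hV' : Unfolds U V') : Step R V V' := by
  cases V with
  | tend => rw [← (hR.tend _ _ h hV).det hV']; trivial
  | var X => exact (hT.unfolds hV).not_var.elim
  | mu X S => exact absurd rfl (hV.ne_mu X S)
  | inp n T' S =>
    obtain ⟨U', S₂, h1, h2, h3⟩ := hR.inp _ _ h _ _ _ hV
    rw [← h1.det hV']
    refine ⟨rfl, fun i j e => ?_, h3⟩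
    rw [← Fin.ext e]; exact h2 i
  | out n T' S =>
    obtain ⟨U', S₂, h1, h2, h3⟩ := hR.out _ _ h _ _ _ hV
    rw [← h1.det hV']
    refine ⟨rfl, fun i j e => ?_, h3⟩
    rw [← Fin.ext e]; exact h2 i
  | bra n l T' =>
    obtain ⟨_, _, _, h1, h2⟩ := hR.bra _ _ h _ _ _ hV
    rw [← h1.det hV']
    exact h2
  | sel n l T' =>
    obtain ⟨_, _, _, h1, h2⟩ := hR.sel _ _ h _ _ _ hV
    rw [← h1.det hV']
    exact h2

theorem SubtypeC.step {T U V V' : SType} (hT : T.IsSessionType) (h : SubtypeC T U)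
    (hV : Unfolds T V) (hV' : Unfolds U V') : Step SubtypeC V V' := by
  obtain ⟨R, hR, hTU⟩ := h
  exact (hR.step hT hTU hV hV').mono fun _ _ h => ⟨R, hR, h⟩

/-! ### The product graph -/

theorem TopDown.trans {A B C : SType} (h : TopDown A B) (h' : TopDown B C) : TopDown A C := by
  induction h' with
  | self => exact h
  | mu X T _ ih => exact .mu X T ih
  | inpP n T U i _ ih => exact .inpP n T U i ih
  | inpC n T U _ ih => exact .inpC n T U ih
  | outP n T U i _ ih => exact .outP n T U i ih
  | outC n T U _ ih => exact .outC n T U ih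
  | bra n l T i _ ih => exact .bra n l T i ih
  | sel n l T i _ ih => exact .sel n l T i ih

theorem Unfolds.topDown {T V : SType} (h : Unfolds T V) : TopDown V T := by
  induction h with
  | self => exact .self
  | mu X T V _ ih => exact .mu X T ih

theorem Trans.topDown {S S' : SType} {a : Action} (h : Trans (.ty S) a (.ty S')) :
    TopDown S' S := by
  cases h with
  | inC _ n T' U h => exact (TopDown.inpC _ _ _ .self).trans h.topDown
  | inP _ n T' U h i => exact (TopDown.inpP _ _ _ i .self).trans h.topDown
  | outC _ n T' U h => exact (TopDown.outC _ _ _ .self).trans h.topDown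
  | outP _ n T' U h i => exact (TopDown.outP _ _ _ i .self).trans h.topDown
  | bra _ n l T' h j => exact (TopDown.bra _ _ _ j .self).trans h.topDown
  | sel _ n l T' h j => exact (TopDown.sel _ _ _ j .self).trans h.topDown

theorem Trans.mem_component {T U S : SType} {a : Action} {N : Node} (h : Trans (.ty S) a N)
    (hS : .ty S ∈ component T U) : N ∈ component T U := by
  cases N with
  | skip => exact Or.inl rfl
  | ty S' =>
    rcases hS with hS | ⟨S'', e, hS⟩
    · cases hS
    · cases e
      exact Or.inr ⟨S', rfl, hS.imp h.topDown.trans h.topDown.trans⟩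

theorem isSessionType_of_mem_component {T U S : SType} (hT : T.IsSessionType)
    (hU : U.IsSessionType) (h : Node.ty S ∈ component T U) : S.IsSessionType := by
  rcases h with h | ⟨S', e, h⟩
  · cases h
  · cases e
    exact h.elim hT.topDown hU.topDown

/-- The pairs of nodes that stand for valid subtyping judgements. -/
def Related (p : Node × Node) : Prop :=
  p = (.skip, .skip) ∨ ∃ A B, p = (.ty A, .ty B) ∧ A.IsSessionType ∧ B.IsSessionType ∧
    SubtypeC A B

theorem Related.not_inconsistent {p : Node × Node} (hp : Related p) : ¬ Inconsistent p := by
  rcases hp with rfl | ⟨A, B, rfl, hA, hB, h⟩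
  · rintro (⟨a, _, ⟨_, h⟩, _⟩ | ⟨a, _, ⟨_, h⟩, _⟩ | ⟨a, _, ⟨_, h⟩, _⟩ | ⟨a, _, ⟨_, h⟩, _⟩ |
      ⟨_, _, _, _, h, _⟩) <;> cases h
  · obtain ⟨V, hV⟩ := hA.exists_unfolds
    obtain ⟨V', hV'⟩ := hB.exists_unfolds
    have hs := h.step hA hV hV'
    rintro (⟨a, ha, ⟨_, h1⟩, h2⟩ | ⟨a, ha, ⟨_, h1⟩, h2⟩ | ⟨a, ha, ⟨_, h1⟩, h2⟩ |
      ⟨a, ha, ⟨_, h1⟩, h2⟩ | ⟨_, _, A', B', e, h1, h2, h3⟩)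
    · cases h1 with
      | tend _ h =>
        cases hV.det h; cases V' <;> simp only [Step] at hs
        exact h2 ⟨_, .tend _ hV'⟩
      | inC _ n T' U h =>
        cases hV.det h; cases V' <;> simp only [Step] at hs
        exact h2 ⟨_, .inC _ _ _ _ hV'⟩
      | inP _ n T' U h i =>
        cases hV.det h; cases V' <;> simp only [Step] at hs
        obtain ⟨rfl, -⟩ := hs
        exact h2 ⟨_, .inP _ _ _ _ hV' i⟩
      | outC _ n T' U h =>
        cases hV.det h; cases V' <;> simp only [Step] at hs
        exact h2 ⟨_, .outC _ _ _ _ hV'⟩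
      | outP _ n T' U h i => simp [actX] at ha
      | bra _ n l T' h j =>
        cases hV.det h; cases V' <;> simp only [Step] at hs
        obtain ⟨k, hk, -⟩ := hs j
        rw [← hk] at h2
        exact h2 ⟨_, .bra _ _ _ _ hV' k⟩
      | sel _ n l T' h j => simp [actX] at ha
    · cases h1 with
      | tend _ h =>
        cases hV'.det h; cases V <;> simp only [Step] at hs
        exact h2 ⟨_, .tend _ hV⟩
      | inP _ n T' U h i =>
        cases hV'.det h; cases V <;> simp only [Step] at hs
        obtain ⟨rfl, -⟩ := hs
        exact h2 ⟨_, .inP _ _ _ _ hV i⟩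
      | sel _ n l T' h j =>
        cases hV'.det h; cases V <;> simp only [Step] at hs
        obtain ⟨k, hk, -⟩ := hs j
        rw [← hk] at h2
        exact h2 ⟨_, .sel _ _ _ _ hV k⟩
      | _ => simp [actY] at ha
    · cases h1 with
      | outP _ n T' U h i =>
        cases hV.det h; cases V' <;> simp only [Step] at hs
        obtain ⟨rfl, -⟩ := hs
        exact h2 ⟨_, .outP _ _ _ _ hV' i⟩
      | _ => simp [actZ] at ha
    · cases h1 with
      | outP _ n T' U h i =>
        cases hV'.det h; cases V <;> simp only [Step] at hs
        obtain ⟨rfl, -⟩ := hs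
        exact h2 ⟨_, .outP _ _ _ _ hV i⟩
      | _ => simp [actW] at ha
    · cases e
      rw [← hV.det h1, ← hV'.det h2] at h3
      exact h3 hs.tag_eq

/-- `Step` relates some components that carry the label of the edge, whereas the edge may use any
such components. Distinctness of the labels on the side where `Step` makes the choice identifies the
two. -/
theorem Related.edge {T U : SType} {p q : Node × Node} (hT : T.IsSessionType)
    (hU : U.IsSessionType) (hp : Related p) (h : Edge T U p q) : Related q := by
  obtain ⟨-, ⟨hq1, hq2⟩, h⟩ := h
  obtain ⟨q1, q2⟩ := q
  rcases hp with rfl | ⟨A, B, rfl, hA, hB, hAB⟩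
  · rcases h with ⟨_, _, h, _⟩ | ⟨_, _, h, _⟩ <;> cases h
  · obtain ⟨V, hV⟩ := hA.exists_unfolds
    obtain ⟨V', hV'⟩ := hB.exists_unfolds
    have hs := hAB.step hA hV hV'
    have hlV := (hA.unfolds hV).distinctLabels
    have hlV' := (hB.unfolds hV').distinctLabels
    have key : ∀ S S', q1 = .ty S → q2 = .ty S' → SubtypeC S S' → Related (q1, q2) := by
      rintro S S' rfl rfl h
      exact Or.inr ⟨S, S', rfl, isSessionType_of_mem_component hT hU hq1,
        isSessionType_of_mem_component hT hU hq2, h⟩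
    rcases h with ⟨a, ha, h1, h2⟩ | ⟨a, ha, h1, h2⟩
    · cases h1 with
      | tend _ h => cases h2; exact Or.inl rfl
      | inC _ n T' U h =>
        cases h2 with | inC _ n' T'' U' h' => ?_
        cases hV.det h; cases hV'.det h'
        exact key _ _ rfl rfl hs.2.2
      | inP _ n T' U h i =>
        generalize e : Action.inP i = a at h2
        cases h2 with | inP _ n' T'' U' h' j => ?_ | _ => cases e
        cases hV.det h; cases hV'.det h'
        exact key _ _ rfl rfl (hs.2.1 i j (by simpa using e))
      | outC _ n T' U h =>
        cases h2 with | outC _ n' T'' U' h' => ?_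
        cases hV.det h; cases hV'.det h'
        exact key _ _ rfl rfl hs.2.2
      | outP _ n T' U h i => simp [actX, actY] at ha
      | bra _ n l T' h i =>
        generalize e : Action.bra (l i) = a at h2
        cases h2 with | bra _ n' l' T'' h' j => ?_ | _ => cases e
        cases hV.det h; cases hV'.det h'
        obtain ⟨k, hk, h⟩ := hs i
        rw [Action.bra.injEq] at e
        obtain rfl := hlV'.1 (hk.trans e)
        exact key _ _ rfl rfl h
      | sel _ n l T' h i =>
        generalize e : Action.sel (l i) = a at h2
        cases h2 with | sel _ n' l' T'' h' j => ?_ | _ => cases e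
        cases hV.det h; cases hV'.det h'
        obtain ⟨k, hk, h⟩ := hs j
        rw [Action.sel.injEq] at e
        obtain rfl := hlV.1 (hk.trans e.symm)
        exact key _ _ rfl rfl h
    · cases h1 with
      | outP _ n T' U h i =>
        generalize e : Action.outP i = a at h2
        cases h2 with | outP _ n' T'' U' h' j => ?_ | _ => cases e
        cases hV.det h; cases hV'.det h'
        exact key _ _ rfl rfl (hs.2.1 i j (by simpa using e))
      | _ => simp [actZ, actW] at ha

/-- The relation under `Step` is that of being one edge away, with the two orders of the product
graph. Equal constructors come from the last clause of `Inconsistent`, the rest from the actions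
that must be matched. -/
theorem step_of_not_inconsistent {A B V V' : SType} (hA : A.IsSessionType)
    (hV : Unfolds A V) (hV' : Unfolds B V') (h : ¬ Inconsistent (.ty A, .ty B)) :
    Step (fun S S' =>
      (∃ a ∈ actX ∪ actY, Trans (.ty A) a (.ty S) ∧ Trans (.ty B) a (.ty S')) ∨
      (∃ a ∈ actZ ∪ actW, Trans (.ty A) a (.ty S') ∧ Trans (.ty B) a (.ty S))) V V' := by
  simp only [Inconsistent, not_or] at h
  obtain ⟨hX, hY, hZ, hW, ht⟩ := h
  have ht : V.tag = V'.tag := by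
    by_contra e
    exact ht ⟨_, _, _, _, rfl, hV, hV', e⟩
  cases V <;> cases V' <;> try (simp [tag] at ht; done)
  · trivial
  · exact (hA.unfolds hV).not_var
  · exact absurd rfl (hV.ne_mu _ _)
  · rename_i n T U n' T' U'
    -- Payload indices start at 0, so the action indexed by the smaller arity is enabled at the type
    -- with the larger arity only.
    obtain rfl : n = n' := by
      rcases lt_trichotomy n n' with hlt | e | hlt
      · refine absurd ⟨.inP n, by simp [actY], ⟨_, .inP _ _ _ _ hV' ⟨n, hlt⟩⟩, ?_⟩ hY
        rintro ⟨_, h⟩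
        generalize e : Action.inP n = a at h
        cases h with | inP _ n' T'' U' h' j => ?_ | _ => cases e
        cases hV.det h'
        have := j.2
        simp only [Action.inP.injEq] at e
        omega
      · exact e
      · refine absurd ⟨.inP n', by simp [actX], ⟨_, .inP _ _ _ _ hV ⟨n', hlt⟩⟩, ?_⟩ hX
        rintro ⟨_, h⟩
        generalize e : Action.inP n' = a at h
        cases h with | inP _ n' T'' U' h' j => ?_ | _ => cases e
        cases hV'.det h'
        have := j.2
        simp only [Action.inP.injEq] at e
        omega
    refine ⟨rfl, fun i j e => ?_, Or.inl ⟨.inC, by simp [actX], .inC _ _ _ _ hV,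
      .inC _ _ _ _ hV'⟩⟩
    obtain rfl := Fin.ext e
    exact Or.inl ⟨.inP i, by simp [actX], .inP _ _ _ _ hV i, .inP _ _ _ _ hV' i⟩
  · rename_i n T U n' T' U'
    obtain rfl : n = n' := by
      rcases lt_trichotomy n n' with hlt | e | hlt
      · refine absurd ⟨.outP n, by simp [actW], ⟨_, .outP _ _ _ _ hV' ⟨n, hlt⟩⟩, ?_⟩ hW
        rintro ⟨_, h⟩
        generalize e : Action.outP n = a at h
        cases h with | outP _ n' T'' U' h' j => ?_ | _ => cases e
        cases hV.det h'
        have := j.2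
        simp only [Action.outP.injEq] at e
        omega
      · exact e
      · refine absurd ⟨.outP n', by simp [actZ], ⟨_, .outP _ _ _ _ hV ⟨n', hlt⟩⟩, ?_⟩ hZ
        rintro ⟨_, h⟩
        generalize e : Action.outP n' = a at h
        cases h with | outP _ n' T'' U' h' j => ?_ | _ => cases e
        cases hV'.det h'
        have := j.2
        simp only [Action.outP.injEq] at e
        omega
    refine ⟨rfl, fun i j e => ?_, Or.inl ⟨.outC, by simp [actX], .outC _ _ _ _ hV,
      .outC _ _ _ _ hV'⟩⟩
    obtain rfl := Fin.ext e
    exact Or.inr ⟨.outP i, by simp [actZ], .outP _ _ _ _ hV i, .outP _ _ _ _ hV' i⟩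
  · rename_i n l T n' l' T'
    intro i
    by_contra hne
    refine hX ⟨.bra (l i), by simp [actX], ⟨_, .bra _ _ _ _ hV i⟩, ?_⟩
    rintro ⟨_, h⟩
    generalize e : Action.bra (l i) = a at h
    cases h with | bra _ n' l' T'' h' j => ?_ | _ => cases e
    cases hV'.det h'
    rw [Action.bra.injEq] at e
    refine hne ⟨j, e.symm, Or.inl ⟨.bra (l i), by simp [actX], .bra _ _ _ _ hV i, ?_⟩⟩
    rw [e]; exact .bra _ _ _ _ hV' j
  · rename_i n l T n' l' T'
    intro j
    by_contra hne
    refine hY ⟨.sel (l' j), by simp [actY], ⟨_, .sel _ _ _ _ hV' j⟩, ?_⟩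
    rintro ⟨_, h⟩
    generalize e : Action.sel (l' j) = a at h
    cases h with | sel _ n' l' T'' h' i => ?_ | _ => cases e
    cases hV.det h'
    rw [Action.sel.injEq] at e
    refine hne ⟨i, e.symm, Or.inl ⟨.sel (l' j), by simp [actY], ?_, .sel _ _ _ _ hV' j⟩⟩
    rw [e]; exact .sel _ _ _ _ hV i

theorem subtypeC_iff_reachable {T U : SType} (hT : T.IsSessionType) (hU : U.IsSessionType) :
    SubtypeC T U ↔ ∀ q, Relation.ReflTransGen (Edge T U) (Node.ty T, Node.ty U) q →
      ¬ Inconsistent q := by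
  constructor
  · intro h q hq
    have : Related q := by
      induction hq with
      | refl => exact Or.inr ⟨T, U, rfl, hT, hU, h⟩
      | tail _ he ih => exact ih.edge hT hU he
    exact this.not_inconsistent
  · intro h
    -- Membership in the vertex set is carried along because `Edge` requires it at both ends.
    refine ⟨fun A B => Relation.ReflTransGen (Edge T U) (.ty T, .ty U) (.ty A, .ty B) ∧
      .ty A ∈ component T U ∧ .ty B ∈ component T U, isTypeSimulation_of_step ?_,
      .refl, Or.inr ⟨T, rfl, Or.inl .self⟩, Or.inr ⟨U, rfl, Or.inr .self⟩⟩
    rintro A B ⟨hr, hA, hB⟩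
    have hA' := isSessionType_of_mem_component hT hU hA
    have hB' := isSessionType_of_mem_component hT hU hB
    obtain ⟨V, hV⟩ := hA'.exists_unfolds
    obtain ⟨V', hV'⟩ := hB'.exists_unfolds
    refine ⟨V, V', hV, hV', (step_of_not_inconsistent hA' hV hV' (h _ hr)).mono ?_⟩
    rintro S S' (⟨a, ha, h1, h2⟩ | ⟨a, ha, h1, h2⟩)
    · have h3 := h1.mem_component hA
      have h4 := h2.mem_component hB
      exact ⟨hr.tail ⟨⟨hA, hB⟩, ⟨h3, h4⟩, Or.inl ⟨a, ha, h1, h2⟩⟩, h3, h4⟩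
    · have h3 := h1.mem_component hA
      have h4 := h2.mem_component hB
      exact ⟨hr.tail ⟨⟨hA, hB⟩, ⟨h4, h3⟩, Or.inr ⟨a, ha, h1, h2⟩⟩, h4, h3⟩

/-! ### Verification conditions for the random access machine -/

/-- Verification condition of a program: started in the state `s` at time `c`, it halts in a state
and at a time that satisfy the postcondition. -/
def vc (W : ℕ) : Program → (State → ℕ → Prop) → State → ℕ → Prop
  -- Only `const` and `add` are checked against `W`: the other instructions copy or decrease numbers
  -- that are bounded already.
  | .instr (.const d v), Q, s, c =>
    v ≤ W ∧ Q { s with reg := Function.update s.reg d v } (c + 1)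
  | .instr (.copy d a), Q, s, c => Q { s with reg := Function.update s.reg d (s.reg a) } (c + 1)
  | .instr (.add d a b), Q, s, c =>
    s.reg a + s.reg b ≤ W ∧ Q { s with reg := Function.update s.reg d (s.reg a + s.reg b) } (c + 1)
  | .instr (.sub d a b), Q, s, c =>
    Q { s with reg := Function.update s.reg d (s.reg a - s.reg b) } (c + 1)
  | .instr (.load d a), Q, s, c =>
    Q { s with reg := Function.update s.reg d (s.mem (s.reg a)) } (c + 1)
  | .instr (.store a b), Q, s, c =>
    Q { s with mem := Function.update s.mem (s.reg a) (s.reg b) } (c + 1)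
  | .seq p q, Q, s, c => vc W p (vc W q Q) s c
  | .ite r p q, Q, s, c =>
    (s.reg r ≠ 0 → vc W p Q s (c + 1)) ∧ (s.reg r = 0 → vc W q Q s (c + 1))
  -- No loop invariant appears here; the existence of a run is demanded outright and is obtained by
  -- unrolling.
  | .loop r p, Q, s, c => s.Bounded W →
    ∃ t s', Exec W (.loop r p) s t s' ∧ s'.Bounded W ∧ Q s' (c + t)

theorem State.Bounded.update_reg {W : ℕ} {s : State} (h : s.Bounded W) (d : ℕ) {v : ℕ}
    (hv : v ≤ W) : State.Bounded W { s with reg := Function.update s.reg d v } := by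
  refine ⟨fun r => ?_, h.2⟩
  by_cases e : r = d
  · simpa [e] using hv
  · simpa [e] using h.1 r

theorem State.Bounded.update_mem {W : ℕ} {s : State} (h : s.Bounded W) (d : ℕ) {v : ℕ}
    (hv : v ≤ W) : State.Bounded W { s with mem := Function.update s.mem d v } := by
  refine ⟨h.1, fun r => ?_⟩
  by_cases e : r = d
  · simpa [e] using hv
  · simpa [e] using h.2 r

theorem vc_sound {W : ℕ} {p : Program} {Q : State → ℕ → Prop} {s : State} {c : ℕ}
    (h : vc W p Q s c) (hs : s.Bounded W) :
    ∃ t s', Exec W p s t s' ∧ s'.Bounded W ∧ Q s' (c + t) := by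
  induction p generalizing Q s c with
  | instr i =>
    have key : (i.apply s).Bounded W ∧ Q (i.apply s) (c + 1) := by
      cases i with
      | const d v => exact ⟨hs.update_reg d h.1, h.2⟩
      | copy d a => exact ⟨hs.update_reg d (hs.1 a), h⟩
      | add d a b => exact ⟨hs.update_reg d h.1, h.2⟩
      | sub d a b => exact ⟨hs.update_reg d ((Nat.sub_le _ _).trans (hs.1 a)), h⟩
      | load d a => exact ⟨hs.update_reg d (hs.2 _), h⟩
      | store a b => exact ⟨hs.update_mem _ (hs.1 b), h⟩
    exact ⟨1, _, .instr i s key.1, key.1, key.2⟩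
  | seq p q ihp ihq =>
    obtain ⟨t₁, s₁, h₁, hs₁, hq⟩ := ihp h hs
    obtain ⟨t₂, s₂, h₂, hs₂, hQ⟩ := ihq hq hs₁
    exact ⟨_, s₂, .seq p q s s₁ s₂ t₁ t₂ h₁ h₂, hs₂, by rwa [← add_assoc]⟩
  | ite r p q ihp ihq =>
    by_cases e : s.reg r = 0
    · obtain ⟨t, s', h', hs', hQ⟩ := ihq (h.2 e) hs
      exact ⟨_, s', .iteFalse r p q s s' t e h', hs', by rwa [add_right_comm, add_assoc] at hQ⟩
    · obtain ⟨t, s', h', hs', hQ⟩ := ihp (h.1 e) hs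
      exact ⟨_, s', .iteTrue r p q s s' t e h', hs', by rwa [add_right_comm, add_assoc] at hQ⟩
  | loop r p _ => exact h hs

/-- This takes the place of a loop rule: correctness, termination and cost of each loop are proved
by one induction that unrolls the loop once per step. -/
theorem vc_loop_unroll {W : ℕ} {r : ℕ} {p : Program} {Q : State → ℕ → Prop} {s : State} {c : ℕ}
    (h₀ : s.reg r = 0 → Q s (c + 1))
    (h₁ : s.reg r ≠ 0 → vc W p (vc W (.loop r p) Q) s (c + 1)) : vc W (.loop r p) Q s c := by
  intro hs
  by_cases e : s.reg r = 0
  · exact ⟨1, s, .loopFalse r p s e, hs, h₀ e⟩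
  · obtain ⟨t₁, s₁, h₁, hs₁, h⟩ := vc_sound (h₁ e) hs
    obtain ⟨t₂, s₂, h₂, hs₂, hQ⟩ := h hs₁
    refine ⟨_, s₂, .loopTrue r p s s₁ s₂ t₁ t₂ e h₁ h₂, hs₂, ?_⟩
    convert hQ using 1
    omega

/-! ### Auxiliary programs -/

/-- Runs programs one after the other. -/
def block : List Program → Program
  | [] => .instr (.copy 0 0)
  | [p] => p
  | p :: q :: ps => .seq p (block (q :: ps))

abbrev iconst (d c : ℕ) : Program := .instr (.const d c)
abbrev icopy (d a : ℕ) : Program := .instr (.copy d a)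
abbrev iadd (d a b : ℕ) : Program := .instr (.add d a b)
abbrev isub (d a b : ℕ) : Program := .instr (.sub d a b)
abbrev iload (d a : ℕ) : Program := .instr (.load d a)
abbrev istore (a b : ℕ) : Program := .instr (.store a b)

/-- Sets register `e` to `0` if the registers `x` and `y` agree and to a nonzero number
otherwise. -/
def compareRegs (e x y : ℕ) : Program :=
  block [isub e x y, .ite e (icopy e e) (isub e y x)]

/-- Two numbers are equal if and only if both truncated differences vanish. -/
theorem vc_compareRegs {W e x y : ℕ} (hx : x ≠ e) (hy : y ≠ e) {s : State} {c : ℕ}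
    {Q : State → ℕ → Prop}
    (h : ∀ v c', (v = 0 ↔ s.reg x = s.reg y) → c' ≤ c + 3 →
      Q { s with reg := Function.update s.reg e v } c') :
    vc W (compareRegs e x y) Q s c := by
  simp only [compareRegs, block, vc, Function.update_self, ne_eq, hx, hy, not_false_eq_true,
    Function.update_of_ne, Function.update_idem]
  exact ⟨fun h1 => h _ _ (by omega) (by omega), fun h1 => h _ _ (by omega) (by omega)⟩

/-- The number of children of a node, in terms of its constructor and its argument. -/
def childCount (t x : ℕ) : ℕ := if 4 < t then x else if 2 < t then x + 1 else t - 1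

/-- The number of labels of a node, in terms of its constructor and its argument. -/
def labelCount (t x : ℕ) : ℕ := if 4 < t then x else 0

/-- Reads the node at the address in register `b`: the registers `b + 1`, …, `b + 5` receive its
constructor, its argument, the number of its children, the address of its first child, and a
number that is nonzero for variables and binders only. -/
def readNode (b : ℕ) : Program :=
  block [iload (b + 1) b, iadd (b + 5) b 2, iload (b + 2) (b + 5), iadd (b + 4) b 3,
    iconst (b + 5) 4, isub (b + 5) (b + 1) (b + 5),
    .ite (b + 5) (block [icopy (b + 3) (b + 2), iadd (b + 4) (b + 4) (b + 2)])
      (block [isub (b + 5) (b + 1) 3,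
        .ite (b + 5) (iadd (b + 3) (b + 2) 2) (isub (b + 3) (b + 1) 2)]),
    iconst (b + 5) 3, isub (b + 5) (b + 5) (b + 1),
    .ite (b + 1) (icopy (b + 5) (b + 5)) (iconst (b + 5) 0)]

/-- Registers 2 and 3 hold the numbers 1 and 2. So the truncated differences in `readNode` compare
the constructor with 4 (branching or selection) and with 2 (input or output), and constructor minus
one is the number of children in the other cases. -/
theorem vc_readNode {W b : ℕ} (hb : 4 ≤ b) {s : State} {c : ℕ} {Q : State → ℕ → Prop}
    (h2 : s.reg 2 = 1) (h3 : s.reg 3 = 2) (hW : 4 ≤ W)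
    (hk : childCount (s.mem (s.reg b)) (s.mem (s.reg b + 1)) ≤ W)
    (hl : s.reg b + 2 + labelCount (s.mem (s.reg b)) (s.mem (s.reg b + 1)) ≤ W)
    (h : ∀ s' c', s'.mem = s.mem → s'.reg (b + 1) = s.mem (s.reg b) →
      s'.reg (b + 2) = s.mem (s.reg b + 1) →
      s'.reg (b + 3) = childCount (s.mem (s.reg b)) (s.mem (s.reg b + 1)) →
      s'.reg (b + 4) = s.reg b + 2 + labelCount (s.mem (s.reg b)) (s.mem (s.reg b + 1)) →
      (s'.reg (b + 5) = 0 ↔ s.mem (s.reg b) = 0 ∨ 3 ≤ s.mem (s.reg b)) →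
      (∀ r, r ≤ b ∨ b + 5 < r → s'.reg r = s.reg r) → c' ≤ c + 16 → Q s' c') :
    vc W (readNode b) Q s c := by
  have e2 : ∀ k, 2 ≠ b + k := fun k => by omega
  have e3 : ∀ k, 3 ≠ b + k := fun k => by omega
  have e0 : ∀ k, 0 < k → b ≠ b + k := fun k => by omega
  simp only [childCount, labelCount] at hk hl h
  simp only [readNode, block, vc, Function.update_apply, e2, e3, e0, if_false, if_true, h2, h3,
    Nat.add_left_cancel_iff, Nat.reduceEqDiff, Nat.reduceLT]
  have key : ∀ (f : ℕ → ℕ) (x3 x4 x5 c' : ℕ),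
      f (b + 1) = s.mem (s.reg b) → f (b + 2) = s.mem (s.reg b + 1) → f (b + 3) = x3 →
      f (b + 4) = x4 → f (b + 5) = x5 →
      (∀ r, r ≤ b ∨ b + 5 < r → f r = s.reg r) →
      x3 = childCount (s.mem (s.reg b)) (s.mem (s.reg b + 1)) →
      x4 = s.reg b + 2 + labelCount (s.mem (s.reg b)) (s.mem (s.reg b + 1)) →
      (x5 = 0 ↔ s.mem (s.reg b) = 0 ∨ 3 ≤ s.mem (s.reg b)) → c' ≤ c + 16 →
      Q ⟨f, s.mem⟩ c' := by
    intro f x3 x4 x5 c' h1 h2 h3 h4 h5 h6 h7 h8 h9 h10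
    exact h _ _ rfl h1 h2 (h3.trans h7) (h4.trans h8) (by rw [← h9, ← h5]) h6 h10
  clear h
  simp only [childCount, labelCount] at key
  have ne : ∀ r, r ≤ b ∨ b + 5 < r → r ≠ b + 1 ∧ r ≠ b + 2 ∧ r ≠ b + 3 ∧ r ≠ b + 4 ∧ r ≠ b + 5 :=
    fun r hr => by omega
  have split : ∀ {P P' : Prop}, (0 < s.mem (s.reg b) → P) → (s.mem (s.reg b) = 0 → P') →
      (s.mem (s.reg b) ≠ 0 → P) ∧ (s.mem (s.reg b) = 0 → 0 ≤ W ∧ P') :=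
    fun h h' => ⟨fun e => h (Nat.pos_of_ne_zero e), fun e => ⟨Nat.zero_le _, h' e⟩⟩
  -- Three ranges of the constructor, each followed by the test whether it is 0, give six paths,
  -- some of them contradictory. Goals 1 and 4 are overflow bounds.
  refine ⟨by omega, by omega, hW, fun h4 => ⟨?_, by omega, split (fun h0 => ?_) fun h0 => ?_⟩,
    fun h4 => ⟨fun h5 => ⟨?_, by omega, split (fun h0 => ?_) fun h0 => ?_⟩,
      fun h5 => ⟨by omega, split (fun h0 => ?_) fun h0 => ?_⟩⟩⟩
  on_goal 8 =>
    refine key _ (s.mem (s.reg b) - 1) (s.reg b + 2) 0 _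
      ?_ ?_ ?_ ?_ ?_ ?_ ?_ ?_ ?_ ?_
  on_goal 7 =>
    refine key _ (s.mem (s.reg b) - 1) (s.reg b + 2) (3 - s.mem (s.reg b)) _
      ?_ ?_ ?_ ?_ ?_ ?_ ?_ ?_ ?_ ?_
  on_goal 6 =>
    refine key _ (s.mem (s.reg b + 1) + 1) (s.reg b + 2) 0 _
      ?_ ?_ ?_ ?_ ?_ ?_ ?_ ?_ ?_ ?_
  on_goal 5 =>
    refine key _ (s.mem (s.reg b + 1) + 1) (s.reg b + 2) (3 - s.mem (s.reg b)) _
      ?_ ?_ ?_ ?_ ?_ ?_ ?_ ?_ ?_ ?_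
  on_goal 3 =>
    refine key _ (s.mem (s.reg b + 1)) (s.reg b + 2 + s.mem (s.reg b + 1)) 0 _
      ?_ ?_ ?_ ?_ ?_ ?_ ?_ ?_ ?_ ?_
  on_goal 2 =>
    refine key _ (s.mem (s.reg b + 1)) (s.reg b + 2 + s.mem (s.reg b + 1)) (3 - s.mem (s.reg b)) _
      ?_ ?_ ?_ ?_ ?_ ?_ ?_ ?_ ?_ ?_
  all_goals first
    | (simp [Function.update_apply]; done)
    | (intro r hr; simp [ne r hr])
    | omega
    | (split_ifs <;> omega)
    | (split_ifs at hl hk <;> omega)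

/-! ### Codes as sequences of headers -/

/-- The concatenation of the codes of some types. -/
def codes (l : List SType) : List ℕ := (l.map code).flatten

@[simp] theorem codes_nil : codes [] = [] := rfl

@[simp] theorem codes_cons (S : SType) (l : List SType) : codes (S :: l) = S.code ++ codes l := rfl

@[simp] theorem codes_append (l l' : List SType) : codes (l ++ l') = codes l ++ codes l' := by
  simp [codes]

namespace SType

/-- The immediate subterms of a type. -/
def kids : SType → List SType
  | tend => []
  | var _ => []
  | mu _ T => [T]
  | inp _ T U => List.ofFn T ++ [U]
  | out _ T U => List.ofFn T ++ [U]
  | bra _ _ T => List.ofFn T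
  | sel _ _ T => List.ofFn T

/-- The second entry of the code of a type. -/
def arg : SType → ℕ
  | tend => 0
  | var X => X
  | mu X _ => X
  | inp n _ _ => n
  | out n _ _ => n
  | bra n _ _ => n
  | sel n _ _ => n

/-- The labels of a branching or of a selection. -/
def labels : SType → List ℕ
  | bra _ l _ => List.ofFn l
  | sel _ l _ => List.ofFn l
  | _ => []

/-- All constructors share the shape header, labels, children, so reading and linking need no case
distinction on types. -/
theorem code_eq (T : SType) :
    T.code = T.tag :: T.arg :: (T.labels ++ codes T.kids) := by
  cases T <;> simp [code, codes, tag, arg, labels, kids, List.map_ofFn, Function.comp_def]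

theorem length_kids (T : SType) : T.kids.length = childCount T.tag T.arg := by
  cases T <;> simp [kids, tag, arg, childCount]

theorem length_labels (T : SType) : T.labels.length = labelCount T.tag T.arg := by
  cases T <;> simp [labels, tag, arg, labelCount]

theorem size_eq (T : SType) : T.size = (T.kids.map size).sum + 1 := by
  cases T <;> simp [kids, size, List.map_ofFn, Function.comp_def, List.sum_ofFn]

theorem kids_induction {P : SType → Prop} (h : ∀ T, (∀ S ∈ T.kids, P S) → P T) (T : SType) :
    P T := by
  induction T with
  | tend => exact h _ (by simp [kids])
  | var => exact h _ (by simp [kids])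
  | mu X T ih => exact h _ (by simpa [kids] using ih)
  | inp n T U ihT ihU =>
    refine h _ fun S hS => ?_
    simp only [kids, List.mem_append, List.mem_ofFn, List.mem_singleton] at hS
    rcases hS with ⟨i, rfl⟩ | rfl
    · exact ihT i
    · exact ihU
  | out n T U ihT ihU =>
    refine h _ fun S hS => ?_
    simp only [kids, List.mem_append, List.mem_ofFn, List.mem_singleton] at hS
    rcases hS with ⟨i, rfl⟩ | rfl
    · exact ihT i
    · exact ihU
  | bra n l T ih =>
    refine h _ fun S hS => ?_
    simp only [kids, List.mem_ofFn] at hS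
    obtain ⟨i, rfl⟩ := hS
    exact ih i
  | sel n l T ih =>
    refine h _ fun S hS => ?_
    simp only [kids, List.mem_ofFn] at hS
    obtain ⟨i, rfl⟩ := hS
    exact ih i

theorem length_code_eq (T : SType) :
    T.code.length = 2 + T.labels.length + (codes T.kids).length := by
  rw [code_eq]; simp only [List.length_cons, List.length_append]; omega

theorem two_le_length_code (T : SType) : 2 ≤ T.code.length := by
  rw [length_code_eq]; omega

theorem length_labels_le (T : SType) : T.labels.length ≤ T.kids.length := by
  rw [length_kids, length_labels, childCount, labelCount]
  split_ifs <;> omega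

/-- A node occupies two header cells and at most one label cell per child. The strict inequality
leaves one spare cell for each child, which pays for its label. -/
theorem length_code_lt (T : SType) : T.code.length < 3 * T.size := by
  induction T using kids_induction with
  | h T ih =>
    have key : ∀ l : List SType, (∀ S ∈ l, S.code.length < 3 * S.size) →
        (codes l).length + l.length ≤ 3 * (l.map size).sum := by
      intro l
      induction l with
      | nil => simp
      | cons S l ih =>
        intro h
        have h1 := h S (by simp)
        have h2 := ih fun S hS => h S (by simp [hS])
        simp only [List.map_cons, codes_cons, List.length_append, List.length_cons,
          List.sum_cons]
        omega
    have := key _ ih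
    have := T.length_labels_le
    rw [length_code_eq, size_eq]
    omega

theorem length_le_length_codes (l : List SType) :
    l.length ≤ (codes l).length := by
  induction l with
  | nil => simp
  | cons S l ih =>
    have := S.two_le_length_code
    simp only [codes_cons, List.length_append, List.length_cons]
    omega

/-! ### Closing substitutions -/

/-- Replaces all free variables according to `σ`; only closed types are ever substituted. -/
def close (σ : ℕ → SType) : SType → SType
  | tend => tend
  | var X => σ X
  | mu X T => mu X (close (Function.update σ X (var X)) T)
  | inp n T U => inp n (fun i => close σ (T i)) (close σ U)
  | out n T U => out n (fun i => close σ (T i)) (close σ U)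
  | bra n l T => bra n l fun i => close σ (T i)
  | sel n l T => sel n l fun i => close σ (T i)

theorem close_of_eq_var {σ : ℕ → SType} (T : SType) (h : ∀ X, σ X = var X) :
    T.close σ = T := by
  induction T generalizing σ with
  | tend => rfl
  | var X => exact h X
  | mu X T ih =>
    have : ∀ Y, Function.update σ X (var X) Y = var Y := fun Y => by
      by_cases e : Y = X
      · subst e; simp
      · simp [e, h]
    simp only [close, ih this]
  | inp n T U ihT ihU => simp only [close, ihU h, fun i => ihT i h]
  | out n T U ihT ihU => simp only [close, ihU h, fun i => ihT i h]
  | bra n l T ih => simp only [close, fun i => ih i h]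
  | sel n l T ih => simp only [close, fun i => ih i h]

/-- With `S` the closed type of a binder `mu X T`, the left side is the unfolding of `S` and the
right side is the closure of the body `T` in the environment extended by `X ↦ S`. The hypothesis
holds when `σ` has closed values on the remaining free variables. -/
theorem subst_close {σ : ℕ → SType} {X : ℕ} {S T : SType}
    (h : ∀ Y ∈ T.freeVars, Y ≠ X → X ∉ (σ Y).freeVars) :
    subst X S (T.close (Function.update σ X (var X))) = T.close (Function.update σ X S) := by
  induction T generalizing σ with
  | tend => rfl
  | var Y =>
    by_cases e : Y = X
    · subst e; simp [close, subst]
    · simp only [close, Function.update_of_ne e]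
      exact subst_of_notMem_freeVars (h Y rfl e)
  | mu Y T ih =>
    by_cases e : Y = X
    · subst e; simp [close, subst]
    · simp only [close, subst, e, if_false, mu.injEq, true_and]
      rw [Function.update_comm (Ne.symm e), Function.update_comm (Ne.symm e), ih]
      intro Z hZ hZX
      by_cases e' : Z = Y
      · subst e'; simpa [freeVars] using Ne.symm e
      · simpa [e'] using h Z ⟨hZ, e'⟩ hZX
  | inp n T U ihT ihU =>
    simp only [freeVars, Set.mem_union, Set.mem_iUnion] at h
    simp only [close, subst, ihU fun Y hY => h Y (Or.inr hY),
      fun i => ihT i fun Y hY => h Y (Or.inl ⟨i, hY⟩)]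
  | out n T U ihT ihU =>
    simp only [freeVars, Set.mem_union, Set.mem_iUnion] at h
    simp only [close, subst, ihU fun Y hY => h Y (Or.inr hY),
      fun i => ihT i fun Y hY => h Y (Or.inl ⟨i, hY⟩)]
  | bra n l T ih =>
    simp only [freeVars, Set.mem_iUnion] at h
    simp only [close, subst, fun i => ih i fun Y hY => h Y ⟨i, hY⟩]
  | sel n l T ih =>
    simp only [freeVars, Set.mem_iUnion] at h
    simp only [close, subst, fun i => ih i fun Y hY => h Y ⟨i, hY⟩]

/-- Types that are neither variables nor binders. -/
def IsHead (T : SType) : Prop := T.tag = 0 ∨ 3 ≤ T.tag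

theorem IsHead.close {S : SType} (h : S.IsHead) (σ : ℕ → SType) :
    (S.close σ).IsHead ∧ (S.close σ).tag = S.tag ∧ (S.close σ).arg = S.arg ∧
      (S.close σ).labels = S.labels ∧ (S.close σ).kids = S.kids.map (SType.close σ) := by
  cases S <;> first
    | (simp [IsHead, tag] at h; done)
    | simp [IsHead, SType.close, tag, arg, labels, kids, List.map_ofFn, Function.comp_def]

theorem IsHead.freeVars_kids {S S' : SType} (h : S.IsHead) (h' : S' ∈ S.kids) :
    S'.freeVars ⊆ S.freeVars := by
  cases S <;> simp only [kids, List.mem_append, List.mem_ofFn, List.mem_singleton,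
    List.not_mem_nil] at h' <;> simp only [freeVars]
  · simp [IsHead, tag] at h
  · rcases h' with ⟨i, rfl⟩ | rfl
    · exact (Set.subset_iUnion (fun i => (_ : Fin _ → SType) i |>.freeVars) i).trans
        Set.subset_union_left
    · exact Set.subset_union_right
  · rcases h' with ⟨i, rfl⟩ | rfl
    · exact (Set.subset_iUnion (fun i => (_ : Fin _ → SType) i |>.freeVars) i).trans
        Set.subset_union_left
    · exact Set.subset_union_right
  · obtain ⟨i, rfl⟩ := h'
    exact Set.subset_iUnion (fun i => (_ : Fin _ → SType) i |>.freeVars) i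
  · obtain ⟨i, rfl⟩ := h'
    exact Set.subset_iUnion (fun i => (_ : Fin _ → SType) i |>.freeVars) i

theorem IsSessionType.kids {S S' : SType} (hS : S.IsSessionType) (h : S.IsHead)
    (h' : S' ∈ S.kids) : S'.IsSessionType := by
  cases S <;> simp only [SType.kids, List.mem_append, List.mem_ofFn, List.mem_singleton,
    List.not_mem_nil] at h'
  · simp [IsHead, tag] at h
  · rcases h' with ⟨i, rfl⟩ | rfl
    · exact hS.inp.1 i
    · exact hS.inp.2
  · rcases h' with ⟨i, rfl⟩ | rfl
    · exact hS.out.1 i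
    · exact hS.out.2
  · obtain ⟨i, rfl⟩ := h'
    exact hS.bra i
  · obtain ⟨i, rfl⟩ := h'
    exact hS.sel i

end SType

/-! ### Memory contents -/

/-- The memory holds the list `l` from the address `a` on. -/
def Matches (m : ℕ → ℕ) : ℕ → List ℕ → Prop
  | _, [] => True
  | a, v :: l => m a = v ∧ Matches m (a + 1) l

theorem matches_append {m : ℕ → ℕ} {a : ℕ} {l l' : List ℕ} :
    Matches m a (l ++ l') ↔ Matches m a l ∧ Matches m (a + l.length) l' := by
  induction l generalizing a with
  | nil => simp [Matches]
  | cons v l ih =>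
    simp only [List.cons_append, Matches, ih, List.length_cons, and_assoc]
    rw [add_right_comm, add_assoc]

theorem Matches.congr {m m' : ℕ → ℕ} {a : ℕ} {l : List ℕ} (h : Matches m a l)
    (hm : ∀ x, a ≤ x → x < a + l.length → m' x = m x) : Matches m' a l := by
  induction l generalizing a with
  | nil => trivial
  | cons v l ih =>
    rw [List.length_cons] at hm
    exact ⟨(hm a le_rfl (by omega)).trans h.1, ih h.2 fun x h1 h2 => hm x (by omega) (by omega)⟩

theorem matches_of_getD {m : ℕ → ℕ} {l : List ℕ} {a : ℕ}
    (h : ∀ i < l.length, m (a + i) = l.getD i 0) : Matches m a l := by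
  induction l generalizing a with
  | nil => trivial
  | cons v l ih =>
    refine ⟨by simpa using h 0 (by simp), ih fun i hi => ?_⟩
    have := h (i + 1) (by simpa using hi)
    rw [List.getD_cons_succ] at this
    rw [← this]; congr 1; omega

theorem matches_code {m : ℕ → ℕ} {a : ℕ} {S : SType} :
    Matches m a S.code ↔ m a = S.tag ∧ m (a + 1) = S.arg ∧ Matches m (a + 2) S.labels ∧
      Matches m (a + 2 + S.labels.length) (codes S.kids) := by
  rw [code_eq]
  simp only [Matches, matches_append]

/-! ### Skipping a tree -/

/-- The constants that the program keeps in registers: `1`, `2`, and the multiples of the length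
of the input. -/
structure Consts (L : ℕ) (s : State) : Prop where
  one : s.reg 2 = 1
  two : s.reg 3 = 2
  length : s.reg 4 = L
  length2 : s.reg 5 = 2 * L
  length3 : s.reg 6 = 3 * L
  length4 : s.reg 7 = 4 * L

theorem Consts.congr {L : ℕ} {s s' : State} (h : Consts L s)
    (hr : ∀ r < 8, s'.reg r = s.reg r) : Consts L s' :=
  ⟨(hr _ (by norm_num)).trans h.one, (hr _ (by norm_num)).trans h.two,
    (hr _ (by norm_num)).trans h.length, (hr _ (by norm_num)).trans h.length2,
    (hr _ (by norm_num)).trans h.length3, (hr _ (by norm_num)).trans h.length4⟩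

/-- Moves the address in register `40` past as many trees as register `41` says. -/
def skipTrees : Program :=
  .loop 41 (block [icopy 50 40, readNode 50, iadd 41 41 53, isub 41 41 2, icopy 40 54])

/-- In a prefix code, passing a header and its labels turns the first tree of the list into the list
of its children, so a counter of outstanding trees replaces a stack. The total size drops by one per
node, which is both the induction measure and the cost. -/
theorem vc_skipTrees {W : ℕ} {ts : List SType} {s : State} {c : ℕ} {Q : State → ℕ → Prop}
    (h2 : s.reg 2 = 1) (h3 : s.reg 3 = 2) (hlen : s.reg 41 = ts.length)
    (hm : Matches s.mem (s.reg 40) (codes ts))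
    (hW : 2 * (s.reg 40 + (codes ts).length) + 4 ≤ W)
    (h : ∀ s' c', s'.mem = s.mem → s'.reg 40 = s.reg 40 + (codes ts).length →
      (∀ r < 40, s'.reg r = s.reg r) → c' ≤ c + 30 * (ts.map size).sum + 1 → Q s' c') :
    vc W skipTrees Q s c := by
  induction hk : (ts.map size).sum using Nat.strong_induction_on generalizing ts s c with
  | _ k ih =>
    cases ts with
    | nil =>
      refine vc_loop_unroll (fun _ => h _ _ rfl (by simp) (fun _ _ => rfl) (by omega)) fun h0 => ?_
      exact absurd (by simpa using hlen) h0
    | cons S r =>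
      refine vc_loop_unroll (fun h0 => absurd (hlen.symm.trans h0) (by simp)) fun _ => ?_
      have hm' := hm
      simp only [codes_cons, matches_append, matches_code] at hm'
      obtain ⟨⟨ht, ha, -, hk1⟩, hr⟩ := hm'
      have hc := S.length_code_eq
      have hkl := S.length_kids
      have hll := S.length_labels
      have hk2 := length_le_length_codes S.kids
      have hr2 := length_le_length_codes r
      have hW' := hW
      simp only [codes_cons, List.length_append] at hW
      simp only [List.length_cons] at hlen
      simp only [block, vc]
      refine vc_readNode (by norm_num) (by simp [h2]) (by simp [h3]) (by omega) ?_ ?_ ?_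
      · simp only [Function.update_self, ht, ha, ← hkl]; omega
      · simp only [Function.update_self, ht, ha, ← hll]; omega
      intro s' c' hmem _ _ e3 e4 _ hfr hc'
      dsimp only at hmem
      simp only [Function.update_self, ht, ha, ← hll, ← hkl, Nat.reduceAdd] at e3 e4
      have f : ∀ r, r < 50 → s'.reg r = s.reg r := fun r hr => by
        rw [hfr r (Or.inl hr.le)]; simp [hr.ne]
      simp only [vc, Function.update_apply, f, e3, e4, hlen, h2, Nat.reduceEqDiff, if_true,
        if_false, Nat.reduceLT]
      refine ⟨by omega, ?_⟩
      have hs := S.size_eq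
      simp only [List.map_cons, List.sum_cons] at hk h
      have hcl : (codes (S.kids ++ r)).length + 2 + S.labels.length
          = (codes (S :: r)).length := by
        simp only [codes_cons, codes_append, List.length_append]; omega
      refine ih ((S.kids ++ r).map size).sum ?_ (ts := S.kids ++ r) ?_ ?_ ?_ ?_ ?_ ?_ rfl
      · simp only [List.map_append, List.sum_append]; omega
      · simp [h2, f]
      · simp [h3, f]
      · simp [Function.update_apply, add_comm]
      · simp only [Function.update_apply]
        simp only [hmem, Nat.reduceEqDiff, if_true, if_false, codes_append, matches_append]
        refine ⟨hk1, ?_⟩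
        convert hr using 1
        rw [hc]; omega
      · simp only [Function.update_apply]
        simp only [Nat.reduceEqDiff, if_true, if_false]
        omega
      · intro s'' c'' e1 e2 e3 e4
        refine h s'' c'' (e1.trans hmem) ?_ ?_ ?_
        · simp only [Function.update_apply, Nat.reduceEqDiff, if_true, if_false] at e2
          rw [e2]; omega
        · intro r hr; rw [e3 r hr]
          have : r ≠ 40 ∧ r ≠ 41 := by omega
          simp [this, f r (by omega)]
        · simp only [List.map_append, List.sum_append] at e4; omega

/-! ### Linking the children of a node -/

/-- Stores at `L + a` the parent and at `2 * L + a` the end of the tree at `a`, for each child `a`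
of the node whose address is in register `10`. -/
def linkChildren : Program :=
  .loop 31 (block [iadd 32 4 30, istore 32 10, icopy 40 30, iconst 41 1, skipTrees,
    iadd 32 5 30, istore 32 40, icopy 30 40, isub 31 31 2])

/-- The trees `ts`, which start at the address `a`, have `p` as their parent and are linked to
their successors. -/
def Linked (m : ℕ → ℕ) (L p : ℕ) : ℕ → List SType → Prop
  | _, [] => True
  | a, S :: ts => m (L + a) = p ∧ m (2 * L + a) = a + S.code.length ∧
    Linked m L p (a + S.code.length) ts

/-- Each child is traversed once to find its end, hence the linear cost. The frame condition
confines the writes to the stretches of the two tables that belong to these children. -/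
theorem vc_linkChildren {W L : ℕ} {ts : List SType} {s : State} {c : ℕ} {Q : State → ℕ → Prop}
    (hs : Consts L s) (hlen : s.reg 31 = ts.length)
    (hm : Matches s.mem (s.reg 30) (codes ts))
    (hL : s.reg 30 + (codes ts).length ≤ L) (hW : 4 * L + 4 ≤ W)
    (h : ∀ s' c', Linked s'.mem L (s.reg 10) (s.reg 30) ts →
      (∀ x, ¬ (L + s.reg 30 ≤ x ∧ x < L + (s.reg 30 + (codes ts).length)) →
        ¬ (2 * L + s.reg 30 ≤ x ∧ x < 2 * L + (s.reg 30 + (codes ts).length)) →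
        s'.mem x = s.mem x) →
      (∀ r < 30, s'.reg r = s.reg r) → c' ≤ c + 50 * (ts.map size).sum + 1 → Q s' c') :
    vc W linkChildren Q s c := by
  induction ts generalizing s c with
  | nil =>
    refine vc_loop_unroll (fun _ => h _ _ trivial (fun _ _ _ => rfl) (fun _ _ => rfl)
      (by omega)) fun h0 => ?_
    exact absurd (by simpa using hlen) h0
  | cons S ts ih =>
    refine vc_loop_unroll (fun h0 => absurd (hlen.symm.trans h0) (by simp)) fun _ => ?_
    have h2 := S.two_le_length_code
    have hm' := hm
    simp only [codes_cons, matches_append, List.length_append] at hm' hL h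
    simp only [block, vc, Function.update_apply, Nat.reduceEqDiff, if_true, if_false, hs.length]
    refine ⟨by omega, by omega, ?_⟩
    have hM : Matches (Function.update s.mem (L + s.reg 30) (s.reg 10)) (s.reg 30)
        (codes [S]) := by
      simp only [codes_cons, codes_nil, List.append_nil]
      exact hm'.1.congr fun x h1 h3 => Function.update_of_ne (by omega) _ _
    refine vc_skipTrees (ts := [S]) ?_ ?_ ?_ ?_ ?_ ?_
    · simp [hs.one]
    · simp [hs.two]
    · simp
    · simpa [Function.update_apply] using hM
    · simp [Function.update_apply]; omega
    intro s' c' e1 e2 e3 e4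
    dsimp only at e1
    have f : ∀ r < 32, s'.reg r = s.reg r := fun r hr => by
      rw [e3 r (by omega)]
      have : r ≠ 40 ∧ r ≠ 41 ∧ r ≠ 32 := by omega
      simp [this]
    simp only [codes_cons, codes_nil, List.append_nil, Function.update_apply] at e2
    simp only [Nat.reduceEqDiff, if_true, if_false] at e2
    simp only [vc, Function.update_apply, Nat.reduceEqDiff, if_true, if_false, f, Nat.reduceLT,
      hs.length2, e2, hlen, hs.one]
    refine ⟨by omega, ?_⟩
    have hmem : ∀ x, x ≠ L + s.reg 30 → x ≠ 2 * L + s.reg 30 →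
        Function.update s'.mem (2 * L + s.reg 30) (s.reg 30 + S.code.length) x = s.mem x := by
      intro x h1 h3
      rw [Function.update_of_ne h3, e1, Function.update_of_ne h1]
    refine ih ?_ ?_ ?_ ?_ ?_
    · refine hs.congr fun r hr => ?_
      have : r ≠ 30 ∧ r ≠ 31 ∧ r ≠ 32 := by omega
      simp [this, f r (by omega)]
    · simp
    · simp only [Function.update_apply, Nat.reduceEqDiff, if_true, if_false]
      exact hm'.2.congr fun x h1 h3 => hmem x (by omega) (by omega)
    · simp only [Function.update_apply, Nat.reduceEqDiff, if_true, if_false]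
      omega
    · simp only [Function.update_apply, Nat.reduceEqDiff, if_true, if_false]
      intro s'' c'' g1 g2 g3 g4
      refine h s'' c'' ⟨?_, ?_, ?_⟩ ?_ ?_ ?_
      · rw [g2 _ (by omega) (by omega), if_neg (by omega), e1]
        simp
      · rw [g2 _ (by omega) (by omega), if_pos rfl]
      · rwa [f 10 (by norm_num)] at g1
      · intro x h1 h3
        rw [g2 _ (by omega) (by omega), ← Function.update_apply]
        exact hmem x (by omega) (by omega)
      · intro r hr
        rw [g3 r hr]
        have : r ≠ 30 ∧ r ≠ 31 ∧ r ≠ 32 := by omega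
        simp [this, f r (by omega)]
      · simp only [List.map_cons, List.map_nil, List.sum_cons, List.sum_nil] at e4 ⊢
        have := S.size_eq
        omega

/-! ### Finding the binder of a variable -/

/-- Walking up from the node at `p` along the parent links, the first binder of `X` that is met is
at the address `r`. -/
inductive BinderAbove (m : ℕ → ℕ) (L X : ℕ) : ℕ → ℕ → Prop
  | found (p : ℕ) (h : m p = 2) (h' : m (p + 1) = X) : BinderAbove m L X p p
  | up (p r : ℕ) (h : ¬ (m p = 2 ∧ m (p + 1) = X)) (hlt : m (L + p) < p)
      (hr : BinderAbove m L X (m (L + p)) r) : BinderAbove m L X p r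

theorem BinderAbove.congr {m m' : ℕ → ℕ} {L X p r : ℕ} (h : BinderAbove m L X p r)
    (hm : ∀ x ≤ p + 1, m' x = m x) (hm' : ∀ x ≤ p, m' (L + x) = m (L + x)) :
    BinderAbove m' L X p r := by
  induction h with
  | found p h h' => exact .found p (by rwa [hm _ (by omega)]) (by rwa [hm _ le_rfl])
  | up p r h hlt _ ih =>
    refine .up p r ?_ ?_ ?_
    · rwa [hm _ (by omega), hm _ le_rfl]
    · rwa [hm' _ le_rfl]
    · rw [hm' _ le_rfl]
      exact ih (fun x hx => hm x (by omega)) fun x hx => hm' x (by omega)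

/-- Walks from the node in register `27` up to the binder of the variable in register `22`, as
long as register `28` is nonzero. -/
def findBinder : Program :=
  .loop 28 (block [iload 29 27, compareRegs 28 29 3,
    .ite 28 (icopy 28 28) (block [iadd 29 27 2, iload 29 29, compareRegs 28 29 22]),
    .ite 28 (block [iadd 29 4 27, iload 27 29]) (icopy 28 28)])

/-- Parents have smaller addresses (`hlt` in `BinderAbove.up`), so the walk visits at most `p + 1`
nodes. -/
theorem vc_findBinder {W L X p b : ℕ} {s : State} {c : ℕ} {Q : State → ℕ → Prop}
    (hs : Consts L s) (hX : s.reg 22 = X) (hp : s.reg 27 = p) (hf : s.reg 28 ≠ 0)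
    {m : ℕ → ℕ} (hm : s.mem = m) (hb : BinderAbove m L X p b) (hW : L + p + 1 ≤ W)
    (h : ∀ s' c', s'.mem = m → s'.reg 27 = b → (∀ r < 27, s'.reg r = s.reg r) →
      c' ≤ c + 20 * p + 20 → Q s' c') :
    vc W findBinder Q s c := by
  induction hb generalizing s c with
  | found p h1 h2 =>
    refine vc_loop_unroll (fun h0 => absurd h0 hf) fun _ => ?_
    simp only [block, vc]
    refine vc_compareRegs (by norm_num) (by norm_num) fun v c₁ hv hc₁ => ?_
    simp [hp, hm, h1, hs.two] at hv
    subst hv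
    simp only [vc, Function.update_apply, Nat.reduceEqDiff, if_true, if_false, hp, hm, hs.one, h2]
    refine ⟨fun h => absurd rfl h, fun _ => ⟨by omega, ?_⟩⟩
    refine vc_compareRegs (by norm_num) (by norm_num) fun v c₂ hv hc₂ => ?_
    simp [hX] at hv
    subst hv
    simp only [Function.update_apply, Nat.reduceEqDiff, if_true, if_false]
    refine ⟨fun h => absurd rfl h, fun _ => ?_⟩
    refine vc_loop_unroll (fun _ => ?_) (fun h => absurd (by simp) h)
    refine h _ _ rfl (by simp [hp]) (fun r hr => ?_) (by omega)
    have : r ≠ 28 ∧ r ≠ 29 := by omega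
    simp [this]
  | up p r h1 hlt _ ih =>
    refine vc_loop_unroll (fun h0 => absurd h0 hf) fun _ => ?_
    have key : ∀ f c', f 27 = m (L + p) → f 28 ≠ 0 → (∀ r < 27, f r = s.reg r) → c' ≤ c + 16 →
        vc W findBinder Q ⟨f, m⟩ c' := by
      intro f c' h27 h28 hfr hc'
      refine ih (hs.congr fun r hr => hfr r (by omega)) ((hfr 22 (by norm_num)).trans hX) h27 h28
        rfl (by omega) fun s' c'' g1 g2 g3 g4 => h s' c'' g1 g2 (fun r hr => ?_) ?_
      · exact (g3 r hr).trans (hfr r hr)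
      · omega
    have ne : ∀ r < 27, r ≠ 27 ∧ r ≠ 28 ∧ r ≠ 29 := fun r hr => by omega
    simp only [block, vc]
    refine vc_compareRegs (by norm_num) (by norm_num) fun v c₁ hv hc₁ => ?_
    simp [hp, hm, hs.two] at hv
    simp only [vc, Function.update_apply, Nat.reduceEqDiff, if_true, if_false, hp, hm, hs.one,
      hs.length]
    refine ⟨fun hv0 => ⟨fun _ => ⟨by omega, ?_⟩, fun h0 => absurd h0 hv0⟩, fun hv0 => ⟨by omega, ?_⟩⟩
    · exact key _ _ (by simp) (by simpa using hv0) (fun r hr => by simp [ne r hr]) (by omega)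
    · refine vc_compareRegs (by norm_num) (by norm_num) fun w c₂ hw hc₂ => ?_
      simp [hX] at hw
      simp only [Function.update_apply, Nat.reduceEqDiff, if_true, if_false, hp, hm, hs.length]
      refine ⟨fun hw0 => ⟨by omega, ?_⟩, fun hw0 => absurd ⟨hv.1 hv0, hw.1 hw0⟩ h1⟩
      exact key _ _ (by simp) (by simpa using hw0) (fun r hr => by simp [ne r hr]) (by omega)

/-! ### The syntax graph -/

/-- The end of the tree at `a`. -/
def nextTree (m : ℕ → ℕ) (L a : ℕ) : ℕ := m (2 * L + a)

/-- The memory describes the type `V`, which is neither a variable nor a binder, at the node `a`,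
where `D` says which closed types belong to which nodes. -/
def HeadOK (m : ℕ → ℕ) (L : ℕ) (D : ℕ → SType → Prop) (a : ℕ) (V : SType) : Prop :=
  V.IsHead ∧ m a = V.tag ∧ m (a + 1) = V.arg ∧ Matches m (a + 2) V.labels ∧
    a + 2 + V.labels.length + V.kids.length ≤ L ∧
    ∀ i V', V.kids[i]? = some V' → D ((nextTree m L)^[i] (a + 2 + V.labels.length)) V'

/-- The memory describes the closed type `V` at the node `a`, where `D` says which closed types
belong to which nodes. -/
def NodeOK (m : ℕ → ℕ) (L : ℕ) (D : ℕ → SType → Prop) (a : ℕ) (V : SType) : Prop :=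
  (m a = 1 ∧ D (m (3 * L + a)) V ∧ m (m (3 * L + a)) = 2) ∨
  (m a = 2 ∧ ∃ X S, V = mu X S ∧ D (m (3 * L + a)) (subst X V S)) ∨
  HeadOK m L D a V

theorem NodeOK.congr {m m' : ℕ → ℕ} {L : ℕ} {D D' : ℕ → SType → Prop} {a : ℕ} {V : SType}
    (h : NodeOK m L D a V) (ha : a + 1 < L) (hD : ∀ x T, D x T → D' x T)
    (hlt : ∀ x T, D x T → x < L) (hm : ∀ x < L, m' x = m x)
    (hj : m' (3 * L + a) = m (3 * L + a))
    (hn : ∀ x T, D x T → m' (2 * L + x) = m (2 * L + x)) : NodeOK m' L D' a V := by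
  have hma := hm a (by omega)
  rcases h with ⟨h1, h2, h3⟩ | ⟨h1, X, S, h2, h3⟩ | ⟨h0, h1, h2, h3, h4, h5⟩
  · exact Or.inl ⟨hma.trans h1, hj ▸ hD _ _ h2, by rw [hj, hm _ (hlt _ _ h2), h3]⟩
  · exact Or.inr (Or.inl ⟨hma.trans h1, X, S, h2, hj ▸ hD _ _ h3⟩)
  · refine Or.inr (Or.inr ⟨h0, hma.trans h1, (hm _ ha).trans h2,
      h3.congr fun x _ hx => hm x (by omega), h4, fun i V' hV' => ?_⟩)
    -- Each earlier sibling is a node of `D`, so its link is unchanged and the old and new iterates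
    -- agree one after the other.
    have : ∀ j ≤ i, (nextTree m' L)^[j] (a + 2 + V.labels.length)
        = (nextTree m L)^[j] (a + 2 + V.labels.length) := by
      intro j
      induction j with
      | zero => simp
      | succ j ih =>
        intro hj
        have hlt : j < V.kids.length := by
          have := (List.getElem?_eq_some_iff.1 hV').1
          omega
        rw [Function.iterate_succ_apply', Function.iterate_succ_apply', ih (by omega)]
        exact hn _ _ (h5 j _ (List.getElem?_eq_getElem hlt))
    rw [this i le_rfl]
    exact hD _ _ (h5 i V' hV')

/-- The trees that are still to be read, with their closing substitutions, start one after the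
other from the address `p` on. -/
def pending : ℕ → List (SType × (ℕ → SType)) → List (ℕ × SType × (ℕ → SType))
  | _, [] => []
  | p, (S, σ) :: P => (p, S, σ) :: pending (p + S.code.length) P

theorem pending_append (p : ℕ) (P P' : List (SType × (ℕ → SType))) :
    pending p (P ++ P') = pending p P ++ pending (p + (codes (P.map Prod.fst)).length) P' := by
  induction P generalizing p with
  | nil => simp [pending]
  | cons x P ih =>
    simp only [List.cons_append, pending, ih, List.map_cons, codes_cons, List.length_append,
      add_assoc]

theorem pending_bounds {p : ℕ} {P : List (SType × (ℕ → SType))} {a : ℕ} {S : SType}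
    {σ : ℕ → SType} (h : (a, S, σ) ∈ pending p P) :
    p ≤ a ∧ a + S.code.length ≤ p + (codes (P.map Prod.fst)).length := by
  induction P generalizing p with
  | nil => simp [pending] at h
  | cons x P ih =>
    obtain ⟨S', σ'⟩ := x
    simp only [pending, List.mem_cons, Prod.mk.injEq] at h
    simp only [List.map_cons, codes_cons, List.length_append]
    rcases h with ⟨rfl, rfl, rfl⟩ | h
    · omega
    · have := ih h; omega

/-- Codes are nonempty, so the addresses of the pending trees increase strictly. -/
theorem pending_functional {p : ℕ} {P : List (SType × (ℕ → SType))} {a : ℕ} {S S' : SType}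
    {σ σ' : ℕ → SType} (h : (a, S, σ) ∈ pending p P) (h' : (a, S', σ') ∈ pending p P) :
    S = S' ∧ σ = σ' := by
  induction P generalizing p with
  | nil => simp [pending] at h
  | cons x P ih =>
    obtain ⟨S₀, σ₀⟩ := x
    have := S₀.two_le_length_code
    simp only [pending, List.mem_cons, Prod.mk.injEq] at h h'
    rcases h with ⟨rfl, rfl, rfl⟩ | h <;> rcases h' with ⟨e, rfl, rfl⟩ | h'
    · exact ⟨rfl, rfl⟩
    · have := (pending_bounds h').1; omega
    · have := (pending_bounds h).1; omega
    · exact ih h h'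

theorem Linked.iterate_mem {m : ℕ → ℕ} {L p a : ℕ} {ts : List SType} (h : Linked m L p a ts)
    {i : ℕ} {S : SType} (hS : ts[i]? = some S) (σ : ℕ → SType) :
    ((nextTree m L)^[i] a, S, σ) ∈ pending a (ts.map fun T => (T, σ)) := by
  induction ts generalizing a i with
  | nil => simp at hS
  | cons S' ts ih =>
    cases i with
    | zero =>
      simp only [List.getElem?_cons_zero, Option.some.injEq] at hS
      simp [pending, hS]
    | succ i =>
      rw [List.getElem?_cons_succ] at hS
      simp only [List.map_cons, pending, List.mem_cons, Function.iterate_succ_apply]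
      right
      rw [nextTree, h.2.1]
      exact ih h.2.2 hS

theorem Linked.parent_eq {m : ℕ → ℕ} {L p a : ℕ} {ts : List SType} (h : Linked m L p a ts)
    {x : ℕ} {S : SType} {σ σ' : ℕ → SType}
    (hx : (x, S, σ') ∈ pending a (ts.map fun T => (T, σ))) :
    m (L + x) = p ∧ S ∈ ts ∧ σ' = σ := by
  induction ts generalizing a with
  | nil => simp [pending] at hx
  | cons S' ts ih =>
    simp only [List.map_cons, pending, List.mem_cons, Prod.mk.injEq] at hx
    rcases hx with ⟨rfl, rfl, rfl⟩ | hx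
    · exact ⟨h.1, by simp, rfl⟩
    · have := ih h.2.2 hx
      exact ⟨this.1, by simp [this.2.1], this.2.2⟩

/-! ### The invariant of the reading phase. -/

/-- The number of children of the node at `a`, plus one. -/
def weight (m : ℕ → ℕ) (a : ℕ) : ℕ := 1 + childCount (m a) (m (a + 1))

/-- The invariant of the first phase of the program, which reads the input from left to right: the
trees `P` from the address `pos` on are still to be read, `D` assigns closed types to nodes, and
`A` is the set of the nodes that have been read. -/
structure ParseInv (m : ℕ → ℕ) (L n pos : ℕ) (P : List (SType × (ℕ → SType)))
    (D : ℕ → SType → Prop) (A : Finset ℕ) : Prop where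
  code : Matches m pos (codes (P.map Prod.fst))
  length : pos + (codes (P.map Prod.fst)).length = L
  zero : ∀ x, 4 * L ≤ x → m x = 0
  node : ∀ a V, D a V →
    (a ∈ A ∧ NodeOK m L D a V) ∨ ∃ S σ, (a, S, σ) ∈ pending pos P ∧ V = S.close σ
  lt : ∀ a ∈ A, a < pos
  pend : ∀ a S σ, (a, S, σ) ∈ pending pos P → D a (S.close σ)
  scope : ∀ a S σ, (a, S, σ) ∈ pending pos P → ∀ X ∈ S.freeVars, m (L + a) < pos ∧
    ∃ r, BinderAbove m L X (m (L + a)) r ∧ D r (σ X) ∧ m r = 2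
  functional : ∀ a V V', D a V → D a V' → V = V'
  session : ∀ a V, D a V → V.IsSessionType
  weight_le : ∑ a ∈ A, weight m a + (P.map fun x => 2 * x.1.size - 1).sum ≤ 2 * n

theorem ParseInv.lt_length {m : ℕ → ℕ} {L n pos : ℕ} {P : List (SType × (ℕ → SType))}
    {D : ℕ → SType → Prop} {A : Finset ℕ} (h : ParseInv m L n pos P D A) {a : ℕ} {V : SType}
    (hD : D a V) : a < L := by
  have h2 := h.length
  rcases h.node a V hD with ⟨ha, -⟩ | ⟨S, σ, hm, -⟩
  · have := h.lt a ha; omega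
  · have := pending_bounds hm
    have := S.two_le_length_code
    omega

/-- The closing substitution for the children of a node. -/
def kidEnv (σ : ℕ → SType) : SType → ℕ → SType
  | mu X T => Function.update σ X ((mu X T).close σ)
  | _ => σ

theorem kidEnv_of_isHead {σ : ℕ → SType} {S : SType} (h : S.IsHead) : kidEnv σ S = σ := by
  cases S <;> simp [kidEnv, IsHead, tag] at h ⊢

theorem cases_head (S : SType) :
    (∃ X, S = var X) ∨ (∃ X T, S = mu X T) ∨ S.IsHead := by
  cases S <;> simp [IsHead, tag]

/-- Reading the node at `pos` replaces the pending tree `S` by its children, closed by `kidEnv σ S`,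
and adds `pos` to the nodes that have been read. The links written lie strictly inside the tree at
`pos`, where `D` is still empty, so older descriptions survive. -/
theorem ParseInv.step {m m' : ℕ → ℕ} {L n pos : ℕ} {S : SType} {σ : ℕ → SType}
    {P : List (SType × (ℕ → SType))} {D : ℕ → SType → Prop} {A : Finset ℕ}
    (h : ParseInv m L n pos ((S, σ) :: P) D A)
    (hm : ∀ x < L, m' x = m x) (hz : ∀ x, 4 * L ≤ x → m' x = m x)
    (hm2 : ∀ x < L, x < pos + 2 + S.labels.length ∨ pos + S.code.length ≤ x →
      m' (L + x) = m (L + x) ∧ m' (2 * L + x) = m (2 * L + x))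
    (hm3 : ∀ x < L, x ≠ pos → m' (3 * L + x) = m (3 * L + x))
    (hlink : Linked m' L pos (pos + 2 + S.labels.length) S.kids)
    (hvar : ∀ X, S = var X → D (m' (3 * L + pos)) (σ X) ∧ m (m' (3 * L + pos)) = 2)
    (hmu : S.tag = 2 → m' (3 * L + pos) = pos + 2) :
    ∃ D' A', (∀ a V, D a V → D' a V) ∧
      ParseInv m' L n (pos + 2 + S.labels.length)
        (S.kids.map (fun T => (T, kidEnv σ S)) ++ P) D' A' := by
  have hcode := h.code
  have hlen := h.length
  have hw := h.weight_le
  have hcl := S.length_code_eq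
  have h2 := S.two_le_length_code
  simp only [List.map_cons, codes_cons, matches_append, matches_code, List.length_append]
    at hcode hlen
  obtain ⟨⟨ht, ha, hlab, hkid⟩, hrest⟩ := hcode
  set f := pos + 2 + S.labels.length with hf
  set K := S.kids.map (fun T => (T, kidEnv σ S)) with hK
  have hKf : K.map Prod.fst = S.kids := by simp [hK, Function.comp_def]
  have hE : f + (codes S.kids).length = pos + S.code.length := by omega
  have hpa : pending f (K ++ P) = pending f K ++ pending (pos + S.code.length) P := by
    rw [pending_append, hKf, hE]
  have hpc : pending pos ((S, σ) :: P) = (pos, S, σ) :: pending (pos + S.code.length) P := rfl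
  have hnew : ∀ {a S' σ'}, (a, S', σ') ∈ pending f K →
      f ≤ a ∧ a < pos + S.code.length ∧ m' (L + a) = pos ∧ S' ∈ S.kids ∧ σ' = kidEnv σ S := by
    intro a S' σ' hmem
    have h1 := pending_bounds hmem
    have h3 := S'.two_le_length_code
    rw [hKf] at h1
    have h4 := hlink.parent_eq hmem
    exact ⟨h1.1, by omega, h4⟩
  -- Strictly inside the tree at `pos` no address has a type yet. This protects the old links and
  -- makes the extended `D` functional.
  have hold : ∀ {a V}, D a V → a ≤ pos ∨ pos + S.code.length ≤ a := by
    intro a V hD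
    rcases h.node a V hD with ⟨hA, -⟩ | ⟨S', σ', hmem, -⟩
    · exact Or.inl (h.lt a hA).le
    · rw [hpc, List.mem_cons] at hmem
      rcases hmem with e | hmem
      · cases e; exact Or.inl le_rfl
      · exact Or.inr (pending_bounds hmem).1
  have hpos : D pos (S.close σ) := h.pend _ _ _ (by simp [hpc])
  have hsess := h.session _ _ hpos
  have hclosed : ∀ X ∈ S.freeVars, (σ X).freeVars = ∅ := fun X hX => by
    obtain ⟨-, r, -, hr, -⟩ := h.scope pos S σ (by simp [hpc]) X hX
    exact (h.session _ _ hr).closed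
  have hunf : ∀ X T, S = mu X T → T.close (kidEnv σ S)
      = subst X (S.close σ) (T.close (Function.update σ X (var X))) := by
    rintro X T rfl
    rw [subst_close]
    · rfl
    · intro Y hY hYX
      rw [hclosed Y ⟨hY, hYX⟩]; simp
  let D' : ℕ → SType → Prop := fun a V =>
    D a V ∨ ∃ S' σ', (a, S', σ') ∈ pending f K ∧ V = S'.close σ'
  have hDD' : ∀ a V, D a V → D' a V := fun a V h => Or.inl h
  refine ⟨D', insert pos A, hDD', ?_⟩
  have hbinder : ∀ {X p r}, p ≤ pos → BinderAbove m L X p r → BinderAbove m' L X p r := by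
    intro X p r hp hb
    exact hb.congr (fun x hx => hm x (by omega)) fun x hx => (hm2 x (by omega) (by omega)).1
  constructor
  · simp only [List.map_append, hKf, codes_append, matches_append, hE]
    exact ⟨hkid.congr fun x _ hx => hm x (by omega),
      hrest.congr fun x _ hx => hm x (by omega)⟩
  · simp only [List.map_append, hKf, codes_append, List.length_append]
    omega
  · intro x hx; rw [hz x hx, h.zero x hx]
  · rintro a V (hD | ⟨S', σ', hmem, rfl⟩)
    · rcases h.node a V hD with ⟨hA, hN⟩ | ⟨S', σ', hmem, hV⟩
      · have hlt := h.lt a hA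
        refine Or.inl ⟨Finset.mem_insert_of_mem hA, hN.congr (by omega) hDD'
          (fun x T hx => h.lt_length hx) hm (hm3 a (by omega) (by omega)) fun x T hx => ?_⟩
        have := hold hx
        exact (hm2 x (h.lt_length hx) (by omega)).2
      · rw [hpc, List.mem_cons] at hmem
        rcases hmem with e | hmem
        · cases e
          subst hV
          refine Or.inl ⟨Finset.mem_insert_self _ _, ?_⟩
          have hmt : m' pos = S.tag := (hm _ (by omega)).trans ht
          rcases cases_head S with ⟨X, rfl⟩ | ⟨X, T, rfl⟩ | hS
          · obtain ⟨h1, h3⟩ := hvar X rfl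
            exact Or.inl ⟨hmt, Or.inl h1, by rw [hm _ (h.lt_length h1), h3]⟩
          · refine Or.inr (Or.inl ⟨hmt, X, _, rfl, Or.inr ⟨T, kidEnv σ (mu X T), ?_,
              (hunf X T rfl).symm⟩⟩)
            rw [hmu rfl]
            simp [hK, kids, pending, hf, labels]
          · obtain ⟨g1, g2, g3, g4, g5⟩ := hS.close σ
            refine Or.inr (Or.inr ⟨g1, hmt.trans g2.symm,
              (hm _ (by omega)).trans (ha.trans g3.symm), ?_, ?_, ?_⟩)
            · rw [g4]; exact hlab.congr fun x _ hx => hm x (by omega)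
            · rw [g4, g5, List.length_map]
              have := length_le_length_codes S.kids
              omega
            · intro i V' hV'
              rw [g5, List.getElem?_map, Option.map_eq_some_iff] at hV'
              obtain ⟨S', hS', rfl⟩ := hV'
              rw [g4]
              refine Or.inr ⟨S', kidEnv σ S, hlink.iterate_mem hS' _, ?_⟩
              rw [kidEnv_of_isHead hS]
        · exact Or.inr ⟨S', σ', by rw [hpa]; exact List.mem_append_right _ hmem, hV⟩
    · exact Or.inr ⟨S', σ', by rw [hpa]; exact List.mem_append_left _ hmem, rfl⟩
  · intro a hA
    rcases Finset.mem_insert.1 hA with rfl | hA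
    · omega
    · have := h.lt a hA; omega
  · intro a S' σ' hmem
    rw [hpa, List.mem_append] at hmem
    rcases hmem with hmem | hmem
    · exact Or.inr ⟨S', σ', hmem, rfl⟩
    · exact Or.inl (h.pend _ _ _ (by rw [hpc]; exact List.mem_cons_of_mem _ hmem))
  · intro a S' σ' hmem X hX
    rw [hpa, List.mem_append] at hmem
    rcases hmem with hmem | hmem
    · obtain ⟨-, -, hpar, hS', rfl⟩ := hnew hmem
      rw [hpar]
      refine ⟨by omega, ?_⟩
      -- If `pos` does not bind `X`, the search from a child passes through `pos` and continues as
      -- the search from `pos` did.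
      have hup : X ∈ S.freeVars → σ X = kidEnv σ S X → ¬ (m pos = 2 ∧ m (pos + 1) = X) →
          ∃ r, BinderAbove m' L X pos r ∧ D' r (kidEnv σ S X) ∧ m' r = 2 := by
        intro hXS hσ hne
        obtain ⟨hlt, r, hb, hr, hr2⟩ := h.scope pos S σ (by simp [hpc]) X hXS
        have hp : m' (L + pos) = m (L + pos) := (hm2 pos (by omega) (by omega)).1
        refine ⟨r, .up _ _ ?_ ?_ ?_, ?_, ?_⟩
        · rwa [hm _ (by omega), hm _ (by omega)]
        · rwa [hp]
        · rw [hp]; exact hbinder hlt.le hb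
        · rw [← hσ]; exact Or.inl hr
        · rw [hm _ (h.lt_length hr), hr2]
      rcases cases_head S with ⟨Y, rfl⟩ | ⟨Y, T, rfl⟩ | hS
      · simp [kids] at hS'
      · simp only [kids, List.mem_singleton] at hS'
        subst hS'
        by_cases e : X = Y
        · subst e
          refine ⟨pos, .found _ ?_ ?_, ?_, ?_⟩
          · rw [hm _ (by omega), ht]; rfl
          · rw [hm _ (by omega), ha]; rfl
          · simp only [kidEnv, Function.update_self]; exact Or.inl hpos
          · rw [hm _ (by omega), ht]; rfl
        · refine hup ⟨hX, e⟩ (by simp [kidEnv, e]) fun h' => e ?_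
          rw [← h'.2, ha]; rfl
      · refine hup (hS.freeVars_kids hS' hX) (by rw [kidEnv_of_isHead hS]) fun h' => ?_
        have := ht.symm.trans h'.1
        simp [IsHead, this] at hS
    · have hb := pending_bounds hmem
      have := S'.two_le_length_code
      obtain ⟨hlt, r, hbin, hr, hr2⟩ :=
        h.scope a S' σ' (by rw [hpc]; exact List.mem_cons_of_mem _ hmem) X hX
      have hp : m' (L + a) = m (L + a) := (hm2 a (by omega) (by omega)).1
      rw [hp]
      exact ⟨by omega, r, hbinder hlt.le hbin, Or.inl hr, by rw [hm _ (h.lt_length hr), hr2]⟩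
  · rintro a V V' (hD | ⟨S₁, σ₁, h1, rfl⟩) (hD' | ⟨S₂, σ₂, h3, rfl⟩)
    · exact h.functional a V V' hD hD'
    · have := hold hD; have := hnew h3; omega
    · have := hold hD'; have := hnew h1; omega
    · obtain ⟨rfl, rfl⟩ := pending_functional h1 h3; rfl
  · rintro a V (hD | ⟨S', σ', hmem, rfl⟩)
    · exact h.session a V hD
    · obtain ⟨-, -, -, hS', rfl⟩ := hnew hmem
      rcases cases_head S with ⟨Y, rfl⟩ | ⟨Y, T, rfl⟩ | hS
      · simp [kids] at hS'
      · simp only [kids, List.mem_singleton] at hS'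
        subst hS'
        rw [hunf Y _ rfl]
        exact IsSessionType.unfold_mu hsess
      · rw [kidEnv_of_isHead hS]
        obtain ⟨g1, -, -, -, g5⟩ := hS.close σ
        exact hsess.kids g1 (by rw [g5]; exact List.mem_map_of_mem hS')
  -- The budget is kept exactly: with `k` children `S_i`, `2|S| - 1` equals `1 + k`, the weight of
  -- the node, plus the sum of the `2|S_i| - 1`.
  · have hpA : pos ∉ A := fun hA => (h.lt _ hA).false
    rw [Finset.sum_insert hpA]
    have e1 : ∑ a ∈ A, weight m' a = ∑ a ∈ A, weight m a := by
      refine Finset.sum_congr rfl fun a hA => ?_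
      have := h.lt a hA
      rw [weight, weight, hm _ (by omega), hm _ (by omega)]
    have e2 : weight m' pos = 1 + S.kids.length := by
      rw [weight, hm _ (by omega), hm _ (by omega), ht, ha, length_kids]
    have e3 : ∀ l : List SType, ((l.map (fun T => (T, kidEnv σ S))).map
        fun x => 2 * x.1.size - 1).sum + l.length = 2 * (l.map size).sum := by
      intro l
      induction l with
      | nil => simp
      | cons T l ih =>
        have := T.size_eq
        simp only [List.map_cons, List.sum_cons, List.length_cons] at ih ⊢
        omega
    have e4 := e3 S.kids
    rw [← hK] at e4
    have e5 := S.size_eq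
    simp only [List.map_cons, List.sum_cons, List.map_append, List.sum_append] at hw ⊢
    omega

/-! ### The reading phase and its cost. -/

/-- Links the children of the node that has just been read and moves on to the next node. -/
def linkNode : Program :=
  block [icopy 30 24, icopy 31 23, linkChildren, icopy 10 24, isub 11 4 10]

/-- Reads the node at the address in register `10`; if it is a variable or a binder, the address
of its successor is stored. -/
def parseNode : Program :=
  block [icopy 20 10, readNode 20,
    .ite 25 (block [isub 26 21 2,
      .ite 26 (icopy 27 24) (block [iadd 29 4 10, iload 27 29, iconst 28 1, findBinder]),
      iadd 26 6 10, istore 26 27]) (icopy 26 26),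
    linkNode]

/-- The first phase of the program: it reads the input, links the children of each node, and
stores at `3 * L + a` the successor of each variable or binder at `a`. -/
def parse : Program := .loop 11 parseNode

/-- Per node, `20 * L` covers the walk to a binder and `50 * n` the linking of the children. The
final `D'` extends `D`, so the roots keep their types. -/
theorem vc_parse {W L n pos : ℕ} {P : List (SType × (ℕ → SType))} {D : ℕ → SType → Prop}
    {A : Finset ℕ} {s : State} {c : ℕ} {Q : State → ℕ → Prop} (hs : Consts L s)
    (h10 : s.reg 10 = pos) (h11 : s.reg 11 = L - pos) (inv : ParseInv s.mem L n pos P D A)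
    (hW : 5 * L + 4 ≤ W)
    (h : ∀ s' c' D' A', ParseInv s'.mem L n L [] D' A' → (∀ a V, D a V → D' a V) →
      (∀ r < 10, s'.reg r = s.reg r) → c' ≤ c + (20 * L + 50 * n + 70) * (L - pos) + 1 →
      Q s' c') :
    vc W parse Q s c := by
  induction hk : L - pos using Nat.strong_induction_on generalizing s c pos P D A with
  | _ k ih =>
  have hlen := inv.length
  cases P with
  | nil =>
    simp only [List.map_nil, codes_nil, List.length_nil, add_zero] at hlen
    subst hlen
    refine vc_loop_unroll (fun _ => h _ _ D A inv (fun _ _ h => h) (fun _ _ => rfl) (by omega))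
      fun h0 => absurd (by omega) h0
  | cons x P =>
    obtain ⟨S, σ⟩ := x
    have hcode := inv.code
    have hcl := S.length_code_eq
    have h2 := S.two_le_length_code
    have hkl := S.length_kids
    have hll := S.length_labels
    have hk2 := length_le_length_codes S.kids
    have hsize : S.size ≤ n := by
      have := inv.weight_le
      simp only [List.map_cons, List.sum_cons] at this
      omega
    simp only [List.map_cons, codes_cons, matches_append, matches_code, List.length_append]
      at hcode hlen
    obtain ⟨⟨ht, ha, -, hkid⟩, -⟩ := hcode
    refine vc_loop_unroll (fun h0 => absurd h0 (by omega)) fun _ => ?_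
    change vc W parseNode (vc W parse Q) s (c + 1)
    simp only [parseNode, block, vc]
    refine vc_readNode (by norm_num) (by simp [hs.one]) (by simp [hs.two]) (by omega) ?_ ?_ ?_
    · simp only [Function.update_self, h10, ht, ha, ← hkl]; omega
    · simp only [Function.update_self, h10, ht, ha, ← hll]; omega
    intro s₁ c₁ hmem e21 e22 e23 e24 e25 hfr hc₁
    simp only [Function.update_self, h10, ht, ha, ← hll, ← hkl, Nat.reduceAdd] at e21 e22 e23 e24
    simp only [Function.update_self, h10, ht, Nat.reduceAdd] at e25
    dsimp only at hmem
    have f : ∀ r, r < 20 → s₁.reg r = s.reg r := fun r hr => by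
      rw [hfr r (Or.inl hr.le)]; simp [hr.ne]
    -- the children are linked after the successor of the node has been stored
    have rest : ∀ s₂ c₂, (∀ x ≠ 3 * L + pos, s₂.mem x = s.mem x) →
        (∀ r < 25, s₂.reg r = s₁.reg r) → c₂ ≤ c₁ + 20 * L + 40 →
        (∀ X, S = var X → D (s₂.mem (3 * L + pos)) (σ X) ∧ s.mem (s₂.mem (3 * L + pos)) = 2) →
        (S.tag = 2 → s₂.mem (3 * L + pos) = pos + 2) →
        vc W linkNode (vc W parse Q) s₂ c₂ := by
      intro s₂ c₂ hmem₂ hfr₂ hc₂ hvar hmu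
      have f₂ : ∀ r, r < 20 → s₂.reg r = s.reg r := fun r hr =>
        (hfr₂ r (by omega)).trans (f r hr)
      simp only [linkNode, block, vc]
      have g24 := (hfr₂ 24 (by norm_num)).trans e24
      have g23 := (hfr₂ 23 (by norm_num)).trans e23
      refine vc_linkChildren (L := L) (ts := S.kids) (hs.congr fun r hr => ?_) ?_ ?_ ?_ (by omega) ?_
      · have : r ≠ 30 ∧ r ≠ 31 := by omega
        simp [this, f₂ r (by omega)]
      · simp [g23]
      · simp only [Function.update_apply, Nat.reduceEqDiff, if_true, if_false, g24]
        exact hkid.congr fun x _ hx => hmem₂ x (by omega)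
      · simp only [Function.update_apply, Nat.reduceEqDiff, if_true, if_false, g24]
        omega
      intro s₃ c₃ hlink hmem₃ hfr₃ hc₃
      simp only [Function.update_apply, Nat.reduceEqDiff, if_true, if_false, g24, f₂, Nat.reduceLT,
        h10] at hlink hmem₃
      have g₃ : ∀ r < 25, s₃.reg r = s₁.reg r := fun r hr => by
        have : r ≠ 30 ∧ r ≠ 31 := by omega
        rw [hfr₃ r (by omega)]
        simp [this, hfr₂ r hr]
      have f₃ : ∀ r, r < 20 → s₃.reg r = s.reg r := fun r hr =>
        (g₃ r (by omega)).trans (f r hr)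
      have g24' := (g₃ 24 (by norm_num)).trans e24
      simp only [vc, Function.update_apply, Nat.reduceEqDiff, if_true, if_false, g24', f₃,
        Nat.reduceLT, hs.length]
      have hjmp : s₃.mem (3 * L + pos) = s₂.mem (3 * L + pos) :=
        hmem₃ _ (by omega) (by omega)
      obtain ⟨D', A', hDD', inv'⟩ := inv.step (m' := s₃.mem)
        (fun x hx => (hmem₃ x (by omega) (by omega)).trans (hmem₂ x (by omega)))
        (fun x hx => (hmem₃ x (by omega) (by omega)).trans (hmem₂ x (by omega)))
        (fun x hx hx' => ⟨(hmem₃ _ (by omega) (by omega)).trans (hmem₂ _ (by omega)),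
          (hmem₃ _ (by omega) (by omega)).trans (hmem₂ _ (by omega))⟩)
        (fun x hx hx' => (hmem₃ _ (by omega) (by omega)).trans (hmem₂ _ (by omega)))
        hlink (by rwa [hjmp]) (by rwa [hjmp])
      have hS := S.size_eq
      refine ih (L - (pos + 2 + S.labels.length)) (by omega) ?_ ?_ ?_ inv' ?_ rfl
      · refine hs.congr fun r hr => ?_
        have : r ≠ 10 ∧ r ≠ 11 := by omega
        simp [this, f₃ r (by omega)]
      · simp
      · simp
      · intro s' c' D'' A'' i1 i2 i3 i4
        refine h s' c' D'' A'' i1 (fun a V hD => i2 a V (hDD' a V hD)) (fun r hr => ?_) ?_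
        · have : r ≠ 10 ∧ r ≠ 11 := by omega
          rw [i3 r hr]; simp [this, f₃ r (by omega)]
        -- The position moves on by at least one cell, and each cell carries the budget of a whole
        -- node.
        · have hmono : (20 * L + 50 * n + 70) * (L - (pos + 2 + S.labels.length) + 1)
              ≤ (20 * L + 50 * n + 70) * (L - pos) := Nat.mul_le_mul_left _ (by omega)
          rw [mul_add, mul_one] at hmono
          omega
    have hb : pos + 2 ≤ L := by omega
    have ne : ∀ r < 25, r ≠ 26 ∧ r ≠ 27 ∧ r ≠ 28 ∧ r ≠ 29 := fun r hr => by omega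
    -- Binder, variable, other node. Register 26 holds the constructor minus one, which vanishes for
    -- a variable; a binder jumps to its body at `pos + 2`, a variable to the binder found from its
    -- parent upwards.
    refine ⟨fun hj => ⟨fun hj2 => ?_, fun hj2 => ?_⟩, fun hj => ?_⟩
    · have htag : S.tag = 2 := by
        have h1 : ¬ (S.tag = 0 ∨ 3 ≤ S.tag) := fun h1 => hj (e25.2 h1)
        simp only [Function.update_self, e21, f, Nat.reduceLT, hs.one] at hj2
        omega
      have hlab : S.labels.length = 0 := by rw [hll, htag]; rfl
      simp only [Function.update_apply, Nat.reduceEqDiff, if_true, if_false, f, Nat.reduceLT,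
        h10, hs.length3, e24]
      refine ⟨by omega, rest _ _ ?_ ?_ ?_ ?_ ?_⟩
      · intro x hx; simp [hmem, hx]
      · intro r hr; simp [ne r hr]
      · omega
      · rintro X rfl; simp [tag] at htag
      · intro _; simp [hlab]
    · have hvar : ∃ X, S = var X := by
        have h1 : ¬ (S.tag = 0 ∨ 3 ≤ S.tag) := fun h1 => hj (e25.2 h1)
        simp only [Function.update_self, e21, f, Nat.reduceLT, hs.one] at hj2
        have h3 : S.tag = 1 := by omega
        cases S <;> simp [tag] at h3
        exact ⟨_, rfl⟩
      obtain ⟨X, rfl⟩ := hvar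
      obtain ⟨hlt, r, hbin, hr, hr2⟩ := inv.scope pos (var X) σ (by simp [pending]) X rfl
      simp only [Function.update_apply, Nat.reduceEqDiff, if_true, if_false, f, Nat.reduceLT,
        h10, hs.length, hmem]
      refine ⟨by omega, by omega, ?_⟩
      refine vc_findBinder (L := L) (X := X) (p := s.mem (L + pos)) (b := r) (m := s.mem)
        (hs.congr fun r hr => ?_) ?_ ?_ ?_ rfl hbin (by omega) ?_
      · simp [ne r (by omega), f r (by omega)]
      · simp [e22, arg]
      · simp
      · simp
      intro s₂ c₂ k1 k2 k3 k4
      have g₂ : ∀ r < 25, s₂.reg r = s₁.reg r := fun r hr => by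
        rw [k3 r (by omega)]; simp [ne r hr]
      simp only [Function.update_apply, Nat.reduceEqDiff, if_true, if_false, g₂, f, Nat.reduceLT,
        h10, hs.length3, k2, k1]
      refine ⟨by omega, rest _ _ ?_ ?_ ?_ ?_ ?_⟩
      · intro x hx; simp [hx]
      · intro r hr; simp [ne r hr, g₂ r hr]
      · omega
      · rintro Y ⟨⟩; simp [hr, hr2]
      · intro h3; simp [tag] at h3
    · have h1 := e25.1 hj
      refine rest _ _ ?_ ?_ ?_ ?_ ?_
      · intro x hx; simp [hmem]
      · intro r hr; simp [ne r hr]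
      · omega
      · rintro X rfl; simp [tag] at h1
      · intro h3; omega

/-! ### The queue of pairs -/

/-- The memory in the second phase of the program: below `4 * L` it agrees with the result `m` of
the first phase, the addresses from `5 * L` on hold the characteristic function of the list `q` of
the pairs that have been found so far, and after that follows the list `q` itself. -/
structure QueueMem (m : ℕ → ℕ) (L : ℕ) (q : List (ℕ × ℕ)) (mem : ℕ → ℕ) : Prop where
  low : ∀ x < 4 * L, mem x = m x
  row : ∀ a < L, mem (4 * L + a) = 5 * L + a * L
  visited : ∀ a < L, ∀ b < L, mem (5 * L + a * L + b) ≠ 0 ↔ (a, b) ∈ q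
  queue : ∀ i a b, q[i]? = some (a, b) →
    mem (5 * L + L * L + 2 * i) = a ∧ mem (5 * L + L * L + 2 * i + 1) = b
  nodup : q.Nodup
  lt : ∀ a b, (a, b) ∈ q → a < L ∧ b < L

/-- With no repetitions, the queue needs at most `2 * (L * L)` cells. Hence the term `5 * L + 3 * (L
* L)` in all later lower bounds on `W`. -/
theorem QueueMem.length_le {m mem : ℕ → ℕ} {L : ℕ} {q : List (ℕ × ℕ)}
    (h : QueueMem m L q mem) : q.length ≤ L * L := by
  have h1 : q.toFinset ⊆ Finset.range L ×ˢ Finset.range L := by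
    rintro ⟨a, b⟩ hx
    rw [List.mem_toFinset] at hx
    simpa using h.lt a b hx
  have h2 := Finset.card_le_card h1
  rwa [List.toFinset_card_of_nodup h.nodup, Finset.card_product, Finset.card_range] at h2

theorem index_lt {L a b : ℕ} (ha : a < L) (hb : b < L) : a * L + b < L * L := by
  calc a * L + b < a * L + L := by omega
    _ = (a + 1) * L := by ring
    _ ≤ L * L := Nat.mul_le_mul_right _ ha

theorem index_injective {L a b a' b' : ℕ} (hb : b < L) (hb' : b' < L)
    (h : a * L + b = a' * L + b') : a = a' ∧ b = b' := by
  have hL : 0 < L := by omega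
  have h1 := congrArg (fun x => x / L) h
  have h2 := congrArg (fun x => x % L) h
  simp only [Nat.add_comm (_ * L), Nat.add_mul_div_right _ _ hL, Nat.add_mul_mod_self_right,
    Nat.div_eq_of_lt hb, Nat.div_eq_of_lt hb', Nat.mod_eq_of_lt hb, Nat.mod_eq_of_lt hb',
    zero_add] at h1 h2
  exact ⟨h1, h2⟩

theorem QueueMem.push {m mem : ℕ → ℕ} {L : ℕ} {q : List (ℕ × ℕ)} (h : QueueMem m L q mem)
    {a b : ℕ} (ha : a < L) (hb : b < L) (hab : (a, b) ∉ q) :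
    QueueMem m L (q ++ [(a, b)]) (Function.update (Function.update (Function.update mem
      (5 * L + a * L + b) 1) (5 * L + L * L + 2 * q.length) a)
      (5 * L + L * L + 2 * q.length + 1) b) := by
  have hi := index_lt ha hb
  constructor
  · intro x hx
    rw [Function.update_of_ne (by omega), Function.update_of_ne (by omega),
      Function.update_of_ne (by omega), h.low x hx]
  · intro x hx
    rw [Function.update_of_ne (by omega), Function.update_of_ne (by omega),
      Function.update_of_ne (by omega), h.row x hx]
  · intro a' ha' b' hb'
    have hi' := index_lt ha' hb'
    rw [Function.update_of_ne (by omega), Function.update_of_ne (by omega)]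
    by_cases e : a' = a ∧ b' = b
    · obtain ⟨rfl, rfl⟩ := e
      simp
    · have hne : 5 * L + a' * L + b' ≠ 5 * L + a * L + b := fun e' =>
        e (index_injective hb' hb (by omega))
      rw [Function.update_of_ne hne, h.visited a' ha' b' hb']
      simp [e]
  · intro i a' b' hi'
    rcases lt_trichotomy i q.length with hlt | rfl | hlt
    · rw [List.getElem?_append_left hlt] at hi'
      rw [Function.update_of_ne (by omega), Function.update_of_ne (by omega),
        Function.update_of_ne (by omega), Function.update_of_ne (by omega),
        Function.update_of_ne (by omega), Function.update_of_ne (by omega)]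
      exact h.queue i a' b' hi'
    · simp only [List.getElem?_concat_length, Option.some.injEq, Prod.mk.injEq] at hi'
      obtain ⟨rfl, rfl⟩ := hi'
      rw [Function.update_of_ne (by omega)]
      simp
    · rw [List.getElem?_eq_none (by simp; omega)] at hi'
      cases hi'
  · rw [List.nodup_append]
    refine ⟨h.nodup, by simp, ?_⟩
    rintro x hx y hy rfl
    rw [List.mem_singleton] at hy
    exact hab (hy ▸ hx)
  · intro a' b' hx
    rw [List.mem_append, List.mem_singleton, Prod.mk.injEq] at hx
    rcases hx with hx | ⟨rfl, rfl⟩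
    · exact h.lt a' b' hx
    · exact ⟨ha, hb⟩

/-- The state in the second phase of the program, when `k` of the pairs in the queue `q` have been
dealt with. -/
structure QueueState (m : ℕ → ℕ) (L k : ℕ) (q : List (ℕ × ℕ)) (s : State) : Prop where
  consts : Consts L s
  mem : QueueMem m L q s.mem
  count : s.reg 11 + k = q.length
  last : s.reg 12 = 5 * L + L * L + 2 * q.length

/-- The pairs in `q'` are those in `q`, followed by pairs that have the property `N`. -/
def Grows (N : ℕ × ℕ → Prop) (q q' : List (ℕ × ℕ)) : Prop :=
  q <+: q' ∧ ∀ x ∈ q', x ∈ q ∨ N x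

theorem Grows.refl (N : ℕ × ℕ → Prop) (q : List (ℕ × ℕ)) : Grows N q q :=
  ⟨List.prefix_refl q, fun _ h => Or.inl h⟩

theorem Grows.trans {N : ℕ × ℕ → Prop} {q q' q'' : List (ℕ × ℕ)} (h : Grows N q q')
    (h' : Grows N q' q'') : Grows N q q'' :=
  ⟨h.1.trans h'.1, fun x hx => (h'.2 x hx).elim (h.2 x) Or.inr⟩

theorem Grows.mem {N : ℕ × ℕ → Prop} {q q' : List (ℕ × ℕ)} (h : Grows N q q') {x : ℕ × ℕ}
    (hx : x ∈ q) : x ∈ q' := h.1.subset hx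

/-- The pair of `u` and `v`, in reverse order if `w` is not zero. -/
def order (w u v : ℕ) : ℕ × ℕ := if w = 0 then (u, v) else (v, u)

/-- Adds the pair of the registers `40` and `41` (in reverse order if register `42` is not zero)
to the queue unless it has been added before. -/
def push : Program :=
  block [.ite 42 (block [icopy 43 41, icopy 44 40]) (block [icopy 43 40, icopy 44 41]),
    iadd 45 7 43, iload 45 45, iadd 45 45 44, iload 46 45,
    .ite 46 (icopy 46 46) (block [istore 45 2, istore 12 43, iadd 12 12 2, istore 12 44,
      iadd 12 12 2, iadd 11 11 2])]

/-- Without a multiplication instruction, the address of a mark is the row entry plus the second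
node. `N` is an arbitrary property of the pair, accumulated by `Grows`; later it becomes `Sound`. -/
theorem vc_push {W L k : ℕ} {m : ℕ → ℕ} {q : List (ℕ × ℕ)} {s : State} {c : ℕ}
    {Q : State → ℕ → Prop} {N : ℕ × ℕ → Prop} (hs : QueueState m L k q s)
    (h40 : s.reg 40 < L) (h41 : s.reg 41 < L) (hN : N (order (s.reg 42) (s.reg 40) (s.reg 41)))
    (hW : 5 * L + 3 * (L * L) + 2 ≤ W)
    (h : ∀ s' c' q', QueueState m L k q' s' → Grows N q q' →
      order (s.reg 42) (s.reg 40) (s.reg 41) ∈ q' →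
      (∀ r, r < 11 ∨ 12 < r → r < 43 ∨ 46 < r → s'.reg r = s.reg r) → c' ≤ c + 16 → Q s' c') :
    vc W push Q s c := by
  have hcons := hs.consts
  have hmain : ∀ a b f, order (s.reg 42) (s.reg 40) (s.reg 41) = (a, b) → a < L → b < L →
      f 43 = a → f 44 = b → (∀ r, r < 43 ∨ 46 < r → f r = s.reg r) →
      ∀ c₁, c₁ ≤ c + 3 → vc W (block [iadd 45 7 43, iload 45 45, iadd 45 45 44, iload 46 45,
        .ite 46 (icopy 46 46) (block [istore 45 2, istore 12 43, iadd 12 12 2, istore 12 44,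
          iadd 12 12 2, iadd 11 11 2])]) Q ⟨f, s.mem⟩ c₁ := by
    intro a b f hab ha hb h43 h44 hfr c₁ hc₁
    rw [hab] at hN h
    have hi := index_lt ha hb
    have g7 : f 7 = 4 * L := (hfr 7 (by norm_num)).trans hcons.length4
    have g2 : f 2 = 1 := (hfr 2 (by norm_num)).trans hcons.one
    have g12 : f 12 = _ := (hfr 12 (by norm_num)).trans hs.last
    have g11 : f 11 = s.reg 11 := hfr 11 (by norm_num)
    have hrow := hs.mem.row a ha
    have hlen := hs.mem.length_le
    have hcnt := hs.count
    simp only [block, vc, Function.update_apply, Nat.reduceEqDiff, if_true, if_false, g7, g2, g12,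
      g11, h43, h44, hrow]
    refine ⟨by omega, by omega, fun hv => ?_, fun hv => ?_⟩
    · refine h _ _ q ⟨?_, hs.mem, ?_, ?_⟩ (Grows.refl N q) ((hs.mem.visited a ha b hb).1 hv) ?_
        (by omega)
      · refine hcons.congr fun r hr => ?_
        have : r ≠ 45 ∧ r ≠ 46 := by omega
        simp [this, hfr r (by omega)]
      · simp [g11, hcnt]
      · simp [g12]
      · intro r hr hr'
        have : r ≠ 45 ∧ r ≠ 46 := by omega
        simp [this, hfr r hr']
    · have hnew : (a, b) ∉ q := fun hmem => (hs.mem.visited a ha b hb).2 hmem hv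
      have hq := hs.mem.push ha hb hnew
      have hlen' := hq.length_le
      simp only [List.length_append, List.length_singleton] at hlen'
      refine ⟨by omega, by omega, by omega, ?_⟩
      refine h _ _ (q ++ [(a, b)]) ⟨?_, hq, ?_, ?_⟩ ⟨List.prefix_append _ _, ?_⟩ (by simp) ?_
        (by omega)
      · refine hcons.congr fun r hr => ?_
        have : r ≠ 45 ∧ r ≠ 46 ∧ r ≠ 12 ∧ r ≠ 11 := by omega
        simp [this, hfr r (by omega)]
      · simp; omega
      · simp; omega
      · intro x hx
        rw [List.mem_append, List.mem_singleton] at hx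
        exact hx.imp_right fun e => by rw [e]; exact hN
      · intro r hr hr'
        have : r ≠ 45 ∧ r ≠ 46 ∧ r ≠ 12 ∧ r ≠ 11 := by omega
        simp [this, hfr r hr']
  have ne : ∀ r, r < 43 ∨ 46 < r → r ≠ 43 ∧ r ≠ 44 := fun r hr => by omega
  refine ⟨fun hw => hmain _ _ _ (if_neg hw) h41 h40 ?_ ?_ ?_ _ (by omega),
    fun hw => hmain _ _ _ (if_pos hw) h40 h41 ?_ ?_ ?_ _ (by omega)⟩
  all_goals first
    | (simp; done)
    | (intro r hr; simp [ne r hr])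

theorem QueueState.load_next {m : ℕ → ℕ} {L k : ℕ} {q : List (ℕ × ℕ)} {s : State}
    (hs : QueueState m L k q s) {a : ℕ} (ha : a < L) : s.mem (2 * L + a) = nextTree m L a :=
  hs.mem.low _ (by omega)

/-- Updates of registers that the second phase uses as temporary storage. -/
theorem QueueState.congr {m : ℕ → ℕ} {L k : ℕ} {q : List (ℕ × ℕ)} {s s' : State}
    (h : QueueState m L k q s) (hmem : s'.mem = s.mem)
    (hr : ∀ r, r < 8 ∨ r = 11 ∨ r = 12 → s'.reg r = s.reg r) : QueueState m L k q s' :=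
  ⟨h.consts.congr fun r h => hr r (Or.inl h), hmem ▸ h.mem, by rw [hr 11 (by simp), h.count],
    by rw [hr 12 (by simp), h.last]⟩

/-! ### Comparing the components of two nodes -/

/-- Adds the pairs of the children of two nodes, starting with the children at the addresses in
the registers `40` and `41`; register `51` holds the number of the pairs. -/
def pushKids : Program :=
  .loop 51 (block [push, iadd 52 5 40, iload 40 52, iadd 52 5 41, iload 41 52, isub 51 51 2])

theorem vc_pushKids {W L k : ℕ} {m : ℕ → ℕ} {q : List (ℕ × ℕ)} {s : State} {c : ℕ}
    {Q : State → ℕ → Prop} {N : ℕ × ℕ → Prop} (n w x y : ℕ) (hs : QueueState m L k q s)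
    (h51 : s.reg 51 = n) (h42 : s.reg 42 = w) (h40 : s.reg 40 = x) (h41 : s.reg 41 = y)
    (hlt : ∀ i < n, (nextTree m L)^[i] x < L ∧ (nextTree m L)^[i] y < L)
    (hN : ∀ i < n, N (order w ((nextTree m L)^[i] x) ((nextTree m L)^[i] y)))
    (hW : 5 * L + 3 * (L * L) + 2 ≤ W)
    (h : ∀ s' c' q', QueueState m L k q' s' → Grows N q q' →
      (∀ i < n, order w ((nextTree m L)^[i] x) ((nextTree m L)^[i] y) ∈ q') →
      s'.reg 40 = (nextTree m L)^[n] x → s'.reg 41 = (nextTree m L)^[n] y →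
      (∀ r, r < 11 ∨ 12 < r → r < 40 → s'.reg r = s.reg r) → c' ≤ c + 24 * n + 1 → Q s' c') :
    vc W pushKids Q s c := by
  induction n generalizing q s c x y with
  | zero =>
    exact vc_loop_unroll (fun _ => h _ _ q hs (Grows.refl N q) (by simp) h40 h41
      (fun _ _ _ => rfl) (by omega)) fun h0 => absurd h51 h0
  | succ n ih =>
    refine vc_loop_unroll (fun h0 => absurd (h51.symm.trans h0) (by simp)) fun _ => ?_
    have hx := hlt 0 (by omega)
    simp only [Function.iterate_zero, id] at hx
    simp only [block, vc]
    refine vc_push (N := N) hs (by omega) (by omega) (by simpa [h40, h41, h42] using hN 0 (by omega))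
      hW fun s₁ c₁ q₁ hs₁ hg₁ hin hfr hc₁ => ?_
    rw [h40, h41, h42] at hin
    have g : ∀ r, 12 < r → r < 43 ∨ 46 < r → s₁.reg r = s.reg r := fun r h1 h2 =>
      hfr r (Or.inr h1) h2
    have g2 := hs₁.consts.one
    have g5 := hs₁.consts.length2
    simp only [Function.update_apply, Nat.reduceEqDiff, if_true, if_false, g, Nat.reduceLT,
      true_or, or_true, h40, h41, h51, h42, g2, g5, hs₁.load_next hx.1, hs₁.load_next hx.2]
    refine ⟨by omega, by omega, ?_⟩
    have ne : ∀ r, r < 40 → r ≠ 40 ∧ r ≠ 41 ∧ r ≠ 51 ∧ r ≠ 52 := fun r hr => by omega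
    refine ih (nextTree m L x) (nextTree m L y) (hs₁.congr rfl fun r hr => ?_) ?_ ?_ ?_ ?_ ?_ ?_ ?_
    · simp [ne r (by omega)]
    · simp
    · simp [g, h42]
    · simp
    · simp
    · exact fun i hi => hlt (i + 1) (by omega)
    · exact fun i hi => hN (i + 1) (by omega)
    · intro s' c' q' i1 i2 i3 i4 i5 i6 i7
      refine h s' c' q' i1 (hg₁.trans i2) ?_ i4 i5 (fun r hr hr' => ?_) (by omega)
      · intro i hi
        cases i with
        | zero => exact i2.mem hin
        | succ i => exact i3 i (by omega)
      · rw [i6 r hr hr']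
        simp [ne r hr', hfr r hr (by omega)]

/-- Moves on to the next label and to the next child of the second node. -/
def advanceLabel : Program :=
  block [iadd 66 66 2, iadd 52 5 41, iload 41 52, isub 67 67 2]

/-- Searches the label in register `65` among the labels from the address in register `66` on,
whose number is in register `67`, and adds the pair of the child at the address in register `40`
and the corresponding child of the second node; register `68` becomes `0` if the label has been
found. -/
def searchLabel : Program :=
  .loop 67 (block [iload 69 66, compareRegs 70 65 69,
    .ite 70 (icopy 70 70) (block [iconst 68 0, push]), advanceLabel])

/-- The search does not stop at a hit, so every position that carries `l` contributes a pair and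
uniqueness of labels is not needed here. Register 68 is only ever cleared. -/
theorem vc_searchLabel {W L k : ℕ} {m : ℕ → ℕ} {q : List (ℕ × ℕ)} {s : State} {c : ℕ}
    {Q : State → ℕ → Prop} {N : ℕ × ℕ → Prop} (ls : List ℕ) (l w x y p : ℕ)
    (hs : QueueState m L k q s)
    (h65 : s.reg 65 = l) (h66 : s.reg 66 = p) (h67 : s.reg 67 = ls.length) (h42 : s.reg 42 = w)
    (h40 : s.reg 40 = x) (h41 : s.reg 41 = y)
    (hm : Matches m p ls) (hp : p + ls.length ≤ L) (hx : x < L)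
    (hlt : ∀ i < ls.length, (nextTree m L)^[i] y < L)
    (hN : ∀ i, ls[i]? = some l → N (order w x ((nextTree m L)^[i] y)))
    (hW : 5 * L + 3 * (L * L) + 2 ≤ W)
    (h : ∀ s' c' q', QueueState m L k q' s' → Grows N q q' →
      (∀ i, ls[i]? = some l → order w x ((nextTree m L)^[i] y) ∈ q') →
      (s'.reg 68 = 0 ↔ s.reg 68 = 0 ∨ l ∈ ls) →
      (∀ r, r < 11 ∨ 12 < r → r < 41 ∨ r = 42 ∨ 52 < r → r < 66 → s'.reg r = s.reg r) →
      c' ≤ c + 32 * ls.length + 1 → Q s' c') :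
    vc W searchLabel Q s c := by
  induction ls generalizing q s c y p with
  | nil =>
    exact vc_loop_unroll (fun _ => h _ _ q hs (Grows.refl N q) (by simp) (by simp)
      (fun _ _ _ _ => rfl) (by omega)) fun h0 => absurd h67 h0
  | cons l' ls ih =>
    refine vc_loop_unroll (fun h0 => absurd (h67.symm.trans h0) (by simp)) fun _ => ?_
    rw [List.length_cons] at h67 hp
    have hy := hlt 0 (by simp)
    simp only [Function.iterate_zero, id] at hy
    have hl' : s.mem p = l' := (hs.mem.low _ (by omega)).trans hm.1
    -- the rest of the loop body, followed by the remaining iterations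
    have rest : ∀ s₁ c₁ q₁, QueueState m L k q₁ s₁ → Grows N q q₁ →
        (l' = l → order w x y ∈ q₁) → (s₁.reg 68 = 0 ↔ s.reg 68 = 0 ∨ l' = l) →
        (∀ r, 12 < r → r < 43 ∨ 52 < r ∧ r < 68 → s₁.reg r = s.reg r) →
        (∀ r, r < 11 → s₁.reg r = s.reg r) → c₁ ≤ c + 25 →
        vc W advanceLabel (vc W searchLabel Q) s₁ c₁ := by
      intro s₁ c₁ q₁ hs₁ hg₁ hin h68 hfr hfr' hc₁
      have g2 := hs₁.consts.one
      have g5 := hs₁.consts.length2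
      simp only [advanceLabel, block, vc, Function.update_apply, Nat.reduceEqDiff, if_true,
        if_false, hfr, Nat.reduceLT, true_or, or_true, and_true, h66, h67, h41, g2, g5, hs₁.load_next hy]
      refine ⟨by omega, by omega, ?_⟩
      have ne : ∀ r, r < 41 ∨ r = 42 ∨ 52 < r → r < 66 → r ≠ 41 ∧ r ≠ 66 ∧ r ≠ 67 ∧ r ≠ 52 :=
        fun r h1 h2 => by omega
      refine ih (nextTree m L y) (p + 1) (hs₁.congr rfl fun r hr => ?_) ?_ ?_ ?_ ?_ ?_ ?_ hm.2
        (by omega) (fun i hi => ?_) (fun i hi => ?_) ?_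
      · simp [ne r (by omega) (by omega)]
      · simp [hfr, h65]
      · simp
      · simp
      · simp [hfr, h42]
      · simp [hfr, h40]
      · simp
      · exact hlt (i + 1) (by simpa using hi)
      · exact hN (i + 1) (by simpa using hi)
      · intro s' c' q' i1 i2 i3 i4 i5 i6
        refine h s' c' q' i1 (hg₁.trans i2) ?_ ?_ (fun r h1 h2 h3 => ?_) ?_
        · intro i hi
          cases i with
          | zero =>
            rw [List.getElem?_cons_zero, Option.some.injEq] at hi
            exact i2.mem (hin hi)
          | succ i => exact i3 i (by simpa using hi)
        · rw [i4]
          simp only [Function.update_apply, Nat.reduceEqDiff, if_false, h68, List.mem_cons]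
          rw [or_assoc, eq_comm (a := l')]
        · rw [i5 r h1 h2 h3]
          simp only [Function.update_of_ne (ne r h2 h3).1, Function.update_of_ne (ne r h2 h3).2.1,
            Function.update_of_ne (ne r h2 h3).2.2.1, Function.update_of_ne (ne r h2 h3).2.2.2]
          rcases h1 with h1 | h1
          · exact hfr' r h1
          · exact hfr r h1 (by omega)
        · rw [List.length_cons]; omega
    change vc W (block _) (vc W searchLabel Q) s (c + 1)
    simp only [block, vc]
    refine vc_compareRegs (by norm_num) (by norm_num) fun v c₁ hv hc₁ => ?_
    simp [h65, h66, hl'] at hv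
    refine ⟨fun hv0 => ?_, fun hv0 => ?_⟩
    · simp at hv0
      have hne : ¬ l' = l := fun e => hv0 (hv.2 e.symm)
      refine rest _ _ q ?_ (Grows.refl N q) (fun e => absurd e hne) ?_ ?_ ?_ ?_
      · refine hs.congr rfl fun r hr => ?_
        have : r ≠ 69 ∧ r ≠ 70 := by omega
        simp [this]
      · simp [hne]
      · intro r h1 h2
        have : r ≠ 69 ∧ r ≠ 70 := by omega
        simp [this]
      · intro r h1
        have : r ≠ 69 ∧ r ≠ 70 := by omega
        simp [this]
      · omega
    · simp at hv0
      have he : l' = l := (hv.1 hv0).symm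
      refine ⟨by omega, ?_⟩
      refine vc_push (N := N) (hs.congr rfl fun r hr => ?_) ?_ ?_ ?_ hW ?_
      · have : r ≠ 69 ∧ r ≠ 70 ∧ r ≠ 68 := by omega
        simp [this]
      · simpa [h40] using hx
      · simpa [h41] using hy
      · simpa [h40, h41, h42] using hN 0 (by simp [he])
      intro s₁ c₁ q₁ hs₁ hg₁ hin hfr hc₁
      refine rest _ _ q₁ hs₁ hg₁ (fun _ => by simpa [h40, h41, h42] using hin) ?_ ?_ ?_ ?_
      · rw [hfr 68 (by norm_num) (by norm_num)]; simp [he]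
      · intro r h1 h2
        have : r ≠ 69 ∧ r ≠ 70 ∧ r ≠ 68 := by omega
        rw [hfr r (by omega) (by omega)]
        simp [this]
      · intro r h1
        have : r ≠ 69 ∧ r ≠ 70 ∧ r ≠ 68 := by omega
        rw [hfr r (by omega) (by omega)]
        simp [this]
      · omega

/-- Moves on to the next label and to the next child of the first node. -/
def advanceSearch : Program :=
  block [iadd 60 60 2, iadd 52 5 40, iload 40 52, isub 61 61 2]

/-- Searches each of the labels from the address in register `60` on, whose number is in register
`61`, among those from the address in register `62` on, whose number is in register `63`, and adds
the pairs of the corresponding children, which start at the addresses in the registers `40` and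
`64`; register `9` is set to `1` if some label is not found. -/
def matchLabels : Program :=
  .loop 61 (block [iload 65 60, icopy 66 62, icopy 67 63, icopy 41 64, iconst 68 1, searchLabel,
    .ite 68 (icopy 9 2) (icopy 68 68), advanceSearch])

/-- The product of the two numbers of labels in the time bound is what the product of the weights
pays for; sorting the labels is unnecessary. -/
theorem vc_matchLabels {W L k : ℕ} {m : ℕ → ℕ} {q : List (ℕ × ℕ)} {s : State} {c : ℕ}
    {Q : State → ℕ → Prop} {N : ℕ × ℕ → Prop} (ls ls' : List ℕ) (w x y p p' : ℕ)
    (hs : QueueState m L k q s)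
    (h60 : s.reg 60 = p) (h61 : s.reg 61 = ls.length) (h40 : s.reg 40 = x)
    (h62 : s.reg 62 = p') (h63 : s.reg 63 = ls'.length) (h64 : s.reg 64 = y)
    (h42 : s.reg 42 = w)
    (hm : Matches m p ls) (hp : p + ls.length ≤ L) (hm' : Matches m p' ls')
    (hp' : p' + ls'.length ≤ L)
    (hlt : ∀ i < ls.length, (nextTree m L)^[i] x < L)
    (hlt' : ∀ i < ls'.length, (nextTree m L)^[i] y < L)
    (hN : ∀ i j l, ls[i]? = some l → ls'[j]? = some l →
      N (order w ((nextTree m L)^[i] x) ((nextTree m L)^[j] y)))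
    (hW : 5 * L + 3 * (L * L) + 2 ≤ W)
    (h : ∀ s' c' q', QueueState m L k q' s' → Grows N q q' →
      (∀ i j l, ls[i]? = some l → ls'[j]? = some l →
        order w ((nextTree m L)^[i] x) ((nextTree m L)^[j] y) ∈ q') →
      (s'.reg 9 = 0 ↔ s.reg 9 = 0 ∧ ∀ l ∈ ls, l ∈ ls') →
      (∀ r, r < 9 ∨ r = 10 → s'.reg r = s.reg r) →
      c' ≤ c + ls.length * (32 * ls'.length + 20) + 1 → Q s' c') :
    vc W matchLabels Q s c := by
  induction ls generalizing q s c x p with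
  | nil =>
    exact vc_loop_unroll (fun _ => h _ _ q hs (Grows.refl N q) (by simp) (by simp)
      (fun _ _ => rfl) (by omega)) fun h0 => absurd h61 h0
  | cons l ls ih =>
    refine vc_loop_unroll (fun h0 => absurd (h61.symm.trans h0) (by simp)) fun _ => ?_
    rw [List.length_cons] at h61 hp
    have hx := hlt 0 (by simp)
    simp only [Function.iterate_zero, id] at hx
    have hl : s.mem p = l := (hs.mem.low _ (by omega)).trans hm.1
    change vc W (block _) (vc W matchLabels Q) s (c + 1)
    simp only [block, vc]
    have ne : ∀ r, r < 41 ∨ r = 42 ∨ 52 < r → r < 65 →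
      r ≠ 65 ∧ r ≠ 66 ∧ r ≠ 67 ∧ r ≠ 41 ∧ r ≠ 68 := fun r h1 h2 => by omega
    refine ⟨by omega, ?_⟩
    refine vc_searchLabel (N := N) ls' l w x y p' (hs.congr rfl fun r hr => ?_) ?_ ?_ ?_ ?_ ?_ ?_
      hm' hp' hx hlt' (fun i hi => hN 0 i l (by simp) hi) hW fun s₁ c₁ q₁ hs₁ hg₁ hin h68 hfr hc₁ => ?_
    · simp [ne r (by omega) (by omega)]
    · simp [h60, hl]
    · simp [h62]
    · simp [h63]
    · simp [h42]
    · simp [h40]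
    · simp [h64]
    replace hfr : ∀ r, r < 11 ∨ 12 < r → r < 41 ∨ r = 42 ∨ 52 < r → r < 65 →
        s₁.reg r = s.reg r := fun r h1 h2 h3 => by
      rw [hfr r h1 h2 (by omega)]; simp [ne r h2 h3]
    simp at h68
    -- moving on to the next label
    have rest : ∀ f c₂, (∀ r, r ≠ 9 → r ≠ 68 → f r = s₁.reg r) →
        (f 9 = 0 ↔ s.reg 9 = 0 ∧ l ∈ ls') → c₂ ≤ c₁ + 2 →
        vc W advanceSearch (vc W matchLabels Q) ⟨f, s₁.mem⟩ c₂ := by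
      intro f c₂ hf h9 hc₂
      have g2 := hs.consts.one
      have g5 := hs.consts.length2
      simp only [advanceSearch, block, vc, Function.update_apply, Nat.reduceEqDiff, if_true,
        if_false, hf, ne_eq, not_false_eq_true, Nat.reduceLT, true_or, or_true, hfr, h60, h61, h40,
        g2, g5, hs₁.load_next hx]
      have ne' : ∀ r, r < 40 ∨ r = 42 ∨ 61 < r → r ≠ 40 ∧ r ≠ 60 ∧ r ≠ 61 ∧ r ≠ 52 :=
        fun r h1 => by omega
      refine ⟨by omega, by omega, ?_⟩
      refine ih (nextTree m L x) (p + 1) (hs₁.congr rfl fun r hr => ?_) ?_ ?_ ?_ ?_ ?_ ?_ ?_ hm.2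
        (by omega) (fun i hi => ?_) (fun i j l' hi hj => ?_) ?_
      · rw [← hf r (by omega) (by omega)]; simp [ne' r (by omega)]
      · simp
      · simp
      · simp
      · simp [hf, hfr, h62]
      · simp [hf, hfr, h63]
      · simp [hf, hfr, h64]
      · simp [hf, hfr, h42]
      · exact hlt (i + 1) (by simpa using hi)
      · exact hN (i + 1) j l' (by simpa using hi) hj
      · intro s' c' q' i1 i2 i3 i4 i5 i6
        refine h s' c' q' i1 (hg₁.trans i2) ?_ ?_ (fun r h1 => ?_) ?_
        · intro i j l' hi hj
          cases i with
          | zero =>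
            rw [List.getElem?_cons_zero, Option.some.injEq] at hi
            exact i2.mem (hin j (hi ▸ hj))
          | succ i => exact i3 i j l' (by simpa using hi) hj
        · rw [i4]
          simp [h9, and_assoc]
        · rw [i5 r h1]
          have h2 : r < 40 := by omega
          rw [← hfr r (by omega) (by omega) (by omega), ← hf r (by omega) (by omega)]
          simp [ne' r (Or.inl h2)]
        · rw [List.length_cons, add_mul, one_mul]; omega
    have h9 : s₁.reg 9 = s.reg 9 := hfr 9 (by norm_num) (by norm_num) (by norm_num)
    have g2 := hs₁.consts.one
    refine ⟨fun h0 => rest _ _ (fun r h1 h2 => by simp [h1]) ?_ (by omega),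
      fun h0 => rest _ _ (fun r h1 h2 => by simp [h2]) ?_ (by omega)⟩
    · have : l ∉ ls' := fun hl => h0 (h68.2 hl)
      simp [g2, this]
    · simp [h9, h68.1 h0]

/-- Compares two inputs or two outputs: register `9` is set to `1` if their arities differ, and
otherwise the pairs of their children are added. -/
def compareKids : Program :=
  block [compareRegs 50 22 32,
    .ite 50 (icopy 9 2) (block [iconst 42 3, isub 42 21 42, icopy 40 24, icopy 41 34, icopy 51 22,
      pushKids, iconst 42 0, push])]

/-- Here `w`, the constructor minus 3, is 0 for inputs and 1 for outputs, whose payloads are related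
in reverse. After `n` payloads the addresses have reached the continuations, which are always
related in direct order. -/
theorem vc_compareKids {W L k : ℕ} {m : ℕ → ℕ} {q : List (ℕ × ℕ)} {s : State} {c : ℕ}
    {Q : State → ℕ → Prop} {N : ℕ × ℕ → Prop} (n n' w x y : ℕ) (hs : QueueState m L k q s)
    (h22 : s.reg 22 = n) (h32 : s.reg 32 = n') (h21 : s.reg 21 = w + 3) (h24 : s.reg 24 = x)
    (h34 : s.reg 34 = y)
    (hlt : n = n' → ∀ i ≤ n, (nextTree m L)^[i] x < L ∧ (nextTree m L)^[i] y < L)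
    (hN : n = n' → ∀ i < n, N (order w ((nextTree m L)^[i] x) ((nextTree m L)^[i] y)))
    (hN' : n = n' → N ((nextTree m L)^[n] x, (nextTree m L)^[n] y))
    (hW : 5 * L + 3 * (L * L) + 3 ≤ W)
    (h : ∀ s' c' q', QueueState m L k q' s' → Grows N q q' →
      (n ≠ n' → s'.reg 9 ≠ 0) →
      (n = n' → s'.reg 9 = s.reg 9 ∧
        (∀ i < n, order w ((nextTree m L)^[i] x) ((nextTree m L)^[i] y) ∈ q') ∧
        ((nextTree m L)^[n] x, (nextTree m L)^[n] y) ∈ q') →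
      (∀ r, r < 9 ∨ r = 10 → s'.reg r = s.reg r) → c' ≤ c + 24 * n + 40 → Q s' c') :
    vc W compareKids Q s c := by
  simp only [compareKids, block, vc]
  refine vc_compareRegs (by norm_num) (by norm_num) fun v c₁ hv hc₁ => ?_
  rw [h22, h32] at hv
  have g2 := hs.consts.one
  simp only [Function.update_self, Function.update_apply, Nat.reduceEqDiff, if_true, if_false,
    h22, h21, h24, h34, g2]
  refine ⟨fun hv0 => ?_, fun hv0 => ⟨by omega, ?_⟩⟩
  · have hne : n ≠ n' := fun e => hv0 (hv.2 e)
    refine h _ _ q (hs.congr rfl fun r hr => ?_) (Grows.refl N q) (fun _ => by simp)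
      (fun e => absurd e hne) (fun r hr => ?_) (by omega)
    · have : r ≠ 9 ∧ r ≠ 50 := by omega
      simp [this]
    · have : r ≠ 9 ∧ r ≠ 50 := by omega
      simp [this]
  · have he := hv.1 hv0
    have ne : ∀ r, r < 40 → r ≠ 40 ∧ r ≠ 41 ∧ r ≠ 42 ∧ r ≠ 50 ∧ r ≠ 51 := fun r hr => by omega
    refine vc_pushKids (N := N) n w x y (hs.congr rfl fun r hr => ?_) ?_ ?_ ?_ ?_
      (fun i hi => hlt he i hi.le) (hN he) (by omega) fun s₁ c₁ q₁ hs₁ hg₁ hin e40 e41 hfr hc₁ => ?_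
    · simp [ne r (by omega)]
    · simp
    · simp
    · simp
    · simp
    refine ⟨by omega, ?_⟩
    refine vc_push (N := N) (hs₁.congr rfl fun r hr => ?_) ?_ ?_ ?_ (by omega)
      fun s₂ c₂ q₂ hs₂ hg₂ hin₂ hfr₂ hc₂ => ?_
    · have : r ≠ 42 := by omega
      simp [this]
    · simpa [e40] using (hlt he n le_rfl).1
    · simpa [e41] using (hlt he n le_rfl).2
    · simpa [e40, e41, order] using hN' he
    have hfr' : ∀ r, r < 11 → s₂.reg r = s.reg r := fun r hr => by
      have : r ≠ 42 := by omega
      rw [hfr₂ r (Or.inl hr) (by omega)]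
      simp only [Function.update_of_ne this]
      rw [hfr r (Or.inl hr) (by omega)]
      simp [ne r (by omega)]
    refine h s₂ c₂ q₂ hs₂ (hg₁.trans hg₂) (fun hne => absurd he hne) (fun _ => ⟨?_, ?_, ?_⟩)
      (fun r hr => hfr' r (by omega)) (by omega)
    · exact hfr' 9 (by norm_num)
    · exact fun i hi => hg₂.mem (hin i hi)
    · simpa [e40, e41, order] using hin₂

/-! ### Comparing two unfolded types, constructor by constructor. -/

/-- Compares two branchings or two selections. -/
def compareLabels : Program :=
  block [iconst 42 5, isub 42 21 42,
    .ite 42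
      (block [iadd 60 30 3, icopy 61 33, icopy 40 34, iadd 62 20 3, icopy 63 23, icopy 64 24])
      (block [iadd 60 20 3, icopy 61 23, icopy 40 24, iadd 62 30 3, icopy 63 33, icopy 64 34]),
    matchLabels]

/-- Compares the types at two nodes that are neither variables nor binders. -/
def compareNodes : Program :=
  block [compareRegs 50 21 31,
    .ite 50 (icopy 9 2)
      (.ite 21 (block [iconst 50 4, isub 50 21 50, .ite 50 compareLabels compareKids])
        (icopy 50 50))]

/-- The registers from `b` on describe the type `V` at the node `a`. -/
structure NodeRegs (s : State) (b a : ℕ) (V : SType) : Prop where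
  node : s.reg b = a
  tag : s.reg (b + 1) = V.tag
  arg : s.reg (b + 2) = V.arg
  count : s.reg (b + 3) = V.kids.length
  first : s.reg (b + 4) = a + 2 + V.labels.length

theorem NodeRegs.congr {s s' : State} {b a : ℕ} {V : SType} (h : NodeRegs s b a V)
    (hr : ∀ r, b ≤ r → r < b + 5 → s'.reg r = s.reg r) : NodeRegs s' b a V :=
  ⟨(hr _ (by omega) (by omega)).trans h.node, (hr _ (by omega) (by omega)).trans h.tag,
    (hr _ (by omega) (by omega)).trans h.arg, (hr _ (by omega) (by omega)).trans h.count,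
    (hr _ (by omega) (by omega)).trans h.first⟩

/-- Some pair of nodes in `q` stands for the types `S` and `S'`. -/
def Visited (D : ℕ → SType → Prop) (q : List (ℕ × ℕ)) (S S' : SType) : Prop :=
  ∃ a b, (a, b) ∈ q ∧ D a S ∧ D b S'

/-- The pair of nodes stands for types that are in the subtyping relation, provided that `B`
holds. -/
def Sound (D : ℕ → SType → Prop) (B : Prop) (x : ℕ × ℕ) : Prop :=
  ∃ S S', D x.1 S ∧ D x.2 S' ∧ (B → SubtypeC S S')

/-- The result of the comparison of the types `V` and `V'`. -/
structure Compared (m : ℕ → ℕ) (L k : ℕ) (D : ℕ → SType → Prop) (B : Prop) (V V' : SType)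
    (q : List (ℕ × ℕ)) (s : State) (q' : List (ℕ × ℕ)) (s' : State) : Prop where
  state : QueueState m L k q' s'
  grows : Grows (Sound D B) q q'
  done : s'.reg 9 = 0 → s.reg 9 = 0 ∧ Step (Visited D q') V V'
  failed : s'.reg 9 ≠ 0 → s.reg 9 ≠ 0 ∨ ¬ B
  frame : ∀ r, r < 9 ∨ r = 10 → s'.reg r = s.reg r

/-- `B` stands for the subtyping statement to be decided. Under `B` the types satisfy `Step
SubtypeC`, so no label is missing and only pairs of subtypes are added. -/
theorem vc_compareBra {W L k a b : ℕ} {m : ℕ → ℕ} {q : List (ℕ × ℕ)} {s : State} {c : ℕ}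
    {Q : State → ℕ → Prop} {D : ℕ → SType → Prop} {B : Prop} {n n' : ℕ} {l : Fin n → ℕ}
    {l' : Fin n' → ℕ} {T : Fin n → SType} {T' : Fin n' → SType} (hs : QueueState m L k q s)
    (ha : HeadOK m L D a (bra n l T)) (hb : HeadOK m L D b (bra n' l' T'))
    (hra : NodeRegs s 20 a (bra n l T)) (hrb : NodeRegs s 30 b (bra n' l' T'))
    (hlt : ∀ x S, D x S → x < L) (hstep : B → Step SubtypeC (bra n l T) (bra n' l' T'))
    (hl' : Function.Injective l') (hW : 5 * L + 3 * (L * L) + 5 ≤ W)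
    (h : ∀ s' c' q', Compared m L k D B (bra n l T) (bra n' l' T') q s q' s' →
      c' ≤ c + 40 * ((n + 1) * (n' + 1)) → Q s' c') :
    vc W compareLabels Q s c := by
  obtain ⟨-, -, -, ha1, ha2, ha3⟩ := ha
  obtain ⟨-, -, -, hb1, hb2, hb3⟩ := hb
  obtain ⟨r0, r1, r2, r3, r4⟩ := hra
  obtain ⟨t0, t1, t2, t3, t4⟩ := hrb
  simp only [labels, kids, List.length_ofFn, tag, Nat.reduceAdd] at *
  have hD : ∀ i : Fin n, D ((nextTree m L)^[i] (a + 2 + n)) (T i) := fun i =>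
    ha3 i (T i) (by simp [List.getElem?_ofFn])
  have hD' : ∀ i : Fin n', D ((nextTree m L)^[i] (b + 2 + n')) (T' i) := fun i =>
    hb3 i (T' i) (by simp [List.getElem?_ofFn])
  have g3 := hs.consts.two
  simp only [compareLabels, block, vc, Function.update_apply, Nat.reduceEqDiff, if_true, if_false,
    r0, r1, r3, r4, t0, t1, t3, t4, g3, Nat.sub_self]
  refine ⟨by omega, fun h0 => absurd rfl h0, fun _ => ⟨by omega, by omega, ?_⟩⟩
  refine vc_matchLabels (N := Sound D B) (List.ofFn l) (List.ofFn l') 0 (a + 2 + n) (b + 2 + n')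
    (a + 2) (b + 2) (hs.congr rfl fun r hr => ?_) ?_ ?_ ?_ ?_ ?_ ?_ ?_ ha1 ?_ hb1 ?_ ?_ ?_ ?_
    (by omega) fun s₁ c₁ q₁ hs₁ hg₁ hin h9 hfr hc₁ => ?_
  · have : r ≠ 42 ∧ r ≠ 60 ∧ r ≠ 61 ∧ r ≠ 40 ∧ r ≠ 62 ∧ r ≠ 63 ∧ r ≠ 64 := by omega
    simp [this]
  · simp
  · simp
  · simp
  · simp
  · simp
  · simp
  · simp
  · simp only [List.length_ofFn]; omega
  · simp only [List.length_ofFn]; omega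
  · intro i hi
    rw [List.length_ofFn] at hi
    exact hlt _ _ (hD ⟨i, hi⟩)
  · intro i hi
    rw [List.length_ofFn] at hi
    exact hlt _ _ (hD' ⟨i, hi⟩)
  · intro i j v hi hj
    rw [List.getElem?_ofFn] at hi hj
    split_ifs at hi hj with hi' hj'
    rw [Option.some.injEq] at hi hj
    refine ⟨T ⟨i, hi'⟩, T' ⟨j, hj'⟩, hD ⟨i, hi'⟩, hD' ⟨j, hj'⟩, fun hB => ?_⟩
    -- `Step` yields some position with this label; injectivity of `l'` shows that it is `j`.
    obtain ⟨j₁, hj₁, hsub⟩ := hstep hB ⟨i, hi'⟩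
    rw [hi, ← hj] at hj₁
    rwa [← hl' hj₁]
  · simp only [Function.update_apply, Nat.reduceEqDiff, if_false] at h9
    refine h s₁ c₁ q₁ ⟨hs₁, hg₁, fun h0 => ?_, fun h0 => ?_, fun r hr => ?_⟩ ?_
    · obtain ⟨h1, h2⟩ := h9.1 h0
      refine ⟨h1, fun i => ?_⟩
      obtain ⟨j, hj⟩ := (List.mem_ofFn' _ _).1 (h2 (l i) ((List.mem_ofFn' _ _).2 ⟨i, rfl⟩))
      exact ⟨j, hj, _, _, hin i j (l i) (by simp [List.getElem?_ofFn])
        (by simp [List.getElem?_ofFn, hj]), hD i, hD' j⟩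
    · by_contra hcon
      rw [not_or, not_not, not_not] at hcon
      refine h0 (h9.2 ⟨hcon.1, fun v hv => ?_⟩)
      obtain ⟨i, rfl⟩ := (List.mem_ofFn' _ _).1 hv
      obtain ⟨j, hj, -⟩ := hstep hcon.2 i
      exact (List.mem_ofFn' _ _).2 ⟨j, hj⟩
    · have : r ≠ 42 ∧ r ≠ 60 ∧ r ≠ 61 ∧ r ≠ 40 ∧ r ≠ 62 ∧ r ≠ 63 ∧ r ≠ 64 := by omega
      rw [hfr r hr]
      simp [this]
    · simp only [List.length_ofFn] at hc₁
      nlinarith [Nat.zero_le (n * n')]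

/-- The labels of the right-hand type are searched in the left-hand one. So the two nodes exchange
their roles, and `w = 1` restores the order of the pairs. -/
theorem vc_compareSel {W L k a b : ℕ} {m : ℕ → ℕ} {q : List (ℕ × ℕ)} {s : State} {c : ℕ}
    {Q : State → ℕ → Prop} {D : ℕ → SType → Prop} {B : Prop} {n n' : ℕ} {l : Fin n → ℕ}
    {l' : Fin n' → ℕ} {T : Fin n → SType} {T' : Fin n' → SType} (hs : QueueState m L k q s)
    (ha : HeadOK m L D a (sel n l T)) (hb : HeadOK m L D b (sel n' l' T'))
    (hra : NodeRegs s 20 a (sel n l T)) (hrb : NodeRegs s 30 b (sel n' l' T'))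
    (hlt : ∀ x S, D x S → x < L) (hstep : B → Step SubtypeC (sel n l T) (sel n' l' T'))
    (hl : Function.Injective l) (hW : 5 * L + 3 * (L * L) + 5 ≤ W)
    (h : ∀ s' c' q', Compared m L k D B (sel n l T) (sel n' l' T') q s q' s' →
      c' ≤ c + 40 * ((n + 1) * (n' + 1)) → Q s' c') :
    vc W compareLabels Q s c := by
  obtain ⟨-, -, -, ha1, ha2, ha3⟩ := ha
  obtain ⟨-, -, -, hb1, hb2, hb3⟩ := hb
  obtain ⟨r0, r1, r2, r3, r4⟩ := hra
  obtain ⟨t0, t1, t2, t3, t4⟩ := hrb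
  simp only [labels, kids, List.length_ofFn, tag, Nat.reduceAdd] at *
  have hD : ∀ i : Fin n, D ((nextTree m L)^[i] (a + 2 + n)) (T i) := fun i =>
    ha3 i (T i) (by simp [List.getElem?_ofFn])
  have hD' : ∀ i : Fin n', D ((nextTree m L)^[i] (b + 2 + n')) (T' i) := fun i =>
    hb3 i (T' i) (by simp [List.getElem?_ofFn])
  have g3 := hs.consts.two
  simp only [compareLabels, block, vc, Function.update_apply, Nat.reduceEqDiff, if_true, if_false,
    r0, r1, r3, r4, t0, t1, t3, t4, g3, Nat.reduceSub]
  refine ⟨by omega, fun _ => ⟨by omega, by omega, ?_⟩, fun h0 => h0.elim⟩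
  refine vc_matchLabels (N := Sound D B) (List.ofFn l') (List.ofFn l) 1 (b + 2 + n') (a + 2 + n)
    (b + 2) (a + 2) (hs.congr rfl fun r hr => ?_) ?_ ?_ ?_ ?_ ?_ ?_ ?_ hb1 ?_ ha1 ?_ ?_ ?_ ?_
    (by omega) fun s₁ c₁ q₁ hs₁ hg₁ hin h9 hfr hc₁ => ?_
  · have : r ≠ 42 ∧ r ≠ 60 ∧ r ≠ 61 ∧ r ≠ 40 ∧ r ≠ 62 ∧ r ≠ 63 ∧ r ≠ 64 := by omega
    simp [this]
  · simp
  · simp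
  · simp
  · simp
  · simp
  · simp
  · simp
  · simp only [List.length_ofFn]; omega
  · simp only [List.length_ofFn]; omega
  · intro i hi
    rw [List.length_ofFn] at hi
    exact hlt _ _ (hD' ⟨i, hi⟩)
  · intro i hi
    rw [List.length_ofFn] at hi
    exact hlt _ _ (hD ⟨i, hi⟩)
  · intro j i v hj hi
    rw [List.getElem?_ofFn] at hi hj
    split_ifs at hi hj with hi' hj'
    rw [Option.some.injEq] at hi hj
    refine ⟨T ⟨i, hi'⟩, T' ⟨j, hj'⟩, hD ⟨i, hi'⟩, hD' ⟨j, hj'⟩, fun hB => ?_⟩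
    obtain ⟨i₁, hi₁, hsub⟩ := hstep hB ⟨j, hj'⟩
    rw [hj, ← hi] at hi₁
    rwa [← hl hi₁]
  · simp only [Function.update_apply, Nat.reduceEqDiff, if_false] at h9
    refine h s₁ c₁ q₁ ⟨hs₁, hg₁, fun h0 => ?_, fun h0 => ?_, fun r hr => ?_⟩ ?_
    · obtain ⟨h1, h2⟩ := h9.1 h0
      refine ⟨h1, fun j => ?_⟩
      obtain ⟨i, hi⟩ := (List.mem_ofFn' _ _).1 (h2 (l' j) ((List.mem_ofFn' _ _).2 ⟨j, rfl⟩))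
      exact ⟨i, hi, _, _, hin j i (l' j) (by simp [List.getElem?_ofFn])
        (by simp [List.getElem?_ofFn, hi]), hD i, hD' j⟩
    · by_contra hcon
      rw [not_or, not_not, not_not] at hcon
      refine h0 (h9.2 ⟨hcon.1, fun v hv => ?_⟩)
      obtain ⟨j, rfl⟩ := (List.mem_ofFn' _ _).1 hv
      obtain ⟨i, hi, -⟩ := hstep hcon.2 j
      exact (List.mem_ofFn' _ _).2 ⟨i, hi⟩
    · have : r ≠ 42 ∧ r ≠ 60 ∧ r ≠ 61 ∧ r ≠ 40 ∧ r ≠ 62 ∧ r ≠ 63 ∧ r ≠ 64 := by omega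
      rw [hfr r hr]
      simp [this]
    · simp only [List.length_ofFn] at hc₁
      nlinarith [Nat.zero_le (n * n')]

theorem getElem?_ofFn_append {α : Type*} {n : ℕ} (f : Fin n → α) (u : α) (i : Fin n) :
    (List.ofFn f ++ [u])[(i : ℕ)]? = some (f i) := by
  rw [List.getElem?_append_left (by simp)]
  simp [List.getElem?_ofFn]

theorem getElem?_ofFn_append_last {α : Type*} {n : ℕ} (f : Fin n → α) (u : α) :
    (List.ofFn f ++ [u])[n]? = some u := by
  rw [List.getElem?_append_right (by simp)]
  simp

theorem vc_compareInp {W L k a b : ℕ} {m : ℕ → ℕ} {q : List (ℕ × ℕ)} {s : State} {c : ℕ}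
    {Q : State → ℕ → Prop} {D : ℕ → SType → Prop} {B : Prop} {n n' : ℕ}
    {T : Fin n → SType} {T' : Fin n' → SType} {U U' : SType} (hs : QueueState m L k q s)
    (ha : HeadOK m L D a (inp n T U)) (hb : HeadOK m L D b (inp n' T' U'))
    (hra : NodeRegs s 20 a (inp n T U)) (hrb : NodeRegs s 30 b (inp n' T' U'))
    (hlt : ∀ x S, D x S → x < L) (hstep : B → Step SubtypeC (inp n T U) (inp n' T' U'))
    (hW : 5 * L + 3 * (L * L) + 5 ≤ W)
    (h : ∀ s' c' q', Compared m L k D B (inp n T U) (inp n' T' U') q s q' s' →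
      c' ≤ c + 24 * n + 40 → Q s' c') :
    vc W compareKids Q s c := by
  obtain ⟨-, -, -, -, -, ha3⟩ := ha
  obtain ⟨-, -, -, -, -, hb3⟩ := hb
  obtain ⟨-, r1, r2, -, r4⟩ := hra
  obtain ⟨-, t1, t2, -, t4⟩ := hrb
  simp only [labels, kids, List.length_nil, add_zero, tag, arg, Nat.reduceAdd] at *
  have hD : ∀ i : Fin n, D ((nextTree m L)^[i] (a + 2)) (T i) := fun i =>
    ha3 i (T i) (getElem?_ofFn_append _ _ i)
  have hD' : ∀ i : Fin n', D ((nextTree m L)^[i] (b + 2)) (T' i) := fun i =>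
    hb3 i (T' i) (getElem?_ofFn_append _ _ i)
  have hU : D ((nextTree m L)^[n] (a + 2)) U := ha3 n U (getElem?_ofFn_append_last _ _)
  have hU' : D ((nextTree m L)^[n'] (b + 2)) U' := hb3 n' U' (getElem?_ofFn_append_last _ _)
  refine vc_compareKids (N := Sound D B) n n' 0 (a + 2) (b + 2) hs r2 t2 r1 r4 t4 ?_ ?_ ?_
    (by omega) fun s₁ c₁ q₁ hs₁ hg₁ hne heq hfr hc₁ => ?_
  · rintro rfl i hi
    rcases hi.lt_or_eq with hi | rfl
    · exact ⟨hlt _ _ (hD ⟨i, hi⟩), hlt _ _ (hD' ⟨i, hi⟩)⟩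
    · exact ⟨hlt _ _ hU, hlt _ _ hU'⟩
  · rintro rfl i hi
    exact ⟨_, _, hD ⟨i, hi⟩, hD' ⟨i, hi⟩, fun hB => (hstep hB).2.1 _ _ rfl⟩
  · rintro rfl
    exact ⟨_, _, hU, hU', fun hB => (hstep hB).2.2⟩
  · refine h s₁ c₁ q₁ ⟨hs₁, hg₁, fun h0 => ?_, fun h0 => ?_, hfr⟩ hc₁
    · by_cases e : n = n'
      · subst e
        obtain ⟨h1, h2, h3⟩ := heq rfl
        refine ⟨h1 ▸ h0, rfl, fun i j e => ?_, _, _, h3, hU, hU'⟩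
        obtain rfl := Fin.ext e
        exact ⟨_, _, h2 i i.2, hD i, hD' i⟩
      · exact absurd h0 (hne e)
    · by_cases e : n = n'
      · exact Or.inl ((heq e).1 ▸ h0)
      · exact Or.inr fun hB => e (hstep hB).1

theorem vc_compareOut {W L k a b : ℕ} {m : ℕ → ℕ} {q : List (ℕ × ℕ)} {s : State} {c : ℕ}
    {Q : State → ℕ → Prop} {D : ℕ → SType → Prop} {B : Prop} {n n' : ℕ}
    {T : Fin n → SType} {T' : Fin n' → SType} {U U' : SType} (hs : QueueState m L k q s)
    (ha : HeadOK m L D a (out n T U)) (hb : HeadOK m L D b (out n' T' U'))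
    (hra : NodeRegs s 20 a (out n T U)) (hrb : NodeRegs s 30 b (out n' T' U'))
    (hlt : ∀ x S, D x S → x < L) (hstep : B → Step SubtypeC (out n T U) (out n' T' U'))
    (hW : 5 * L + 3 * (L * L) + 5 ≤ W)
    (h : ∀ s' c' q', Compared m L k D B (out n T U) (out n' T' U') q s q' s' →
      c' ≤ c + 24 * n + 40 → Q s' c') :
    vc W compareKids Q s c := by
  obtain ⟨-, -, -, -, -, ha3⟩ := ha
  obtain ⟨-, -, -, -, -, hb3⟩ := hb
  obtain ⟨-, r1, r2, -, r4⟩ := hra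
  obtain ⟨-, t1, t2, -, t4⟩ := hrb
  simp only [labels, kids, List.length_nil, add_zero, tag, arg, Nat.reduceAdd] at *
  have hD : ∀ i : Fin n, D ((nextTree m L)^[i] (a + 2)) (T i) := fun i =>
    ha3 i (T i) (getElem?_ofFn_append _ _ i)
  have hD' : ∀ i : Fin n', D ((nextTree m L)^[i] (b + 2)) (T' i) := fun i =>
    hb3 i (T' i) (getElem?_ofFn_append _ _ i)
  have hU : D ((nextTree m L)^[n] (a + 2)) U := ha3 n U (getElem?_ofFn_append_last _ _)
  have hU' : D ((nextTree m L)^[n'] (b + 2)) U' := hb3 n' U' (getElem?_ofFn_append_last _ _)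
  refine vc_compareKids (N := Sound D B) n n' 1 (a + 2) (b + 2) hs r2 t2 r1 r4 t4 ?_ ?_ ?_
    (by omega) fun s₁ c₁ q₁ hs₁ hg₁ hne heq hfr hc₁ => ?_
  · rintro rfl i hi
    rcases hi.lt_or_eq with hi | rfl
    · exact ⟨hlt _ _ (hD ⟨i, hi⟩), hlt _ _ (hD' ⟨i, hi⟩)⟩
    · exact ⟨hlt _ _ hU, hlt _ _ hU'⟩
  · rintro rfl i hi
    exact ⟨_, _, hD' ⟨i, hi⟩, hD ⟨i, hi⟩, fun hB => (hstep hB).2.1 _ _ rfl⟩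
  · rintro rfl
    exact ⟨_, _, hU, hU', fun hB => (hstep hB).2.2⟩
  · refine h s₁ c₁ q₁ ⟨hs₁, hg₁, fun h0 => ?_, fun h0 => ?_, hfr⟩ hc₁
    · by_cases e : n = n'
      · subst e
        obtain ⟨h1, h2, h3⟩ := heq rfl
        refine ⟨h1 ▸ h0, rfl, fun i j e => ?_, _, _, h3, hU, hU'⟩
        obtain rfl := Fin.ext e
        exact ⟨_, _, h2 i i.2, hD' i, hD i⟩
      · exact absurd h0 (hne e)
    · by_cases e : n = n'
      · exact Or.inl ((heq e).1 ▸ h0)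
      · exact Or.inr fun hB => e (hstep hB).1

theorem Compared.of_congr {m : ℕ → ℕ} {L k : ℕ} {D : ℕ → SType → Prop} {B : Prop} {V V' : SType}
    {q q' : List (ℕ × ℕ)} {s₀ s s' : State} (h : Compared m L k D B V V' q s q' s')
    (hr : ∀ r, r < 11 → s.reg r = s₀.reg r) : Compared m L k D B V V' q s₀ q' s' :=
  ⟨h.state, h.grows, fun h0 => hr 9 (by norm_num) ▸ h.done h0,
    fun h0 => hr 9 (by norm_num) ▸ h.failed h0,
    fun r h1 => (h.frame r h1).trans (hr r (by omega))⟩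

theorem vc_compareNodes {W L k a b : ℕ} {m : ℕ → ℕ} {q : List (ℕ × ℕ)} {s : State} {c : ℕ}
    {Q : State → ℕ → Prop} {D : ℕ → SType → Prop} {B : Prop} {V V' : SType}
    (hs : QueueState m L k q s) (ha : HeadOK m L D a V) (hb : HeadOK m L D b V')
    (hra : NodeRegs s 20 a V) (hrb : NodeRegs s 30 b V') (hlt : ∀ x S, D x S → x < L)
    (hstep : B → Step SubtypeC V V') (hV : V.DistinctLabels) (hV' : V'.DistinctLabels)
    (hW : 5 * L + 3 * (L * L) + 5 ≤ W)
    (h : ∀ s' c' q', Compared m L k D B V V' q s q' s' →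
      c' ≤ c + 60 * ((V.kids.length + 1) * (V'.kids.length + 1)) → Q s' c') :
    vc W compareNodes Q s c := by
  have hpos : 1 ≤ (V.kids.length + 1) * (V'.kids.length + 1) := by
    have := Nat.mul_le_mul (Nat.le_add_left 1 V.kids.length) (Nat.le_add_left 1 V'.kids.length)
    simpa using this
  have e1 : s.reg 21 = V.tag := hra.tag
  have e2 : s.reg 31 = V'.tag := hrb.tag
  simp only [compareNodes, block, vc]
  refine vc_compareRegs (by norm_num) (by norm_num) fun v c₁ hv hc₁ => ?_
  rw [e1, e2] at hv
  simp only [Function.update_self, Function.update_apply, Nat.reduceEqDiff, if_true, if_false, e1]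
  have ne : ∀ r, r < 50 → r ≠ 50 := fun r hr => by omega
  refine ⟨fun h0 => ?_, fun h0 => ?_⟩
  · refine h _ _ q ⟨hs.congr rfl fun r hr => ?_, Grows.refl _ q, fun h9 => ?_, fun _ => ?_,
      fun r hr => ?_⟩ (by omega)
    · have : r ≠ 9 ∧ r ≠ 50 := by omega
      simp [this]
    · simp [hs.consts.one] at h9
    · exact Or.inr fun hB => h0 (hv.2 (hstep hB).tag_eq)
    · have : r ≠ 9 ∧ r ≠ 50 := by omega
      simp [this]
  have htag := hv.1 h0
  refine ⟨fun ht => ⟨by omega, ?_⟩, fun ht => ?_⟩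
  · have hh := ha.1
    refine ⟨fun h5 => ?_, fun h5 => ?_⟩
    all_goals
      cases V <;> simp [tag, IsHead] at ht h5 htag hh
      all_goals
        cases V' <;> simp only [tag] at htag <;> try omega
    · rename_i n l T n' l' T'
      refine vc_compareBra (hs.congr rfl fun r hr => ?_) ha hb (hra.congr fun r h1 h2 => ?_)
        (hrb.congr fun r h1 h2 => ?_) hlt hstep hV'.1 hW fun s₁ c₁ q₁ hc h₁ =>
        h s₁ c₁ q₁ (hc.of_congr fun r hr => ?_) ?_
      · simp [ne r (by omega)]
      · simp [ne r (by omega)]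
      · simp [ne r (by omega)]
      · simp [ne r (by omega)]
      · simp only [kids, List.length_ofFn] at hpos ⊢
        omega
    · rename_i n l T n' l' T'
      refine vc_compareSel (hs.congr rfl fun r hr => ?_) ha hb (hra.congr fun r h1 h2 => ?_)
        (hrb.congr fun r h1 h2 => ?_) hlt hstep hV.1 hW fun s₁ c₁ q₁ hc h₁ =>
        h s₁ c₁ q₁ (hc.of_congr fun r hr => ?_) ?_
      · simp [ne r (by omega)]
      · simp [ne r (by omega)]
      · simp [ne r (by omega)]
      · simp [ne r (by omega)]
      · simp only [kids, List.length_ofFn] at hpos ⊢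
        omega
    · rename_i n T U n' T' U'
      refine vc_compareInp (hs.congr rfl fun r hr => ?_) ha hb (hra.congr fun r h1 h2 => ?_)
        (hrb.congr fun r h1 h2 => ?_) hlt hstep hW fun s₁ c₁ q₁ hc h₁ =>
        h s₁ c₁ q₁ (hc.of_congr fun r hr => ?_) ?_
      · simp [ne r (by omega)]
      · simp [ne r (by omega)]
      · simp [ne r (by omega)]
      · simp [ne r (by omega)]
      · simp only [kids, List.length_append, List.length_ofFn, List.length_singleton] at hpos ⊢
        nlinarith [Nat.zero_le (n * n')]
    · rename_i n T U n' T' U'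
      refine vc_compareOut (hs.congr rfl fun r hr => ?_) ha hb (hra.congr fun r h1 h2 => ?_)
        (hrb.congr fun r h1 h2 => ?_) hlt hstep hW fun s₁ c₁ q₁ hc h₁ =>
        h s₁ c₁ q₁ (hc.of_congr fun r hr => ?_) ?_
      · simp [ne r (by omega)]
      · simp [ne r (by omega)]
      · simp [ne r (by omega)]
      · simp [ne r (by omega)]
      · simp only [kids, List.length_append, List.length_ofFn, List.length_singleton] at hpos ⊢
        nlinarith [Nat.zero_le (n * n')]
  · refine h _ _ q ⟨hs.congr rfl fun r hr => ?_, Grows.refl _ q, fun h9 => ⟨?_, ?_⟩, fun h9 => ?_,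
      fun r hr => ?_⟩ (by omega)
    · simp [ne r (by omega)]
    · simpa using h9
    · cases V <;> simp only [tag] at ht htag <;> try omega
      cases V' <;> simp only [tag] at htag <;> try omega
      trivial
    · simpa using Or.inl h9
    · simp [ne r (by omega)]

/-! ### Exploring the product graph -/

/-- A simulation sees types only through their unfoldings. This makes following a jump sound. -/
theorem SubtypeC.of_unfolds {T U T' U' : SType} (h : SubtypeC T U)
    (hT : ∀ V, Unfolds T' V → Unfolds T V) (hU : ∀ V, Unfolds U V → Unfolds U' V) :
    SubtypeC T' U' := by
  obtain ⟨R, hR, hTU⟩ := h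
  refine ⟨fun A B => ∃ A' B', R A' B' ∧ (∀ V, Unfolds A V → Unfolds A' V) ∧
    ∀ V, Unfolds B' V → Unfolds B V, ?_, T, U, hTU, hT, hU⟩
  have lift : ∀ A B, R A B → ∃ A' B', R A' B' ∧ (∀ V, Unfolds A V → Unfolds A' V) ∧
    ∀ V, Unfolds B' V → Unfolds B V := fun A B h => ⟨A, B, h, fun _ => id, fun _ => id⟩
  constructor
  · rintro A B ⟨A', B', h, hA, hB⟩ n T' S₁ hu
    obtain ⟨U', S₂, h1, h2, h3⟩ := hR.inp _ _ h _ _ _ (hA _ hu)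
    exact ⟨U', S₂, hB _ h1, fun i => lift _ _ (h2 i), lift _ _ h3⟩
  · rintro A B ⟨A', B', h, hA, hB⟩ n T' S₁ hu
    obtain ⟨U', S₂, h1, h2, h3⟩ := hR.out _ _ h _ _ _ (hA _ hu)
    exact ⟨U', S₂, hB _ h1, fun i => lift _ _ (h2 i), lift _ _ h3⟩
  · rintro A B ⟨A', B', h, hA, hB⟩ n l T' hu
    obtain ⟨n', l', U', h1, h2⟩ := hR.bra _ _ h _ _ _ (hA _ hu)
    exact ⟨n', l', U', hB _ h1, fun i => (h2 i).imp fun j hj => ⟨hj.1, lift _ _ hj.2⟩⟩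
  · rintro A B ⟨A', B', h, hA, hB⟩ n l T' hu
    obtain ⟨n', l', U', h1, h2⟩ := hR.sel _ _ h _ _ _ (hA _ hu)
    exact ⟨n', l', U', hB _ h1, fun i => (h2 i).imp fun j hj => ⟨hj.1, lift _ _ hj.2⟩⟩
  · rintro A B ⟨A', B', h, hA, hB⟩ hu
    exact hB _ (hR.tend _ _ h (hA _ hu))

theorem unfolds_mu_iff {X : ℕ} {T V : SType} :
    Unfolds (mu X T) V ↔ Unfolds (subst X (mu X T) T) V := by
  refine ⟨fun h => ?_, .mu X T V⟩
  cases h with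
  | self _ h => exact absurd rfl (h X T)
  | mu _ _ _ h => exact h

/-- The node `a` is a variable or a binder. -/
def IsJump (m : ℕ → ℕ) (a : ℕ) : Prop := m a = 1 ∨ m a = 2

/-- The pairs that have to be related if the types at the nodes `a` and `b` are, occur in `q`. -/
structure PairDone (m : ℕ → ℕ) (L : ℕ) (D : ℕ → SType → Prop) (q : List (ℕ × ℕ)) (a b : ℕ) :
    Prop where
  left : IsJump m a → (m (3 * L + a), b) ∈ q
  right : ¬ IsJump m a → IsJump m b → (a, m (3 * L + b)) ∈ q
  step : ¬ IsJump m a → ¬ IsJump m b → ∀ S S', D a S → D b S' → Step (Visited D q) S S'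

theorem PairDone.mono {m : ℕ → ℕ} {L : ℕ} {D : ℕ → SType → Prop} {q q' : List (ℕ × ℕ)} {a b : ℕ}
    (h : PairDone m L D q a b) (hq : ∀ x ∈ q, x ∈ q') : PairDone m L D q' a b :=
  ⟨fun h1 => hq _ (h.left h1), fun h1 h2 => hq _ (h.right h1 h2), fun h1 h2 S S' h3 h4 =>
    (h.step h1 h2 S S' h3 h4).mono fun _ _ ⟨x, y, hx, hD⟩ => ⟨x, y, hq _ hx, hD⟩⟩

theorem ParseInv.nodeOK {m : ℕ → ℕ} {L n : ℕ} {D : ℕ → SType → Prop} {A : Finset ℕ}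
    (inv : ParseInv m L n L [] D A) {a : ℕ} {S : SType} (h : D a S) :
    a ∈ A ∧ NodeOK m L D a S := by
  simpa [pending] using inv.node a S h

theorem HeadOK.not_isJump {m : ℕ → ℕ} {L : ℕ} {D : ℕ → SType → Prop} {a : ℕ} {V : SType}
    (h : HeadOK m L D a V) : ¬ IsJump m a := by
  have h1 := h.1
  have h2 := h.2.1
  simp only [IsHead] at h1
  simp only [IsJump]
  omega

theorem NodeOK.jump {m : ℕ → ℕ} {L : ℕ} {D : ℕ → SType → Prop} {a : ℕ} {V : SType}
    (h : NodeOK m L D a V) (ha : IsJump m a) :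
    ∃ V', D (m (3 * L + a)) V' ∧ ∀ U, Unfolds V' U ↔ Unfolds V U := by
  rcases h with ⟨-, h, -⟩ | ⟨-, X, S, rfl, h⟩ | h
  · exact ⟨V, h, fun _ => Iff.rfl⟩
  · exact ⟨_, h, fun _ => unfolds_mu_iff.symm⟩
  · exact absurd ha h.not_isJump

theorem NodeOK.headOK {m : ℕ → ℕ} {L : ℕ} {D : ℕ → SType → Prop} {a : ℕ} {V : SType}
    (h : NodeOK m L D a V) (ha : ¬ IsJump m a) : HeadOK m L D a V := by
  rcases h with ⟨h, -⟩ | ⟨h, -⟩ | h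
  · exact absurd (Or.inl h) ha
  · exact absurd (Or.inr h) ha
  · exact h

theorem NodeOK.bounds {m : ℕ → ℕ} {L : ℕ} {D : ℕ → SType → Prop} {a : ℕ} {V : SType}
    (h : NodeOK m L D a V) :
    childCount (m a) (m (a + 1)) ≤ L + 1 ∧ labelCount (m a) (m (a + 1)) ≤ L := by
  rcases h with ⟨h, -⟩ | ⟨h, -⟩ | ⟨-, h1, h2, -, h3, -⟩
  · simp [h, childCount, labelCount]
  · simp [h, childCount, labelCount]
  · rw [h1, h2, ← length_kids, ← length_labels]
    omega

/-- Adds the pair that results from following the jump at the first node. -/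
def followLeft : Program :=
  block [iadd 40 6 20, iload 40 40, icopy 41 30, iconst 42 0, push]

/-- Adds the pair that results from following the jump at the second node. -/
def followRight : Program :=
  block [icopy 40 20, iadd 41 6 30, iload 41 41, iconst 42 0, push]

/-- Deals with the pair of the nodes in the registers `20` and `30`. -/
def visitNodes : Program :=
  block [readNode 20, readNode 30, .ite 25 followLeft (.ite 35 followRight compareNodes)]

/-- A jump preserves the unfolding, so it only adds an equivalent pair. Jumps on the right wait
until the left node is not a jump, as in `PairDone`. -/
theorem vc_visitNodes {W L n k a b : ℕ} {m : ℕ → ℕ} {q : List (ℕ × ℕ)} {s : State} {c : ℕ}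
    {Q : State → ℕ → Prop} {D : ℕ → SType → Prop} {A : Finset ℕ} {B : Prop}
    (inv : ParseInv m L n L [] D A) (hs : QueueState m L k q s) (h20 : s.reg 20 = a)
    (h30 : s.reg 30 = b) (hab : Sound D B (a, b)) (hW : 5 * L + 3 * (L * L) + 5 ≤ W)
    (h : ∀ s' c' q', QueueState m L k q' s' → Grows (Sound D B) q q' →
      (s'.reg 9 = 0 → s.reg 9 = 0 ∧ PairDone m L D q' a b) →
      (s'.reg 9 ≠ 0 → s.reg 9 ≠ 0 ∨ ¬ B) →
      (∀ r, r < 9 ∨ r = 10 → s'.reg r = s.reg r) → c' ≤ c + 110 * (weight m a * weight m b) →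
      Q s' c') :
    vc W visitNodes Q s c := by
  obtain ⟨S, S', hS, hS', hB⟩ := hab
  dsimp only at hS hS'
  have haL := inv.lt_length hS
  have hbL := inv.lt_length hS'
  have na := (inv.nodeOK hS).2
  have nb := (inv.nodeOK hS').2
  have ba := na.bounds
  have bb := nb.bounds
  have ma : s.mem a = m a := hs.mem.low _ (by omega)
  have ma' : s.mem (a + 1) = m (a + 1) := hs.mem.low _ (by omega)
  have mb : s.mem b = m b := hs.mem.low _ (by omega)
  have mb' : s.mem (b + 1) = m (b + 1) := hs.mem.low _ (by omega)
  have hww : 1 ≤ weight m a * weight m b := by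
    simpa using Nat.mul_le_mul (show 1 ≤ weight m a by simp [weight])
      (show 1 ≤ weight m b by simp [weight])
  simp only [visitNodes, block, vc]
  refine vc_readNode (by norm_num) hs.consts.one hs.consts.two (by omega) ?_ ?_
    fun s₁ c₁ hm₁ a1 a2 a3 a4 a5 afr hc₁ => ?_
  · rw [h20, ma, ma']; omega
  · rw [h20, ma, ma']; omega
  simp only [h20, ma, ma', Nat.reduceAdd] at a1 a2 a3 a4 a5
  have g30 : s₁.reg 30 = b := (afr 30 (by norm_num)).trans h30
  refine vc_readNode (by norm_num) ((afr 2 (by norm_num)).trans hs.consts.one)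
    ((afr 3 (by norm_num)).trans hs.consts.two) (by omega) ?_ ?_
    fun s₂ c₂ hm₂ b1 b2 b3 b4 b5 bfr hc₂ => ?_
  · rw [g30, hm₁, mb, mb']; omega
  · rw [g30, hm₁, mb, mb']; omega
  simp only [g30, hm₁, mb, mb', Nat.reduceAdd] at b1 b2 b3 b4 b5
  have hfr : ∀ r, r < 20 → s₂.reg r = s.reg r := fun r hr =>
    (bfr r (by omega)).trans (afr r (by omega))
  have g20 : s₂.reg 20 = a := (bfr 20 (by norm_num)).trans ((afr 20 (by norm_num)).trans h20)
  have g30' : s₂.reg 30 = b := (bfr 30 (by norm_num)).trans g30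
  have hs₂ : QueueState m L k q s₂ := hs.congr (hm₂.trans hm₁) fun r hr => hfr r (by omega)
  have g25 : s₂.reg 25 = s₁.reg 25 := bfr 25 (by norm_num)
  have g6 := hs₂.consts.length3
  have ne : ∀ r, r < 40 → r ≠ 40 ∧ r ≠ 41 ∧ r ≠ 42 := fun r hr => by omega
  have jump : ∀ x T, D x T → x < L → s₂.mem (3 * L + x) = m (3 * L + x) := fun x T _ hx =>
    hs₂.mem.low _ (by omega)
  -- one of the nodes is a jump: the pair `(x, y)` is added
  have follow : ∀ f x y c₃, f 40 = x → f 41 = y → f 42 = 0 → (∀ r, r < 40 → f r = s₂.reg r) →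
      x < L → y < L → Sound D B (x, y) → c₃ ≤ c + 40 → (∀ q', (x, y) ∈ q' →
        PairDone m L D q' a b) → vc W push Q ⟨f, s₂.mem⟩ c₃ := by
    intro f x y c₃ f40 f41 f42 ffr hx hy hsound hc₃ hdone
    refine vc_push (N := Sound D B) (hs₂.congr rfl fun r hr => ffr r (by omega))
      (by simpa [f40] using hx) (by simpa [f41] using hy)
      (by simpa [f40, f41, f42, order] using hsound) (by omega) fun s₄ c₄ q₄ hs₄ hg₄ hin fr₄ hc₄ => ?_
    have e : ∀ r, r < 11 → s₄.reg r = s.reg r := fun r hr =>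
      (fr₄ r (by omega) (by omega)).trans ((ffr r (by omega)).trans (hfr r (by omega)))
    refine h s₄ c₄ q₄ hs₄ hg₄ (fun h9 => ⟨e 9 (by norm_num) ▸ h9, hdone q₄ ?_⟩)
      (fun h9 => Or.inl (e 9 (by norm_num) ▸ h9)) (fun r hr => e r (by omega)) (by omega)
    simpa [f40, f41, f42, order] using hin
  refine ⟨fun h25 => ?_, fun h25 => ⟨fun h35 => ?_, fun h35 => ?_⟩⟩
  · have hj : IsJump m a := by
      have : m a ≠ 0 ∧ m a < 3 := by
        rw [g25] at h25
        have := mt a5.2 h25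
        omega
      simp only [IsJump]; omega
    obtain ⟨R, hR, hun⟩ := na.jump hj
    simp only [followLeft, block, vc, Function.update_apply, Nat.reduceEqDiff, if_true, if_false,
      g6, g20, g30', jump a S hS haL]
    refine ⟨by omega, Nat.zero_le _, ?_⟩
    refine follow _ (m (3 * L + a)) b _ (by simp) (by simp) (by simp)
      (fun r hr => by simp [ne r hr]) (inv.lt_length hR) hbL ⟨R, S', hR, hS', fun hb => ?_⟩
      (by omega) fun q' hq' => ⟨fun _ => hq', fun h1 => absurd hj h1, fun h1 => absurd hj h1⟩
    exact (hB hb).of_unfolds (fun V hV => (hun V).1 hV) fun _ => id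
  · have hnj : ¬ IsJump m a := by
      rw [g25] at h25
      have := a5.1 h25
      simp only [IsJump]; omega
    have hj : IsJump m b := by
      have := mt b5.2 h35
      simp only [IsJump]; omega
    obtain ⟨R, hR, hun⟩ := nb.jump hj
    simp only [followRight, block, vc, Function.update_apply, Nat.reduceEqDiff, if_true, if_false,
      g6, g20, g30', jump b S' hS' hbL]
    refine ⟨by omega, Nat.zero_le _, ?_⟩
    refine follow _ a (m (3 * L + b)) _ (by simp) (by simp) (by simp)
      (fun r hr => by simp [ne r hr]) haL (inv.lt_length hR) ⟨S, R, hS, hR, fun hb => ?_⟩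
      (by omega) fun q' hq' => ⟨fun h1 => absurd h1 hnj, fun _ _ => hq', fun _ h1 => absurd hj h1⟩
    exact (hB hb).of_unfolds (fun _ => id) fun V hV => (hun V).2 hV
  · have hna : ¬ IsJump m a := by
      rw [g25] at h25
      have := a5.1 h25
      simp only [IsJump]; omega
    have hnb : ¬ IsJump m b := by
      have := b5.1 h35
      simp only [IsJump]; omega
    have ha := na.headOK hna
    have hb := nb.headOK hnb
    have unfolds_self : ∀ {x V}, HeadOK m L D x V → Unfolds V V := fun {x V} hV =>
      .self V fun X T e => by
        have := hV.1
        subst e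
        simp [IsHead, tag] at this
    have hwa : weight m a = S.kids.length + 1 := by
      rw [weight, ha.2.1, ha.2.2.1, ← length_kids, add_comm]
    have hwb : weight m b = S'.kids.length + 1 := by
      rw [weight, hb.2.1, hb.2.2.1, ← length_kids, add_comm]
    rw [ha.2.1, ha.2.2.1, ← length_kids] at a3
    rw [ha.2.1, ha.2.2.1, ← length_labels] at a4
    rw [hb.2.1, hb.2.2.1, ← length_kids] at b3
    rw [hb.2.1, hb.2.2.1, ← length_labels] at b4
    have fr20 : ∀ r, r < 26 → s₂.reg r = s₁.reg r := fun r hr => bfr r (by omega)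
    refine vc_compareNodes (B := B) hs₂ ha hb
      ⟨g20, (fr20 _ (by norm_num)).trans (a1.trans ha.2.1),
        (fr20 _ (by norm_num)).trans (a2.trans ha.2.2.1), (fr20 _ (by norm_num)).trans a3,
        (fr20 _ (by norm_num)).trans a4⟩
      ⟨g30', b1.trans hb.2.1, b2.trans hb.2.2.1, b3, b4⟩ (fun x T hT => inv.lt_length hT)
      (fun hb' => (hB hb').step (inv.session _ _ hS) (unfolds_self ha) (unfolds_self hb))
      (inv.session _ _ hS).distinctLabels (inv.session _ _ hS').distinctLabels hW
      fun s₃ c₃ q₃ hc₃ hle => ?_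
    rw [← hwa, ← hwb] at hle
    refine h s₃ c₃ q₃ hc₃.state hc₃.grows (fun h9 => ?_) (fun h9 => ?_) (fun r hr => ?_) (by omega)
    · obtain ⟨h1, h2⟩ := hc₃.done h9
      refine ⟨hfr 9 (by norm_num) ▸ h1, fun h' => absurd h' hna, fun _ h' => absurd h' hnb,
        fun _ _ T T' hT hT' => ?_⟩
      rwa [inv.functional _ _ _ hT hS, inv.functional _ _ _ hT' hS']
    · rw [← hfr 9 (by norm_num)]
      exact hc₃.failed h9
    · exact (hc₃.frame r hr).trans (hfr r (by omega))

/-- Deals with the first pair in the queue that has not been dealt with yet. -/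
def visitPair : Program :=
  block [iload 20 10, iadd 10 10 2, iload 30 10, iadd 10 10 2, isub 11 11 2, visitNodes]

theorem vc_visitPair {W L n k a b : ℕ} {m : ℕ → ℕ} {q : List (ℕ × ℕ)} {s : State} {c : ℕ}
    {Q : State → ℕ → Prop} {D : ℕ → SType → Prop} {A : Finset ℕ} {B : Prop}
    (inv : ParseInv m L n L [] D A) (hs : QueueState m L k q s)
    (h10 : s.reg 10 = 5 * L + L * L + 2 * k) (hk : q[k]? = some (a, b))
    (hab : Sound D B (a, b)) (hW : 5 * L + 3 * (L * L) + 5 ≤ W)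
    (h : ∀ s' c' q', QueueState m L (k + 1) q' s' → Grows (Sound D B) q q' →
      (s'.reg 9 = 0 → s.reg 9 = 0 ∧ PairDone m L D q' a b) →
      (s'.reg 9 ≠ 0 → s.reg 9 ≠ 0 ∨ ¬ B) → s'.reg 10 = 5 * L + L * L + 2 * (k + 1) →
      (∀ r < 9, s'.reg r = s.reg r) → c' ≤ c + 120 * (weight m a * weight m b) →
      Q s' c') :
    vc W visitPair Q s c := by
  have hlen := hs.mem.length_le
  have hklt := (List.getElem?_eq_some_iff.1 hk).1
  have hcount := hs.count
  have g2 := hs.consts.one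
  obtain ⟨ha, hb⟩ := hs.mem.queue k a b hk
  have hww : 1 ≤ weight m a * weight m b := by
    simpa using Nat.mul_le_mul (show 1 ≤ weight m a by simp [weight])
      (show 1 ≤ weight m b by simp [weight])
  have ne : ∀ r, r < 10 ∨ r = 12 → r ≠ 10 ∧ r ≠ 11 ∧ r ≠ 20 ∧ r ≠ 30 := fun r hr => by omega
  simp only [visitPair, block, vc, Function.update_apply, Nat.reduceEqDiff, if_true, if_false,
    h10, g2, ha, hb]
  refine ⟨by omega, by omega, ?_⟩
  refine vc_visitNodes (B := B) (k := k + 1) inv ⟨?_, hs.mem, ?_, ?_⟩ (by simp) (by simp) hab hW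
    fun s₁ c₁ q₁ hs₁ hg₁ hd hf hfr hc₁ => ?_
  · exact hs.consts.congr fun r hr => by simp [ne r (by omega)]
  · simp; omega
  · simpa using hs.last
  · refine h s₁ c₁ q₁ hs₁ hg₁ (by simpa using hd) (by simpa using hf) ?_ (fun r hr => ?_) (by omega)
    · rw [hfr 10 (by norm_num)]; simp; omega
    · rw [hfr r (Or.inl hr)]; simp [ne r (by omega)]

/-- Deals with the pairs in the queue until there are none left. -/
def explore : Program := .loop 11 visitPair

/-- Although the queue grows, `L * L - k` decreases, since the queue has at most `L * L` entries.
The search continues after a failure; the cost bound holds in either case. The factor 121 is 120 for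
the pair and 1 for the loop test. -/
theorem vc_explore {W L n k : ℕ} {m : ℕ → ℕ} {q : List (ℕ × ℕ)} {s : State} {c : ℕ}
    {Q : State → ℕ → Prop} {D : ℕ → SType → Prop} {A : Finset ℕ} {B : Prop}
    (inv : ParseInv m L n L [] D A) (hs : QueueState m L k q s)
    (h10 : s.reg 10 = 5 * L + L * L + 2 * k) (hq : ∀ x ∈ q, Sound D B x)
    (hdone : s.reg 9 = 0 → ∀ i < k, ∀ a b, q[i]? = some (a, b) → PairDone m L D q a b)
    (hfail : s.reg 9 ≠ 0 → ¬ B) (hW : 5 * L + 3 * (L * L) + 5 ≤ W)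
    (h : ∀ s' c' q', QueueState m L q'.length q' s' → q <+: q' → (∀ x ∈ q', Sound D B x) →
      (s'.reg 9 = 0 → ∀ a b, (a, b) ∈ q' → PairDone m L D q' a b) →
      (s'.reg 9 ≠ 0 → ¬ B) → (∀ r < 9, s'.reg r = s.reg r) →
      c' ≤ c + ((q'.drop k).map fun x => 121 * (weight m x.1 * weight m x.2)).sum + 1 →
      Q s' c') :
    vc W explore Q s c := by
  induction hd : L * L - k using Nat.strong_induction_on generalizing s c q k with
  | _ d ih =>
    have hlen := hs.mem.length_le
    have hcount := hs.count
    refine vc_loop_unroll (fun h0 => ?_) fun h0 => ?_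
    · have hkq : k = q.length := by omega
      subst hkq
      refine h s _ q hs (List.prefix_refl q) hq (fun h9 a b hab => ?_) hfail (fun _ _ => rfl)
        (by omega)
      obtain ⟨i, hi, e⟩ := List.mem_iff_getElem.1 hab
      exact hdone h9 i hi a b (by rw [List.getElem?_eq_getElem hi, e])
    · have hklt : k < q.length := by omega
      obtain ⟨⟨a, b⟩, hab⟩ : ∃ x, q[k]? = some x := ⟨_, List.getElem?_eq_getElem hklt⟩
      refine vc_visitPair (B := B) inv hs h10 hab (hq _ (List.mem_of_getElem? hab)) hW
        fun s₁ c₁ q₁ hs₁ hg₁ hd₁ hf₁ e10 hfr hc₁ => ?_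
      refine ih (L * L - (k + 1)) (by omega) hs₁ e10 (fun x hx => (hg₁.2 x hx).elim (hq x) id)
        (fun h9 i hi a' b' hab' => ?_) (fun h9 => (hf₁ h9).elim hfail id) ?_ rfl
      · obtain ⟨h9', hdone₁⟩ := hd₁ h9
        have hpre : ∀ j < q.length, q₁[j]? = q[j]? := fun j hj => by
          obtain ⟨t, rfl⟩ := hg₁.1
          exact List.getElem?_append_left hj
        rw [hpre i (by omega)] at hab'
        rcases Nat.lt_succ_iff_lt_or_eq.1 hi with hi | rfl
        · exact (hdone h9' i hi a' b' hab').mono fun x hx => hg₁.mem hx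
        · rw [hab, Option.some.injEq, Prod.mk.injEq] at hab'
          obtain ⟨rfl, rfl⟩ := hab'
          exact hdone₁
      · intro s' c' q' i1 i2 i3 i4 i5 i6 i7
        refine h s' c' q' i1 (hg₁.1.trans i2) i3 i4 i5 (fun r hr => (i6 r hr).trans (hfr r hr)) ?_
        have hkq : q'[k]? = some (a, b) := by
          obtain ⟨t, rfl⟩ := hg₁.1.trans i2
          rw [List.getElem?_append_left hklt, hab]
        obtain ⟨hlt, e⟩ := List.getElem?_eq_some_iff.1 hkq
        have hww : 1 ≤ weight m a * weight m b := by
          simpa using Nat.mul_le_mul (show 1 ≤ weight m a by simp [weight])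
            (show 1 ≤ weight m b by simp [weight])
        rw [List.drop_eq_getElem_cons hlt, e, List.map_cons, List.sum_cons]
        dsimp only
        omega

/-! ### Total cost of the search, and the simulation that it yields. -/

/-- The time that is needed to deal with all pairs of nodes. -/
theorem ParseInv.sum_weight_le {m mem : ℕ → ℕ} {L n : ℕ} {D : ℕ → SType → Prop} {A : Finset ℕ}
    {B : Prop} {q : List (ℕ × ℕ)} (inv : ParseInv m L n L [] D A) (hq : QueueMem m L q mem)
    (hD : ∀ x ∈ q, Sound D B x) :
    (q.map fun x => 121 * (weight m x.1 * weight m x.2)).sum ≤ 121 * (2 * n) ^ 2 := by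
  have hsub : q.toFinset ⊆ A ×ˢ A := by
    rintro ⟨a, b⟩ hx
    obtain ⟨S, S', hS, hS', -⟩ := hD _ (List.mem_toFinset.1 hx)
    exact Finset.mem_product.2 ⟨(inv.nodeOK hS).1, (inv.nodeOK hS').1⟩
  have hw : ∑ a ∈ A, weight m a ≤ 2 * n := by simpa using inv.weight_le
  -- Pairs are not repeated and lie in `A ×ˢ A`, so the sum of the products is at most the square of
  -- the sum of the weights.
  calc (q.map fun x => 121 * (weight m x.1 * weight m x.2)).sum
      = ∑ x ∈ q.toFinset, 121 * (weight m x.1 * weight m x.2) :=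
        (List.sum_toFinset _ hq.nodup).symm
    _ ≤ ∑ x ∈ A ×ˢ A, 121 * (weight m x.1 * weight m x.2) :=
        Finset.sum_le_sum_of_subset hsub
    _ = 121 * (∑ a ∈ A, weight m a) ^ 2 := by
        rw [← Finset.mul_sum, sq, Finset.sum_mul_sum, Finset.sum_product]
    _ ≤ 121 * (2 * n) ^ 2 := by gcongr

/-- Following the jumps from a node leads to the unfolding of its type. -/
theorem ParseInv.exists_headOK {m : ℕ → ℕ} {L n : ℕ} {D : ℕ → SType → Prop} {A : Finset ℕ}
    (inv : ParseInv m L n L [] D A) {P : ℕ → Prop}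
    (hP : ∀ a, P a → IsJump m a → P (m (3 * L + a))) {S V : SType} (h : Unfolds S V) {a : ℕ}
    (ha : D a S) (hPa : P a) : ∃ b, P b ∧ D b V ∧ HeadOK m L D b V := by
  induction h generalizing a with
  | self S hS =>
    -- A variable node cannot carry an unfolded type, as its jump would lead to a binder with that
    -- same type.
    rcases (inv.nodeOK ha).2 with ⟨h1, h2, h3⟩ | ⟨-, X, T, e, -⟩ | h1
    · rcases (inv.nodeOK h2).2 with ⟨h4, -⟩ | ⟨-, X, T, e, -⟩ | h4
      · omega
      · exact absurd e (hS X T)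
      · exact absurd (Or.inr h3) h4.not_isJump
    · exact absurd e (hS X T)
    · exact ⟨a, hPa, ha, h1⟩
  | mu X T V _ ih =>
    -- The jump of a variable leaves the type unchanged, so the induction on the unfolding makes no
    -- progress there. But `NodeOK` ensures that it lands on a binder, whose own jump does unfold.
    have key : ∀ b, D b (SType.mu X T) → P b → m b = 2 → ∃ b, P b ∧ D b V ∧ HeadOK m L D b V := by
      intro b hb hPb h2
      rcases (inv.nodeOK hb).2 with ⟨h4, -⟩ | ⟨-, Y, T', e, h3⟩ | h4
      · omega
      · cases e
        exact ih h3 (hP b hPb (Or.inr h2))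
      · exact absurd (Or.inr h2) h4.not_isJump
    rcases (inv.nodeOK ha).2 with ⟨h1, h2, h3⟩ | ⟨h1, -⟩ | h1
    · exact key _ h2 (hP a hPa (Or.inl h1)) h3
    · exact key a ha hPa h1
    · have := h1.1
      simp [IsHead, tag] at this

/-- Following the jumps on the left and then those on the right stays inside `q` and ends at a pair
of nodes that carry the two unfoldings; there `PairDone` provides `Step`. -/
theorem ParseInv.subtypeC {m : ℕ → ℕ} {L n : ℕ} {D : ℕ → SType → Prop} {A : Finset ℕ}
    (inv : ParseInv m L n L [] D A) {q : List (ℕ × ℕ)}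
    (hq : ∀ a b, (a, b) ∈ q → PairDone m L D q a b) {S S' : SType} (h : Visited D q S S') :
    SubtypeC S S' := by
  refine ⟨Visited D q, isTypeSimulation_of_step fun T U hTU => ?_, h⟩
  obtain ⟨a, b, hab, ha, hb⟩ := hTU
  obtain ⟨V, hV⟩ := (inv.session _ _ ha).exists_unfolds
  obtain ⟨V', hV'⟩ := (inv.session _ _ hb).exists_unfolds
  obtain ⟨a', hab', hDa, ha'⟩ := inv.exists_headOK (P := fun x => (x, b) ∈ q)
    (fun x hx hj => (hq _ _ hx).left hj) hV ha hab
  obtain ⟨b', hab'', hDb, hb'⟩ := inv.exists_headOK (P := fun x => (a', x) ∈ q)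
    (fun x hx hj => (hq _ _ hx).right ha'.not_isJump hj) hV' hb hab'
  refine ⟨V, V', hV, hV', (hq _ _ hab'').step ha'.not_isJump hb'.not_isJump V V' hDa hDb⟩

/-! ### The decision procedure -/

/-- The syntax graph at the beginning: the codes of `T` and `U` are still to be read. -/
theorem parseInv_initState {T U : SType} (hT : T.IsSessionType) (hU : U.IsSessionType) :
    ParseInv (initState T U).mem (T.code.length + U.code.length) (T.size + U.size) 0
      [(T, var), (U, var)] (fun a V => (a = 0 ∧ V = T) ∨ (a = T.code.length ∧ V = U)) ∅ := by
  have h2 := T.two_le_length_code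
  have hc : ∀ S : SType, S.close var = S := fun S => close_of_eq_var S fun _ => rfl
  constructor
  · refine matches_of_getD fun i _ => ?_
    simp [initState]
  · simp
  · intro x hx
    simp only [initState]
    rw [List.getD_eq_default]
    rw [List.length_append]; omega
  · rintro a V (⟨rfl, rfl⟩ | ⟨rfl, rfl⟩)
    · exact Or.inr ⟨V, var, by simp [pending], (hc _).symm⟩
    · exact Or.inr ⟨V, var, by simp [pending], (hc _).symm⟩
  · simp
  · intro a S σ h
    simp only [pending, List.mem_cons, Prod.mk.injEq, List.not_mem_nil, or_false] at h
    rcases h with ⟨rfl, rfl, rfl⟩ | ⟨rfl, rfl, rfl⟩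
    · exact Or.inl ⟨rfl, hc _⟩
    · exact Or.inr ⟨by simp, hc _⟩
  -- The roots have no parents, but as closed types they have no free variable to look up.
  · intro a S σ h X hX
    simp only [pending, List.mem_cons, Prod.mk.injEq, List.not_mem_nil, or_false] at h
    rcases h with ⟨rfl, rfl, rfl⟩ | ⟨rfl, rfl, rfl⟩
    · rw [hT.closed] at hX; exact hX.elim
    · rw [hU.closed] at hX; exact hX.elim
  · rintro a V V' (⟨rfl, rfl⟩ | ⟨rfl, rfl⟩) (⟨h, rfl⟩ | ⟨h, rfl⟩) <;> first | rfl | omega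
  · rintro a V (⟨rfl, rfl⟩ | ⟨rfl, rfl⟩) <;> assumption
  · simp; omega

/-- Fills the table of the rows. -/
def initRows : Program := .loop 42 (block [istore 40 41, iadd 40 40 2, iadd 41 41 4, isub 42 42 2])

/-- The multiples of `L` arise by repeated addition; the last one, left in register 41, is the
address of the queue. -/
theorem vc_initRows {W L j : ℕ} {s : State} {c : ℕ} {Q : State → ℕ → Prop} (hs : Consts L s)
    (h40 : s.reg 40 = 4 * L + j) (h41 : s.reg 41 = 5 * L + j * L) (h42 : s.reg 42 + j = L)
    (hW : 5 * L + 3 * (L * L) + 5 ≤ W)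
    (h : ∀ s' c', (∀ x, x < 4 * L + j ∨ 5 * L ≤ x → s'.mem x = s.mem x) →
      (∀ a, j ≤ a → a < L → s'.mem (4 * L + a) = 5 * L + a * L) →
      s'.reg 41 = 5 * L + L * L → (∀ r < 40, s'.reg r = s.reg r) →
      c' ≤ c + 5 * (L - j) + 1 → Q s' c') :
    vc W initRows Q s c := by
  induction hd : L - j generalizing s c j with
  | zero =>
    refine vc_loop_unroll (fun _ => ?_) fun h0 => absurd (by omega) h0
    have : j = L := by omega
    subst this
    exact h _ _ (fun _ _ => rfl) (fun a h1 h2 => by omega) h41 (fun _ _ => rfl) (by omega)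
  | succ d ih =>
    refine vc_loop_unroll (fun h0 => by omega) fun _ => ?_
    have hj : (j + 1) * L ≤ L * L := Nat.mul_le_mul_right _ (by omega)
    have e1 : (j + 1) * L = j * L + L := by ring
    have g2 := hs.one
    have g4 := hs.length
    simp only [block, vc, Function.update_apply, Nat.reduceEqDiff, if_true, if_false, h40, h41, g2,
      g4]
    refine ⟨by omega, by omega, ?_⟩
    have ne : ∀ r, r < 40 → r ≠ 40 ∧ r ≠ 41 ∧ r ≠ 42 := fun r hr => by omega
    refine ih (j := j + 1) (hs.congr fun r hr => ?_) ?_ ?_ ?_ ?_ (by omega)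
    · simp [ne r (by omega)]
    · simp [add_assoc]
    · simp; omega
    · simp; omega
    · intro s' c' i1 i2 i3 i4 i5
      refine h s' c' (fun x hx => ?_) (fun a ha ha' => ?_) i3 (fun r hr => ?_) (by omega)
      · rw [i1 x (by omega)]
        exact Function.update_of_ne (by omega) _ _
      · rcases ha.eq_or_lt with rfl | ha
        · rw [i1 _ (by omega)]
          simp
        · exact i2 a ha ha'
      · rw [i4 r hr]; simp [ne r hr]

/-- Sets up the constants. -/
def initConsts : Program :=
  block [iconst 2 1, iconst 3 2, iadd 4 0 1, iadd 5 4 4, iadd 6 5 4, iadd 7 6 4, iadd 8 7 4,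
    icopy 11 4]

/-- Sets up the queue, with the pair of the roots of the two syntax trees as its only entry. -/
def initQueue : Program :=
  block [icopy 10 41, icopy 12 41, iconst 11 0, iconst 40 0, icopy 41 0, iconst 42 0, push]

/-- The decision procedure for subtyping. -/
def decideSubtype : Program :=
  block [initConsts, parse, icopy 40 7, icopy 41 8, icopy 42 4, initRows, initQueue, explore,
    isub 0 2 9]

theorem vc_decideSubtype {W L : ℕ} {T U : SType} (hT : T.IsSessionType) (hU : U.IsSessionType)
    (hL : L = T.code.length + U.code.length) (hW : 5 * L + 3 * (L * L) + 5 ≤ W)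
    {Q : State → ℕ → Prop}
    (h : ∀ s c, (SubtypeC T U → s.reg 0 = 1) → (¬ SubtypeC T U → s.reg 0 = 0) →
      c ≤ (20 * L + 50 * (T.size + U.size) + 70) * L + 5 * L
        + 121 * (2 * (T.size + U.size)) ^ 2 + 50 → Q s c) :
    vc W decideSubtype Q (initState T U) 0 := by
  have inv₀ := parseInv_initState hT hU
  have hT2 := T.two_le_length_code
  have hU2 := U.two_le_length_code
  rw [← hL] at inv₀
  have r0 : (initState T U).reg 0 = T.code.length := rfl
  have r1 : (initState T U).reg 1 = U.code.length := rfl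
  have r9 : (initState T U).reg 9 = 0 := rfl
  have r10 : (initState T U).reg 10 = 0 := rfl
  generalize hs₀ : initState T U = s₀ at *
  simp only [decideSubtype, initConsts, block, vc, Function.update_apply, Nat.reduceEqDiff,
    if_true, if_false, r0, r1, ← hL]
  refine ⟨by omega, by omega, by omega, by omega, by omega, by omega, by omega, ?_⟩
  refine vc_parse (L := L) ⟨?_, ?_, ?_, ?_, ?_, ?_⟩ ?_ ?_ inv₀ (by omega)
    fun s₁ c₁ D A inv hD hfr hc₁ => ?_
  · simp
  · simp
  · simp
  · simp; omega
  · simp; omega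
  · simp; omega
  · simpa using r10
  · simp
  have hs₁ : Consts L s₁ := by
    refine ⟨?_, ?_, ?_, ?_, ?_, ?_⟩ <;> rw [hfr _ (by norm_num)] <;> simp <;> omega
  have e8 : s₁.reg 8 = 5 * L := by rw [hfr _ (by norm_num)]; simp; omega
  have e9 : s₁.reg 9 = 0 := by rw [hfr _ (by norm_num)]; simpa using r9
  have e0 : s₁.reg 0 = T.code.length := by rw [hfr _ (by norm_num)]; simpa using r0
  have hDT : D 0 T := hD _ _ (Or.inl ⟨rfl, rfl⟩)
  have hDU : D T.code.length U := hD _ _ (Or.inr ⟨rfl, rfl⟩)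
  have e7 := hs₁.length4
  have e4 := hs₁.length
  simp only [e8, e7, e4]
  have ne : ∀ r, r < 40 → r ≠ 40 ∧ r ≠ 41 ∧ r ≠ 42 := fun r hr => by omega
  refine vc_initRows (L := L) (j := 0) (hs₁.congr fun r hr => ?_) ?_ ?_ ?_ hW
    fun s₂ c₂ m₁ m₂ e41 hfr₂ hc₂ => ?_
  · simp [ne r (by omega)]
  · simp
  · simp
  · simp
  replace hfr₂ : ∀ r, r < 40 → s₂.reg r = s₁.reg r := fun r hr => by
    rw [hfr₂ r hr]; simp [ne r hr]
  have hq₀ : QueueMem s₁.mem L [] s₂.mem := by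
    refine ⟨fun x hx => m₁ x (by omega), fun a ha => m₂ a (Nat.zero_le _) ha,
      fun a ha b hb => ?_, by simp, by simp, by simp⟩
    -- The first phase leaves the cells from `4 * L` on at 0, so no pair is marked yet.
    rw [m₁ _ (by omega)]
    simpa using inv.zero _ (by omega)
  simp only [initQueue, block, vc, Function.update_apply, Nat.reduceEqDiff, if_true, if_false, e41,
    hfr₂ 0 (by norm_num), e0]
  refine ⟨by omega, by omega, by omega, ?_⟩
  have ne' : ∀ r, r < 10 → r ≠ 40 ∧ r ≠ 41 ∧ r ≠ 42 ∧ r ≠ 10 ∧ r ≠ 11 ∧ r ≠ 12 :=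
    fun r hr => by omega
  -- The second root lies at `T.code.length`, which register 0 still holds. With `B` the subtyping
  -- statement itself, the initial pair is trivially sound.
  have hroot : Sound D (SubtypeC T U) (0, T.code.length) := ⟨T, U, hDT, hDU, id⟩
  refine vc_push (m := s₁.mem) (L := L) (k := 0) (q := []) (N := Sound D (SubtypeC T U))
    ⟨hs₁.congr fun r hr => ?_, hq₀, ?_, ?_⟩ ?_ ?_ ?_ (by omega)
    fun s₃ c₃ q₃ hs₃ hg₃ hin hfr₃ hc₃ => ?_
  · simp [ne' r (by omega), hfr₂ r (by omega)]
  · simp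
  · simp
  · simp; omega
  · simp; omega
  · simpa [order] using hroot
  replace hin : (0, T.code.length) ∈ q₃ := by simpa [order] using hin
  have h9 : s₃.reg 9 = 0 := by
    rw [hfr₃ 9 (by norm_num) (by norm_num)]
    simp [hfr₂, e9]
  refine vc_explore (k := 0) (B := SubtypeC T U) inv hs₃ ?_ (fun x hx => ?_)
    (fun _ i hi => absurd hi (Nat.not_lt_zero i)) (fun h0 => absurd h9 h0) hW
    fun s₄ c₄ q₄ hs₄ hpre hsound hdone hfail hfr₄ hc₄ => ?_
  · rw [hfr₃ 10 (by norm_num) (by norm_num)]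
    simp
  · exact (hg₃.2 x hx).elim (fun h => by simp at h) id
  have hsum := inv.sum_weight_le hs₄.mem hsound
  have g2 := hs₄.consts.one
  -- The output is the truncated difference of 1 and the failure flag.
  refine h _ _ (fun hsub => ?_) (fun hsub => ?_) ?_
  · have : s₄.reg 9 = 0 := by
      by_contra h0
      exact hfail h0 hsub
    simp [g2, this]
  · have : s₄.reg 9 ≠ 0 := fun h0 =>
      hsub (inv.subtypeC (hdone h0) ⟨_, _, hpre.subset hin, hDT, hDU⟩)
    simp [g2]; omega
  · rw [List.drop_zero] at hc₄
    simp only [Nat.sub_zero] at hc₁ hc₂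
    omega

/-! ### The numerical bounds. -/

theorem initState_bounded {T U : SType} {W : ℕ} (h0 : T.code.length ≤ W) (h1 : U.code.length ≤ W)
    (h : ∀ a ∈ T.code ++ U.code, a ≤ W) : (initState T U).Bounded W := by
  refine ⟨fun r => ?_, fun a => ?_⟩
  · simp only [initState]
    split_ifs <;> omega
  · simp only [initState, List.getD_eq_getElem?_getD]
    cases e : (T.code ++ U.code)[a]? with
    | none => simp
    | some v => exact h v (List.mem_of_getElem? e)

theorem exists_exec_decideSubtype {T U : SType} (hT : T.IsSessionType) (hU : U.IsSessionType)
    {W : ℕ} (hW : 1000 * (T.size + U.size) ^ 2 ≤ W) (hcode : ∀ a ∈ T.code ++ U.code, a ≤ W) :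
    ∃ t s, Exec W decideSubtype (initState T U) t s ∧ t ≤ 1000 * (T.size + U.size) ^ 2 ∧
      (SubtypeC T U → s.reg 0 = 1) ∧ (¬ SubtypeC T U → s.reg 0 = 0) := by
  have hT1 := T.length_code_lt
  have hU1 := U.length_code_lt
  have hT2 := T.two_le_length_code
  have hU2 := U.two_le_length_code
  obtain ⟨n, hn⟩ : ∃ n, n = T.size + U.size := ⟨_, rfl⟩
  obtain ⟨L, hL⟩ : ∃ L, L = T.code.length + U.code.length := ⟨_, rfl⟩
  have hLn : L ≤ 3 * n := by omega
  have hn2 : 2 ≤ n := by omega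
  rw [← hn] at hW ⊢
  -- From `L ≤ 3 * n` and `2 ≤ n`, the time `20 L² + 50 L n + 75 L + 484 n² + 50` is at most `(180 +
  -- 150 + 112.5 + 484 + 12.5) n² = 939 n²`, which explains the constant 1000; the memory bound is
  -- far smaller.
  have hLL : L * L ≤ 9 * n ^ 2 := by nlinarith
  have hLn' : L * n ≤ 3 * n ^ 2 := by nlinarith
  have hnn : 2 * n ≤ n ^ 2 := by nlinarith
  have key := vc_decideSubtype (W := W) (L := L) hT hU hL (by omega)
    (Q := fun s c => c ≤ 1000 * n ^ 2 ∧ (SubtypeC T U → s.reg 0 = 1) ∧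
      (¬ SubtypeC T U → s.reg 0 = 0)) fun s c h1 h2 h3 => ⟨?_, h1, h2⟩
  · obtain ⟨t, s, h1, -, h2⟩ := vc_sound key
      (initState_bounded (by omega) (by omega) hcode)
    rw [zero_add] at h2
    exact ⟨t, s, h1, h2⟩
  · rw [← hn] at h3
    have e : (20 * L + 50 * n + 70) * L + 5 * L + 121 * (2 * n) ^ 2 + 50
        = 20 * (L * L) + 50 * (L * n) + 75 * L + 484 * n ^ 2 + 50 := by ring
    omega

end SessionTypes

theorem mainTheorem1 :
    (∃ (P : SessionTypes.Program) (C : ℕ), ∀ T U : SessionTypes.SType,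
      T.IsSessionType → U.IsSessionType →
      ∀ W : ℕ, C * (T.size + U.size) ^ 2 ≤ W → (∀ a ∈ T.code ++ U.code, a ≤ W) →
        ∃ (t : ℕ) (s : SessionTypes.State),
          SessionTypes.Exec W P (SessionTypes.initState T U) t s ∧
          t ≤ C * (T.size + U.size) ^ 2 ∧
          (SessionTypes.SubtypeC T U → s.reg 0 = 1) ∧
          (¬ SessionTypes.SubtypeC T U → s.reg 0 = 0)) ∧
    (∀ T U : SessionTypes.SType, T.IsSessionType → U.IsSessionType →
      (SessionTypes.SubtypeC T U ↔
        ∀ q, Relation.ReflTransGen (SessionTypes.Edge T U)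
            (SessionTypes.Node.ty T, SessionTypes.Node.ty U) q →
          ¬ SessionTypes.Inconsistent q)) :=
  ⟨⟨SessionTypes.decideSubtype, 1000, fun _ _ hT hU _ hW hcode =>
    SessionTypes.exists_exec_decideSubtype hT hU hW hcode⟩,
    fun _ _ hT hU => SessionTypes.subtypeC_iff_reachable hT hU⟩
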